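/- **Setting.** Let $(\Omega,\mathcal F,\mathbb P)$ be a complete probability space, $(K,\mathcal K)$ a measurable space, $\xi_0\in K$, $T_0=0$, and let $(T_n,\xi_n)_{n\ge1}$ be random variables with values in $[0,\infty]\times K$ such that, $\mathbb P$-a.s., $(T_n)_{n\ge 0}$ is nondecreasing, $T_n<T_{n+1}$ whenever $T_n<\infty$, and $T_n\to\infty$. Put $N_t(B)=\sum_{n\ge1}1_{T_n\le t}1_{\xi_n\in B}$ for $B\in\mathcal K$, $N_t=N_t(K)$, $p(dt\,dy)=\sum_{n\ge1,\,T_n<\infty}\delta_{(T_n,\xi_n)}(dt\,dy)$, $X_t=\xi_n$ for $T_n\le t<T_{n+1}$, $X_{0-}=X_0$, and let $(\mathcal F_t)_{t\ge0}$ be the filtration generated by the processes $N(B)$, $B\in\mathcal K$, augmented by the $\mathbb P$-null sets. Predictability ($\mathcal P$ is the predictable $\sigma$-algebra) and progressive measurability refer to $(\mathcal F_t)$. Let $A$ be the compensator of $N$: a predictable nondecreasing process with $A_0=0$ and $\mathbb E\int_0^\infty H_t\,dN_t=\mathbb E\int_0^\infty H_t\,dA_t$ for all nonnegative predictable $H$;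 assume that $\mathbb P$-a.s. $A$ has continuous trajectories. Assume that there are probability measures $\phi_t(\omega,dy)$ on $K$, with $(\omega,t)\mapsto\phi_t(\omega,B)$ predictable for every $B\in\mathcal K$, such that $\mathbb E\int_0^\infty\!\int_K H_t(y)\,p(dt\,dy)=\mathbb E\int_0^\infty\!\int_K H_t(y)\,\phi_t(dy)\,dA_t$ for all nonnegative $\mathcal P\otimes\mathcal K$-measurable $H$. Put $q(dt\,dy)=p(dt\,dy)-\phi_t(dy)\,dA_t$. Integrals $\int_a^b$ are over $(a,b]$. Fix $T>0$. For $\beta>0$ let $\mathbb K^\beta$ be the set of pairs $(Y,Z)$ with $Y$ real progressive, $Z$ real $\mathcal P\otimes\mathcal K$-measurable, and $\mathbb E\int_0^Te^{\beta A_t}|Y_t|^2dA_t+\mathbb E\int_0^T\!\int_Ke^{\beta A_t}|Z_t(y)|^2\phi_t(dy)dA_t<\infty$. Let $\mathcal L^{1,0}(p)$ be the set of real $\mathcal P\otimes\mathcal K$-measurable $Z$ with $\mathbb E\int_0^T\!\int_K|Z_t(y)|\,\phi_t(dy)dA_t<\infty$. **Control problem.** Let $(U,\mathcal U)$ be a measurable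 space, let $r,l:\Omega\times[0,T]\times K\times U\to\mathbb R$ be $\mathcal P\otimes\mathcal K\otimes\mathcal U$-measurable with, $\mathbb P$-a.s., $0\le r_t(y,u)\le C_r$ and $|l_t(y,u)|\le C_l$ for all $t\in[0,T]$, $y\in K$, $u\in U$, where $C_r>1$ and $C_l>0$ are constants, and let $g:\Omega\times K\to\mathbb R$ be $\mathcal F_T\otimes\mathcal K$-measurable. The set $\mathcal A$ of admissible controls consists of all predictable $U$-valued processes on $[0,T]$. For $u\in\mathcal A$ put $$L^u_T=\exp\Big(\int_0^T\!\!\int_K(1-r_s(y,u_s))\,\phi_s(dy)\,dA_s\Big)\prod_{n\ge1:\,T_n\le T}r_{T_n}(\xi_n,u_{T_n}),\qquad \mathbb P_u(d\omega)=L^u_T(\omega)\,\mathbb P(d\omega),$$ $$J(u)=\mathbb E_u\Big[\int_0^Tl_t(X_t,u_t)\,dA_t+g(X_T)\Big],$$ where $\mathbb E_u$ is the integral with respect to $\mathbb P_u$. The Hamiltonian is $$f(\omega,t,x,z)=\inf_{u\in U}\Big\{l_t(\omega,x,u)+\int_Kz(y)\,(r_t(\omega,y,u)-1)\,\phi_t(\omega,dy)\Big\}.$$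 Assume that for every $Z\in\mathcal L^{1,0}(p)$ there is $\underline u^Z\in\mathcal A$ such that, for $dA_t(\omega)\mathbb P(d\omega)$-almost all $(\omega,t)\in\Omega\times[0,T]$, $$f(\omega,t,X_{t-},Z_t)=l_t(X_{t-},\underline u^Z_t)+\int_KZ_t(y)\,\big(r_t(y,\underline u^Z_t)-1\big)\,\phi_t(dy).\qquad(*)$$ **Theorem.** Under these assumptions, suppose that $\mathbb E\exp((3+C_r^4)A_T)<\infty$ and that $\beta$ is such that $\beta>\sup|r-1|^2$ (supremum over $t\in[0,T]$, $y\in K$, $u\in U$ and over $\omega$ outside a $\mathbb P$-null set), $\mathbb E\,e^{\beta A_T}<\infty$ and $\mathbb E[|g(X_T)|^2e^{\beta A_T}]<\infty$. Let $(Y,Z)\in\mathbb K^\beta$ solve the BSDE: $\mathbb P$-a.s., for all $t\in[0,T]$, $$Y_t+\int_t^T\!\!\int_KZ_s(y)\,q(ds\,dy)=g(X_T)+\int_t^Tf(s,X_s,Z_s(\cdot))\,dA_s.$$ Then: 1. for every $u\in\mathcal A$, $\mathbb P_u$ is a probability measure and the random variable $\int_0^Tl_t(X_t,u_t)\,dA_t+g(X_T)$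 is $\mathbb P_u$-integrable; 2. there is $u^*\in\mathcal A$ satisfying $(*)$ for the $Z$ of the solution (that is, with $u^*$ in place of $\underline u^Z$); 3. every such $u^*$ is optimal and $Y_0$ is the optimal cost: $\mathbb P$-a.s. $Y_0=J(u^*)$, and $J(u^*)=\min_{u\in\mathcal A}J(u)=\inf_{u\in\mathcal A}J(u)$. -/

import Mathlib

open MeasureTheory Filter Topology Set
open scoped ENNReal NNReal

namespace MPPControl

noncomputable section

/-- A nonexplosive marked point process `(T_n, ξ_n)_{n ≥ 1}` with marks in `K`, completed by
`T_0 = 0` and a deterministic initial mark `ξ_0`.  A time equal to `∞` means that the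
corresponding point does not occur. -/
structure MarkedPointProcess {Ω : Type*} [MeasurableSpace Ω] (P : Measure Ω)
    (K : Type*) [MeasurableSpace K] where
  /-- the times `T_n` -/
  time : ℕ → Ω → ℝ≥0∞
  /-- the marks `ξ_n` -/
  mark : ℕ → Ω → K
  /-- the deterministic initial mark `ξ_0` -/
  initMark : K
  measurable_time : ∀ n, Measurable (time n)
  measurable_mark : ∀ n, Measurable (mark n)
  time_zero : ∀ ω, time 0 ω = 0
  mark_zero : ∀ ω, mark 0 ω = initMark
  time_mono : ∀ᵐ ω ∂P, Monotone fun n => time n ω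
  time_strict : ∀ᵐ ω ∂P, ∀ n, time n ω < ∞ → time n ω < time (n + 1) ω
  nonexplosive : ∀ᵐ ω ∂P, Tendsto (fun n => time n ω) atTop (𝓝 ∞)

namespace MarkedPointProcess

variable {Ω : Type*} [mΩ : MeasurableSpace Ω] {P : Measure Ω} {K : Type*} [MeasurableSpace K]

open scoped Classical in
/-- The counting process `N_t(B) = ∑_{n ≥ 1} 1_{T_n ≤ t} 1_{ξ_n ∈ B}`. -/
def count (M : MarkedPointProcess P K) (t : ℝ≥0) (B : Set K) (ω : Ω) : ℝ≥0∞ :=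
  ∑' n : ℕ, if M.time (n + 1) ω ≤ (t : ℝ≥0∞) ∧ M.mark (n + 1) ω ∈ B then 1 else 0

lemma measurable_count (M : MarkedPointProcess P K) (t : ℝ≥0) {B : Set K}
    (hB : MeasurableSet B) : Measurable (M.count t B) := by
  classical
  refine Measurable.tsum fun n => Measurable.ite ?_ measurable_const measurable_const
  exact (measurableSet_le (M.measurable_time _) measurable_const).inter
    (M.measurable_mark _ hB)

/-- The filtration generated by the counting processes, augmented by the `P`-null sets:
`𝓕_t = σ(N_s(B) : s ≤ t, B measurable) ∨ σ(null sets)`. -/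
def filtration (M : MarkedPointProcess P K) [hP : P.IsComplete] : Filtration ℝ≥0 mΩ where
  seq t := (⨆ (s : ℝ≥0) (_ : s ≤ t) (B : Set K) (_ : MeasurableSet B),
      MeasurableSpace.comap (M.count s B) inferInstance) ⊔
    MeasurableSpace.generateFrom {N : Set Ω | P N = 0}
  mono' := by
    intro t t' h
    refine sup_le_sup_right (iSup_mono fun s => ?_) _
    exact iSup_mono' fun hs => ⟨hs.trans h, le_rfl⟩
  le' := by
    intro t
    refine sup_le ?_ (MeasurableSpace.generateFrom_le fun N hN => hP.out N hN)
    refine iSup_le fun s => iSup_le fun _ => iSup_le fun B => iSup_le fun hB => ?_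
    exact (M.measurable_count s hB).comap_le

open scoped Classical in
/-- The piecewise constant process `X_t = ξ_n` for `T_n ≤ t < T_{n+1}`. -/
def X (M : MarkedPointProcess P K) (t : ℝ≥0) (ω : Ω) : K :=
  if h : ∃ n, M.time n ω ≤ (t : ℝ≥0∞) ∧ (t : ℝ≥0∞) < M.time (n + 1) ω then
    M.mark (Nat.find h) ω
  else M.initMark

open scoped Classical in
/-- The left limit `X_{t-} = ξ_n` for `T_n < t ≤ T_{n+1}`, with `X_{0-} = X_0 = ξ_0`. -/
def leftX (M : MarkedPointProcess P K) (t : ℝ≥0) (ω : Ω) : K :=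
  if h : ∃ n, M.time n ω < (t : ℝ≥0∞) ∧ (t : ℝ≥0∞) ≤ M.time (n + 1) ω then
    M.mark (Nat.find h) ω
  else M.initMark

open scoped Classical in
/-- The random measure `p(ω, dt dy) = ∑_{n ≥ 1, T_n < ∞} δ_{(T_n, ξ_n)}`. -/
def p (M : MarkedPointProcess P K) (ω : Ω) : Measure (ℝ≥0 × K) :=
  Measure.sum fun n : ℕ =>
    if M.time (n + 1) ω < ∞ then
      Measure.dirac ((M.time (n + 1) ω).toNNReal, M.mark (n + 1) ω)
    else 0

end MarkedPointProcess

/-- The Stieltjes measure `da` on `[0, ∞)` of a nondecreasing function `a`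
(it gives no mass to `{0}`); the zero measure if `a` is not nondecreasing. -/
def stieltjes (a : ℝ≥0 → ℝ) : Measure ℝ≥0 :=
  open scoped Classical in
  if h : Monotone a then h.stieltjesFunction.measure else 0

variable {Ω : Type*} [mΩ : MeasurableSpace Ω] {P : Measure Ω} [P.IsComplete]
  {K : Type*} [mK : MeasurableSpace K] {U : Type*} [mU : MeasurableSpace U]

/-- The compensator `φ_t(dy) dA_t` of the random measure `p`, where `A` is the compensator of
`N`; the process `A` is assumed to have continuous trajectories. -/
structure Compensator (M : MarkedPointProcess P K) where
  /-- the compensator `A` of `N` -/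
  A : ℝ≥0 → Ω → ℝ
  /-- the transition probabilities `φ_t(ω, dy)` -/
  φ : ℝ≥0 → Ω → Measure K
  A_predictable : Measurable[M.filtration.predictable] fun x : ℝ≥0 × Ω => A x.1 x.2
  A_zero : ∀ᵐ ω ∂P, A 0 ω = 0
  A_mono : ∀ᵐ ω ∂P, Monotone fun t => A t ω
  A_continuous : ∀ᵐ ω ∂P, Continuous fun t => A t ω
  /-- `E ∫ H dN = E ∫ H dA` for nonnegative predictable `H` -/
  A_dual : ∀ H : ℝ≥0 × Ω → ℝ≥0∞, Measurable[M.filtration.predictable] H →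
    ∫⁻ ω, ∫⁻ t in Ioi 0, H (t, ω) ∂(M.p ω).fst ∂P =
      ∫⁻ ω, ∫⁻ t in Ioi 0, H (t, ω) ∂(stieltjes fun t => A t ω) ∂P
  φ_prob : ∀ t ω, IsProbabilityMeasure (φ t ω)
  φ_predictable : ∀ B : Set K, MeasurableSet B →
    Measurable[M.filtration.predictable] fun x : ℝ≥0 × Ω => φ x.1 x.2 B
  /-- `E ∫∫ H_t(y) p(dt dy) = E ∫∫ H_t(y) φ_t(dy) dA_t` for nonnegative
  `𝓟 ⊗ 𝓚`-measurable `H` -/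
  φ_dual : ∀ H : (ℝ≥0 × Ω) × K → ℝ≥0∞,
    Measurable[M.filtration.predictable.prod mK] H →
    ∫⁻ ω, ∫⁻ x in Ioi 0 ×ˢ univ, H ((x.1, ω), x.2) ∂(M.p ω) ∂P =
      ∫⁻ ω, ∫⁻ t in Ioi 0, ∫⁻ y, H ((t, ω), y) ∂(φ t ω) ∂(stieltjes fun t => A t ω) ∂P

namespace Compensator

variable {M : MarkedPointProcess P K} (C : Compensator M)

/-- The random measure `dA_t(ω)` on `(0, T]`. -/
def dA (T : ℝ≥0) (ω : Ω) : Measure ℝ≥0 :=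
  (stieltjes fun t => C.A t ω).restrict (Ioc 0 T)

/-! Processes on `[0, T]` are represented by processes on `[0, ∞)`, of which only the restriction
to `[0, T]` is ever used; every predictable (progressive) process on `[0, T]` extends to a
predictable (progressive) process on `[0, ∞)`. -/

/-- Progressive real processes `Y` with `E ∫_0^T e^{β A_t} |Y_t|² dA_t < ∞`. -/
def MemL2Prog (T : ℝ≥0) (β : ℝ) (Y : ℝ≥0 → Ω → ℝ) : Prop :=
  IsStronglyProgressive M.filtration Y ∧
    ∫⁻ ω, ∫⁻ t, ENNReal.ofReal (Real.exp (β * C.A t ω) * (Y t ω) ^ 2) ∂(C.dA T ω) ∂P < ∞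

/-- `𝓟 ⊗ 𝓚`-measurable `Z` with `E ∫_0^T ∫_K e^{β A_t} |Z_t(y)|² φ_t(dy) dA_t < ∞`. -/
def MemL2 (T : ℝ≥0) (β : ℝ) (Z : ℝ≥0 → Ω → K → ℝ) : Prop :=
  Measurable[M.filtration.predictable.prod mK]
      (fun x : (ℝ≥0 × Ω) × K => Z x.1.1 x.1.2 x.2) ∧
    ∫⁻ ω, ∫⁻ t, ∫⁻ y, ENNReal.ofReal (Real.exp (β * C.A t ω) * (Z t ω y) ^ 2)
      ∂(C.φ t ω) ∂(C.dA T ω) ∂P < ∞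

/-- `𝓟 ⊗ 𝓚`-measurable `Z` with `E ∫_0^T ∫_K |Z_t(y)| φ_t(dy) dA_t < ∞`. -/
def MemL1 (T : ℝ≥0) (Z : ℝ≥0 → Ω → K → ℝ) : Prop :=
  Measurable[M.filtration.predictable.prod mK]
      (fun x : (ℝ≥0 × Ω) × K => Z x.1.1 x.1.2 x.2) ∧
    ∫⁻ ω, ∫⁻ t, ∫⁻ y, ENNReal.ofReal |Z t ω y| ∂(C.φ t ω) ∂(C.dA T ω) ∂P < ∞

/-- `∫_t^T ∫_K Z_s(y) q(ds dy)`, where `q = p - φ_s(dy) dA_s`, over the interval `(t, T]`. -/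
def stochInt (T : ℝ≥0) (Z : ℝ≥0 → Ω → K → ℝ) (t : ℝ≥0) (ω : Ω) : ℝ :=
  (∫ x in Ioc t T ×ˢ univ, Z x.1 ω x.2 ∂(M.p ω)) -
    ∫ s in Ioc t T, (∫ y, Z s ω y ∂(C.φ s ω)) ∂(C.dA T ω)

/-- The Hamiltonian
`f(ω, t, x, z) = inf_u { l_t(ω, x, u) + ∫_K z(y) (r_t(ω, y, u) - 1) φ_t(ω, dy) }`. -/
def hamiltonian (r l : ℝ≥0 → Ω → K → U → ℝ) (ω : Ω) (t : ℝ≥0) (x : K) (z : K → ℝ) : ℝ :=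
  ⨅ u : U, (l t ω x u + ∫ y, z y * (r t ω y u - 1) ∂(C.φ t ω))

/-- `(Y, Z)` satisfies, almost surely, for all `t ∈ [0, T]`,
`Y_t + ∫_t^T ∫_K Z_s(y) q(ds dy) = g(X_T) + ∫_t^T f(s, X_s, Z_s(·)) dA_s`. -/
def SolvesBSDE (T : ℝ≥0) (r l : ℝ≥0 → Ω → K → U → ℝ) (g : Ω → K → ℝ)
    (Y : ℝ≥0 → Ω → ℝ) (Z : ℝ≥0 → Ω → K → ℝ) : Prop :=
  ∀ᵐ ω ∂P, ∀ t ≤ T,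
    Y t ω + C.stochInt T Z t ω =
      g ω (M.X T ω) + ∫ s in Ioc t T, C.hamiltonian r l ω s (M.X s ω) (Z s ω) ∂(C.dA T ω)

/-- `u` attains the infimum in the Hamiltonian at `(t, X_{t-}, Z_t(·))`, for almost all `(ω, t)`
with respect to `dA_t(ω) P(dω)` on `Ω × [0, T]`. -/
def IsMinimizingSelector (T : ℝ≥0) (r l : ℝ≥0 → Ω → K → U → ℝ) (Z : ℝ≥0 → Ω → K → ℝ)
    (u : ℝ≥0 → Ω → U) : Prop :=
  ∀ᵐ ω ∂P, ∀ᵐ t ∂(C.dA T ω),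
    C.hamiltonian r l ω t (M.leftX t ω) (Z t ω) =
      l t ω (M.leftX t ω) (u t ω) + ∫ y, Z t ω y * (r t ω y (u t ω) - 1) ∂(C.φ t ω)

/-- The density process
`L_t = exp(∫_0^t ∫_K (1 - r_s(y, u_s)) φ_s(dy) dA_s) ∏_{n ≥ 1, T_n ≤ t} r_{T_n}(ξ_n, u_{T_n})`. -/
def density (r : ℝ≥0 → Ω → K → U → ℝ) (u : ℝ≥0 → Ω → U) (t : ℝ≥0) (ω : Ω) : ℝ :=
  Real.exp (∫ s, (∫ y, (1 - r s ω y (u s ω)) ∂(C.φ s ω)) ∂(C.dA t ω)) *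
    ∏ᶠ n ∈ {n : ℕ | 1 ≤ n ∧ M.time n ω ≤ (t : ℝ≥0∞)},
      r (M.time n ω).toNNReal ω (M.mark n ω) (u (M.time n ω).toNNReal ω)

/-- The measure `P_u(dω) = L_T(ω) P(dω)`. -/
def controlMeasure (T : ℝ≥0) (r : ℝ≥0 → Ω → K → U → ℝ) (u : ℝ≥0 → Ω → U) : Measure Ω :=
  P.withDensity fun ω => ENNReal.ofReal (C.density r u T ω)

/-- The pathwise cost `∫_0^T l_t(X_t, u_t) dA_t + g(X_T)`. -/
def pathCost (T : ℝ≥0) (l : ℝ≥0 → Ω → K → U → ℝ) (g : Ω → K → ℝ) (u : ℝ≥0 → Ω → U)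
    (ω : Ω) : ℝ :=
  (∫ t, l t ω (M.X t ω) (u t ω) ∂(C.dA T ω)) + g ω (M.X T ω)

/-- The cost functional `J(u) = E_u [∫_0^T l_t(X_t, u_t) dA_t + g(X_T)]`. -/
def J (T : ℝ≥0) (r l : ℝ≥0 → Ω → K → U → ℝ) (g : Ω → K → ℝ) (u : ℝ≥0 → Ω → U) : ℝ :=
  ∫ ω, C.pathCost T l g u ω ∂(C.controlMeasure T r u)

end Compensator

/-- Admissible controls: predictable processes with values in `U`. -/
def Admissible (M : MarkedPointProcess P K) (u : ℝ≥0 → Ω → U) : Prop :=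
  Measurable[M.filtration.predictable] fun x : ℝ≥0 × Ω => u x.1 x.2

/-- The standing conditions on the data `r`, `l`, `g` of the control problem. -/
structure ControlHypothesis (M : MarkedPointProcess P K) (T : ℝ≥0)
    (r l : ℝ≥0 → Ω → K → U → ℝ) (g : Ω → K → ℝ) (Cr Cl : ℝ) : Prop where
  r_measurable : Measurable[(M.filtration.predictable.prod mK).prod mU]
    fun x : ((ℝ≥0 × Ω) × K) × U => r x.1.1.1 x.1.1.2 x.1.2 x.2
  l_measurable : Measurable[(M.filtration.predictable.prod mK).prod mU]
    fun x : ((ℝ≥0 × Ω) × K) × U => l x.1.1.1 x.1.1.2 x.1.2 x.2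
  one_lt_Cr : 1 < Cr
  Cl_pos : 0 < Cl
  bounds : ∀ᵐ ω ∂P, ∀ t ≤ T, ∀ (y : K) (u : U),
    0 ≤ r t ω y u ∧ r t ω y u ≤ Cr ∧ |l t ω y u| ≤ Cl
  g_measurable : Measurable[(M.filtration T).prod mK] fun x : Ω × K => g x.1 x.2

/-- For every `Z` with `E ∫_0^T ∫_K |Z| φ dA < ∞` the infimum in the Hamiltonian is attained
along a predictable process. -/
def HamiltonianHypothesis {M : MarkedPointProcess P K} (C : Compensator M) (T : ℝ≥0)
    (r l : ℝ≥0 → Ω → K → U → ℝ) : Prop :=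
  ∀ Z : ℝ≥0 → Ω → K → ℝ, C.MemL1 T Z →
    ∃ u : ℝ≥0 → Ω → U, Admissible M u ∧ C.IsMinimizingSelector T r l Z u

end

end MPPControl

open MPPControl

/-! The proof is verification by change of measure. Under `P_u` the compensator of `p` is `r_t(y,
u_t) φ_t(dy) dA_t` instead of `φ_t(dy) dA_t`. At time `0` the BSDE writes `Y_0` as `g(X_T)` plus the
integral of the Hamiltonian minus the integral of `Z` against `q`. Take the mean under `P_u`: the
integral of `Z` against `p` may be replaced by the integral of `Z r φ dA`, and what remains is `Y_0
= J(u) - E_u ∫ (h^u - f) dA`, where `h^u` is the expression minimized in the Hamiltonian, taken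
along `u`. The integrand is nonnegative and vanishes when `u` attains the infimum. `Y_0` is almost
surely a number because `𝓕_0` is trivial up to null sets, and `X` may be exchanged with `X_-`
because `dA` has no atoms. This is `Compensator.initial_value_le_J`.

Two facts about the density carry this. The first is that it has mean one. For a bounded predictable
field `R` and `a ≥ 0`, the left-continuous process `D = doleans R a` is predictable and solves a
linear equation path by path (`exp_mul_prod_eq`). The duality defining the compensator turns that
equation into `E D_end + a E ∫ D dA = 1`, provided `E ∫ D dA < ∞`. If `R` is replaced by `1` after
`n` points, `D` is at most `exp(A_T) max(1, c)^n` and the proviso holds; Fatou's lemma then gives `≤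
1` for every bounded `R`. Applying this to `R^4`, together with `doleans R 0 ^ 4 ≤ doleans (R^4) a *
exp((3 + a + c^4) A_T)`, yields the missing integrability: `a = 1` gives `E ∫ D dA < ∞`, hence mean
one for `R` itself, and `a = 0` gives `E D_end^2 < ∞`. The exponent `3 + C_r^4` comes from here.

The second fact is the new compensator, `lintegral_doleans_mul_jumps`. It is obtained without
martingale theory, by a variational argument: the densities of the fields `R (1 + ε H)` all have
mean one, and differentiating at `ε = 0` says that under the density of `R` the integrals of `H`
against `p` and against `R φ dA` have equal means. Monotone convergence removes the restrictions on
`H`. The integrability of `Z` under `P_u` follows from that of `D_end^2`, the weighted norm of `Z`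
and `∫ exp(-β A) dA ≤ 1/β`. -/

namespace MPPControl

/-! ### Exponentials of primitives with respect to an atomless measure -/

section Exponential

variable {μ : Measure ℝ≥0}

lemma measurable_integral_Iio [SFinite μ] {k : ℝ≥0 → ℝ} (hk : Measurable k) :
    Measurable fun t => ∫ s in Iio t, k s ∂μ := by
  have h : StronglyMeasurable fun x : ℝ≥0 × ℝ≥0 => (Iio x.1).indicator k x.2 := by
    have : (fun x : ℝ≥0 × ℝ≥0 => (Iio x.1).indicator k x.2) =
        {x : ℝ≥0 × ℝ≥0 | x.2 < x.1}.indicator fun x => k x.2 := by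
      ext x; simp [indicator]
    rw [this]
    exact ((hk.comp measurable_snd).indicator
      (measurableSet_lt measurable_snd measurable_fst)).stronglyMeasurable
  have := (h.integral_prod_right' (ν := μ)).measurable
  simpa [integral_indicator measurableSet_Iio] using this

/-- Integration by parts: by Fubini the product is an integral over the square, which splits into
two open triangles, since the diagonal is null for the product of an atomless measure with itself.
-/
lemma integral_mul_integral_eq [SFinite μ] [NullSingletonClass μ] {f g : ℝ≥0 → ℝ} (hf : Integrable f μ)
    (hg : Integrable g μ) :
    (∫ x, f x ∂μ) * ∫ x, g x ∂μ =
      (∫ x, f x * ∫ y in Iio x, g y ∂μ ∂μ) + ∫ y, g y * ∫ x in Iio y, f x ∂μ ∂μ := by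
  have hfg : Integrable (fun z : ℝ≥0 × ℝ≥0 => f z.1 * g z.2) (μ.prod μ) := hf.mul_prod hg
  set S : Set (ℝ≥0 × ℝ≥0) := {z | z.2 < z.1} with hS
  have hSm : MeasurableSet S := measurableSet_lt measurable_snd measurable_fst
  set S' : Set (ℝ≥0 × ℝ≥0) := {z | z.1 < z.2} with hS'
  have hSm' : MeasurableSet S' := measurableSet_lt measurable_fst measurable_snd
  have hae : ∀ᵐ z ∂(μ.prod μ), z ∉ S ↔ z ∈ S' := by
    have : (μ.prod μ) {z : ℝ≥0 × ℝ≥0 | z.1 = z.2} = 0 := by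
      rw [Measure.prod_apply (measurableSet_eq_fun measurable_fst measurable_snd)]
      refine lintegral_eq_zero_of_ae_eq_zero (ae_of_all _ fun x => ?_)
      have : Prod.mk x ⁻¹' {z : ℝ≥0 × ℝ≥0 | z.1 = z.2} = {x} := by ext y; simp [eq_comm]
      simp [this]
    filter_upwards [measure_eq_zero_iff_ae_notMem.1 this] with z hz
    simp only [hS, hS', mem_ofPred_eq, not_lt] at hz ⊢
    exact ⟨fun h => lt_of_le_of_ne h hz, le_of_lt⟩
  rw [← integral_prod_mul, ← integral_add_compl hSm hfg]
  congr 1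
  · rw [← integral_indicator hSm, integral_prod _ (hfg.indicator hSm)]
    refine integral_congr_ae (ae_of_all _ fun x => ?_)
    simp only
    rw [← integral_const_mul, ← integral_indicator measurableSet_Iio]
    rfl
  · rw [setIntegral_congr_set (t := S') (by
        filter_upwards [hae] with z hz; exact propext hz),
      ← integral_indicator hSm', integral_prod_symm _ (hfg.indicator hSm')]
    refine integral_congr_ae (ae_of_all _ fun x => ?_)
    simp only
    rw [← integral_const_mul, ← integral_indicator measurableSet_Iio]
    refine integral_congr_ae (ae_of_all _ fun y => ?_)
    simp [indicator, hS', mul_comm]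

lemma setIntegral_Iio_restrict_Iio {k : ℝ≥0 → ℝ} {x t : ℝ≥0} (h : x ≤ t) :
    ∫ y in Iio x, k y ∂(μ.restrict (Iio t)) = ∫ y in Iio x, k y ∂μ := by
  rw [Measure.restrict_restrict measurableSet_Iio, inter_eq_left.2 (Iio_subset_Iio h)]

lemma abs_integral_Iio_le {k : ℝ≥0 → ℝ} (hi : Integrable k μ) (t : ℝ≥0) :
    |∫ y in Iio t, k y ∂μ| ≤ ∫ y, |k y| ∂μ :=
  (abs_integral_le_integral_abs).trans
    (setIntegral_le_integral hi.abs (ae_of_all _ fun _ => abs_nonneg _))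

lemma integrable_pow_integral_Iio_mul [SFinite μ] {k : ℝ≥0 → ℝ} (hk : Measurable k)
    (hi : Integrable k μ) (n : ℕ) : Integrable (fun s => (∫ y in Iio s, k y ∂μ) ^ n * k s) μ := by
  refine hi.bdd_mul (c := (∫ y, |k y| ∂μ) ^ n)
    ((measurable_integral_Iio hk).pow_const n).aestronglyMeasurable (ae_of_all _ fun t => ?_)
  rw [Real.norm_eq_abs, abs_pow]
  exact pow_le_pow_left₀ (abs_nonneg _) (abs_integral_Iio_le hi t) n

/-- The chain rule for powers. Induction on `n`: integrating the product of `F^(n+1)` and `F` by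
parts produces `n + 1` copies of the integral of `F^(n+1) k` from one triangle and one copy from the
other. -/
lemma integral_pow_integral_Iio [SFinite μ] [NullSingletonClass μ] {k : ℝ≥0 → ℝ} (hk : Measurable k)
    (hi : Integrable k μ) (n : ℕ) (t : ℝ≥0) :
    ((n : ℝ) + 1) * ∫ s in Iio t, (∫ y in Iio s, k y ∂μ) ^ n * k s ∂μ =
      (∫ y in Iio t, k y ∂μ) ^ (n + 1) := by
  induction n generalizing t with
  | zero => simp
  | succ n ih =>
    have hi' := integrable_pow_integral_Iio_mul hk hi n
    have key := integral_mul_integral_eq (μ := μ.restrict (Iio t)) hi'.restrict hi.restrict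
    rw [pow_succ, ← ih t, mul_assoc, key]
    have e1 : ∫ x in Iio t, ((∫ y in Iio x, k y ∂μ) ^ n * k x) *
        ∫ y in Iio x, k y ∂(μ.restrict (Iio t)) ∂μ =
        ∫ s in Iio t, (∫ y in Iio s, k y ∂μ) ^ (n + 1) * k s ∂μ := by
      refine setIntegral_congr_fun measurableSet_Iio fun x hx => ?_
      rw [setIntegral_Iio_restrict_Iio (le_of_lt hx)]
      ring
    have e2 : ((n : ℝ) + 1) * ∫ y in Iio t, k y *
        ∫ x in Iio y, ((∫ y in Iio x, k y ∂μ) ^ n * k x) ∂(μ.restrict (Iio t)) ∂μ =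
        ∫ s in Iio t, (∫ y in Iio s, k y ∂μ) ^ (n + 1) * k s ∂μ := by
      rw [← integral_const_mul]
      refine setIntegral_congr_fun measurableSet_Iio fun x hx => ?_
      rw [setIntegral_Iio_restrict_Iio (le_of_lt hx), ← ih x]
      ring
    rw [mul_add, e1, e2]
    push_cast
    ring

/-- The exponential of the primitive of `k` with respect to an atomless measure solves
`dE = E k dμ`. -/
lemma exp_integral_Iio [SFinite μ] [NullSingletonClass μ] {k : ℝ≥0 → ℝ} (hk : Measurable k)
    (hi : Integrable k μ) (t : ℝ≥0) :
    Real.exp (∫ y in Iio t, k y ∂μ) =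
      1 + ∫ s in Iio t, Real.exp (∫ y in Iio s, k y ∂μ) * k s ∂μ := by
  set F : ℝ≥0 → ℝ := fun t => ∫ y in Iio t, k y ∂μ with hF
  set c := ∫ y, |k y| ∂μ
  have hc : ∀ s, |F s| ≤ c := fun s => abs_integral_Iio_le hi s
  -- The exponential series is integrated term by term; since `|F| ≤ c`, the terms are dominated by
  -- those of the series of `exp c` times `|k|`.
  have hsum : HasSum (fun n : ℕ => ∫ s in Iio t, (F s) ^ n * k s / (n.factorial : ℝ) ∂μ)
      (∫ s in Iio t, Real.exp (F s) * k s ∂μ) := by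
    refine hasSum_integral_of_dominated_convergence
      (fun n s => c ^ n / (n.factorial : ℝ) * |k s|) (fun n => ?_) (fun n => ?_) ?_ ?_ ?_
    · exact ((integrable_pow_integral_Iio_mul hk hi n).div_const _).aestronglyMeasurable.restrict
    · refine ae_of_all _ fun s => ?_
      rw [Real.norm_eq_abs, abs_div, abs_mul, abs_pow, Nat.abs_cast, div_mul_eq_mul_div]
      have := hc s
      gcongr
    · exact ae_of_all _ fun s => (Real.summable_pow_div_factorial c).mul_right _
    · simp_rw [tsum_mul_right]
      exact (hi.abs.restrict).const_mul _
    · refine ae_of_all _ fun s => ?_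
      have := (NormedSpace.expSeries_div_hasSum_exp (𝔸 := ℝ) (F s)).mul_right (k s)
      rw [← Real.exp_eq_exp_ℝ] at this
      simpa only [div_mul_eq_mul_div] using this
  have h2 : HasSum (fun n : ℕ => (F t) ^ (n + 1) / ((n + 1).factorial : ℝ))
      (∫ s in Iio t, Real.exp (F s) * k s ∂μ) := by
    refine hsum.congr_fun ?_
    intro n
    rw [integral_div, ← integral_pow_integral_Iio hk hi n t, Nat.factorial_succ]
    push_cast
    have : (n.factorial : ℝ) ≠ 0 := by positivity
    field_simp
    rfl
  have h3 := (NormedSpace.expSeries_div_hasSum_exp (𝔸 := ℝ) (F t))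
  -- Integration raises every power by one, so the zeroth term of the series is not produced; it is
  -- the summand `1` in the claim.
  rw [← Real.exp_eq_exp_ℝ, ← hasSum_nat_add_iff' 1] at h3
  have := h3.unique h2
  simp at this
  linarith

end Exponential

end MPPControl

namespace MPPControl

/-! ### Finite products over jumps and the pathwise Doléans-Dade equation -/

section JumpProduct

variable {K : Type*} [MeasurableSpace K]

/-- The product of `R` over the atoms of the point measure `J` with time coordinate in `[0, s)`,
written through logarithms. -/
noncomputable def jumpProd (J : Measure (ℝ≥0 × K)) (R : ℝ≥0 × K → ℝ) (s : ℝ≥0) : ℝ :=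
  if J (R ⁻¹' {0} ∩ Iio s ×ˢ univ) = 0 then
    Real.exp ((∫⁻ z in Iio s ×ˢ univ, ENNReal.ofReal (Real.log (R z)) ∂J).toReal -
      (∫⁻ z in Iio s ×ˢ univ, ENNReal.ofReal (-Real.log (R z)) ∂J).toReal)
  else 0

lemma lintegral_sum_dirac_restrict {m : ℕ} {τ : ℕ → ℝ≥0} {ξ : ℕ → K} {f : ℝ≥0 × K → ℝ≥0∞}
    (hf : Measurable f) (s : ℝ≥0) :
    ∫⁻ z in Iio s ×ˢ univ, f z ∂(∑ j ∈ Finset.range m, Measure.dirac (τ j, ξ j)) =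
      ∑ j ∈ Finset.range m with τ j < s, f (τ j, ξ j) := by
  have hs : MeasurableSet (Iio s ×ˢ (univ : Set K)) := measurableSet_Iio.prod MeasurableSet.univ
  rw [← lintegral_indicator hs, lintegral_finsetSum_measure, Finset.sum_filter]
  refine Finset.sum_congr rfl fun j _ => ?_
  rw [lintegral_dirac' _ (hf.indicator hs)]
  simp [indicator]

/-- Integrals of the positive and negative parts of `log R` make the product visibly measurable in
the point measure. As `Real.log 0 = 0`, a vanishing factor would be invisible to them, hence the
separate case in `jumpProd`. -/
lemma jumpProd_sum_dirac {m : ℕ} {τ : ℕ → ℝ≥0} {ξ : ℕ → K} {R : ℝ≥0 × K → ℝ}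
    (hR : Measurable R) (hR0 : ∀ z, 0 ≤ R z) (s : ℝ≥0) :
    jumpProd (∑ j ∈ Finset.range m, Measure.dirac (τ j, ξ j)) R s =
      ∏ j ∈ Finset.range m with τ j < s, R (τ j, ξ j) := by
  classical
  have hs : MeasurableSet (Iio s ×ˢ (univ : Set K)) := measurableSet_Iio.prod MeasurableSet.univ
  have h0 : (∑ j ∈ Finset.range m, Measure.dirac (τ j, ξ j)) (R ⁻¹' {0} ∩ Iio s ×ˢ univ) = 0 ↔
      ∀ j ∈ Finset.range m, τ j < s → R (τ j, ξ j) ≠ 0 := by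
    rw [Measure.finsetSum_apply, Finset.sum_eq_zero_iff]
    refine forall₂_congr fun j _ => ?_
    rw [Measure.dirac_apply' _ ((hR (measurableSet_singleton 0)).inter hs)]
    simp only [indicator, mem_inter_iff, mem_preimage, mem_singleton_iff, mem_prod, mem_Iio,
      mem_univ, and_true, Pi.one_apply, ite_eq_right_iff, one_ne_zero, imp_false, not_and]
    tauto
  unfold jumpProd
  split_ifs with h
  · rw [h0] at h
    rw [lintegral_sum_dirac_restrict (f := fun z => ENNReal.ofReal (Real.log (R z))) (by fun_prop),
      lintegral_sum_dirac_restrict (f := fun z => ENNReal.ofReal (-Real.log (R z))) (by fun_prop),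
      ENNReal.toReal_sum (by simp), ENNReal.toReal_sum (by simp), ← Finset.sum_sub_distrib,
      Real.exp_sum]
    refine Finset.prod_congr rfl fun j hj => ?_
    rw [Finset.mem_filter] at hj
    have hpos : 0 < R (τ j, ξ j) := lt_of_le_of_ne (hR0 _) (h j hj.1 hj.2).symm
    rw [ENNReal.toReal_ofReal', ENNReal.toReal_ofReal', max_zero_sub_max_neg_zero_eq_self,
      Real.exp_log hpos]
  · rw [h0] at h
    push Not at h
    obtain ⟨j, hj, hjs, hz⟩ := h
    exact (Finset.prod_eq_zero (Finset.mem_filter.2 ⟨hj, hjs⟩) hz).symm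

/-- A telescoping sum: each jump changes the product by its value just before the jump times `ρ j -
1`. -/
lemma prod_filter_eq_one_add_sum {m : ℕ} {τ : ℕ → ℝ≥0}
    (hτ : ∀ i j, i < j → j < m → τ i < τ j) (ρ : ℕ → ℝ) (s : ℝ≥0) :
    ∏ j ∈ Finset.range m with τ j < s, ρ j =
      1 + ∑ j ∈ Finset.range m with τ j < s,
        (∏ i ∈ Finset.range m with τ i < τ j, ρ i) * (ρ j - 1) := by
  -- The product of `1 + (ρ j - 1)` is expanded according to the largest index at which the second
  -- summand is chosen. As `τ` is increasing, smaller indices are the same as earlier times.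
  have h := Finset.prod_add_ordered ((Finset.range m).filter (τ · < s)) (fun _ => (1 : ℝ))
    (fun j => ρ j - 1)
  simp only [add_sub_cancel, Finset.prod_const_one, mul_one] at h
  rw [h]
  congr 1
  refine Finset.sum_congr rfl fun j hj => ?_
  rw [mul_comm]
  congr 1
  refine Finset.prod_congr ?_ fun _ _ => rfl
  ext i
  simp only [Finset.mem_filter, Finset.mem_range] at hj ⊢
  constructor
  · rintro ⟨⟨hi, _⟩, hij⟩
    exact ⟨hi, hτ i j hij hj.1⟩
  · rintro ⟨hi, hij⟩
    refine ⟨⟨hi, hij.trans hj.2⟩, ?_⟩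
    by_contra hcon
    rcases (not_lt.1 hcon).eq_or_lt with h | h
    · exact absurd (h ▸ hij) (lt_irrefl _)
    · exact absurd (hτ j i h hi) hij.asymm

lemma measurable_prod_filter {m : ℕ} (τ : ℕ → ℝ≥0) (ρ : ℕ → ℝ) :
    Measurable fun s => ∏ j ∈ Finset.range m with τ j < s, ρ j := by
  simp_rw [Finset.prod_filter]
  exact Finset.measurable_prod _ fun j _ =>
    Measurable.ite (measurableSet_lt measurable_const measurable_id) measurable_const
      measurable_const

/-- The Doléans-Dade formula for the product of an exponential of a primitive and a finite product
over jumps. -/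
lemma exp_mul_prod_eq {a : Measure ℝ≥0} [IsFiniteMeasure a] [NullSingletonClass a]
    {k : ℝ≥0 → ℝ} (hk : Measurable k) (hi : Integrable k a) {m : ℕ} {τ : ℕ → ℝ≥0}
    (hτ : ∀ i j, i < j → j < m → τ i < τ j) (ρ : ℕ → ℝ) {S : ℝ≥0} (hS : ∀ j < m, τ j < S)
    (D : ℝ≥0 → ℝ)
    (hD : ∀ s, D s = Real.exp (∫ v in Iio s, k v ∂a) *
      ∏ j ∈ Finset.range m with τ j < s, ρ j) :
    Integrable (fun v => D v * k v) a ∧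
    D S = 1 + ∑ j ∈ Finset.range m, D (τ j) * (ρ j - 1) + ∫ v in Iio S, D v * k v ∂a := by
  set E : ℝ≥0 → ℝ := fun s => Real.exp (∫ v in Iio s, k v ∂a) with hE
  set Q : ℝ≥0 → ℝ := fun s => ∏ j ∈ Finset.range m with τ j < s, ρ j with hQ
  have hEi : Integrable (fun v => E v * k v) a := by
    refine hi.bdd_mul (c := Real.exp (∫ y, |k y| ∂a))
      (Real.measurable_exp.comp (measurable_integral_Iio hk)).aestronglyMeasurable
      (ae_of_all _ fun t => ?_)
    rw [Real.norm_eq_abs, abs_of_pos (Real.exp_pos _)]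
    exact Real.exp_le_exp.2 ((le_abs_self _).trans (abs_integral_Iio_le hi t))
  -- The equation for `E`, restarted at `s`. Applied at each `τ j`, it separates the jump
  -- contribution at `τ j` from the later continuous growth of what the jump added.
  have hexp : ∀ s, s ≤ S → E S = E s + ∫ v in Iio S, (Ici s).indicator (fun v => E v * k v) v ∂a := by
    intro s hs
    rw [hE]
    simp only
    rw [exp_integral_Iio hk hi S, exp_integral_Iio hk hi s, add_assoc]
    congr 1
    rw [← integral_indicator measurableSet_Iio, ← integral_indicator measurableSet_Iio,
      ← integral_indicator measurableSet_Iio, ← integral_add]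
    · refine integral_congr_ae (ae_of_all _ fun v => ?_)
      by_cases h1 : v < s
      · simp [indicator, h1, h1.trans_le hs]
      · by_cases h2 : v < S <;> simp [indicator, h1, h2, not_lt.1 h1]
    · exact hEi.indicator measurableSet_Iio
    · exact (hEi.indicator measurableSet_Ici).indicator measurableSet_Iio
  have hQ1 : ∀ s, Q s = 1 + ∑ j ∈ Finset.range m with τ j < s, Q (τ j) * (ρ j - 1) :=
    prod_filter_eq_one_add_sum hτ ρ
  have hQS : Q S = 1 + ∑ j ∈ Finset.range m, Q (τ j) * (ρ j - 1) := by
    rw [hQ1 S, Finset.filter_true_of_mem fun j hj => hS j (Finset.mem_range.1 hj)]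
  -- Jump times are null, so it does not matter that `Q v` counts the jumps with `τ j < v` while the
  -- restarted integral begins at `τ j` inclusively.
  have hne : ∀ᵐ v ∂a, ∀ j, τ j ≠ v := by
    rw [ae_all_iff]
    intro j
    have : a {τ j} = 0 := measure_singleton _
    filter_upwards [measure_eq_zero_iff_ae_notMem.1 this] with v hv h
    exact hv h.symm
  have hDi : Integrable (fun v => D v * k v) a := by
    have : (fun v => D v * k v) = fun v => Q v * (E v * k v) := by
      ext v; rw [hD]; ring
    rw [this]
    refine hEi.bdd_mul (c := ∏ j ∈ Finset.range m, max 1 |ρ j|)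
      (measurable_prod_filter τ ρ).aestronglyMeasurable (ae_of_all _ fun v => ?_)
    rw [Real.norm_eq_abs, hQ, Finset.abs_prod, Finset.prod_filter]
    refine Finset.prod_le_prod (fun j _ => by split_ifs <;> positivity) fun j _ => ?_
    split_ifs <;> simp
  refine ⟨hDi, ?_⟩
  have hint : ∀ j, Integrable (fun v => Q (τ j) * (ρ j - 1) *
      (Ici (τ j)).indicator (fun v => E v * k v) v) (a.restrict (Iio S)) :=
    fun j => ((hEi.indicator measurableSet_Ici).restrict).const_mul _
  calc D S = E S * Q S := hD S
    _ = E S + ∑ j ∈ Finset.range m, Q (τ j) * (ρ j - 1) * E S := by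
      rw [hQS, mul_add, mul_one, Finset.mul_sum]
      simp_rw [mul_comm (E S)]
    _ = E S + ∑ j ∈ Finset.range m, (D (τ j) * (ρ j - 1) + ∫ v in Iio S, Q (τ j) * (ρ j - 1) *
          (Ici (τ j)).indicator (fun v => E v * k v) v ∂a) := by
      congr 1
      refine Finset.sum_congr rfl fun j hj => ?_
      rw [integral_const_mul, hexp (τ j) (hS j (Finset.mem_range.1 hj)).le, hD (τ j), mul_add]
      congr 1
      change _ = E (τ j) * Q (τ j) * _
      ring
    _ = 1 + ∑ j ∈ Finset.range m, D (τ j) * (ρ j - 1) + (∫ v in Iio S, E v * k v ∂a +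
          ∫ v in Iio S, ∑ j ∈ Finset.range m, Q (τ j) * (ρ j - 1) *
          (Ici (τ j)).indicator (fun v => E v * k v) v ∂a) := by
      rw [Finset.sum_add_distrib, integral_finsetSum _ fun j _ => hint j]
      have : E S = 1 + ∫ v in Iio S, E v * k v ∂a := exp_integral_Iio hk hi S
      linarith
    _ = _ := by
      rw [← integral_add hEi.restrict (integrable_finsetSum _ fun j _ => hint j)]
      congr 1
      refine integral_congr_ae (ae_restrict_of_ae ?_)
      filter_upwards [hne] with v hv
      have h1 : ∑ j ∈ Finset.range m, Q (τ j) * (ρ j - 1) *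
          (Ici (τ j)).indicator (fun v => E v * k v) v = (Q v - 1) * (E v * k v) := by
        rw [hQ1 v, add_sub_cancel_left, Finset.sum_mul, Finset.sum_filter]
        refine Finset.sum_congr rfl fun j _ => ?_
        rcases lt_or_gt_of_ne (hv j) with h | h
        · simp [indicator, h, h.le]
        · simp [indicator, h.not_ge, h.asymm]
      rw [h1, hD v]
      change _ = E v * Q v * k v
      ring

end JumpProduct

end MPPControl

/-! ### The predictable σ-algebra and predictable primitives -/

namespace MPPControl

set_option linter.unusedSectionVars false

variable {Ω : Type*} [mΩ : MeasurableSpace Ω] {P : Measure Ω} [P.IsComplete]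
  {K : Type*} [mK : MeasurableSpace K]

/-- The space `[0, ∞) × Ω` endowed with the predictable σ-algebra. -/
def PredSpace (_M : MarkedPointProcess P K) : Type _ := ℝ≥0 × Ω

noncomputable instance (M : MarkedPointProcess P K) : MeasurableSpace (PredSpace M) :=
  M.filtration.predictable

namespace PredSpace

/-- The point `(t, ω)` of the predictable space. -/
def mk (M : MarkedPointProcess P K) (x : ℝ≥0 × Ω) : PredSpace M := x

variable {M : MarkedPointProcess P K}

/-- The time coordinate of a point of the predictable space. -/
def time (x : PredSpace M) : ℝ≥0 := Prod.fst x

/-- The sample point of a point of the predictable space. -/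
def pt (x : PredSpace M) : Ω := Prod.snd x

@[simp] lemma time_mk (t : ℝ≥0) (ω : Ω) : (mk M (t, ω)).time = t := rfl

@[simp] lemma pt_mk (t : ℝ≥0) (ω : Ω) : (mk M (t, ω)).pt = ω := rfl

end PredSpace

namespace MarkedPointProcess

variable (M : MarkedPointProcess P K)

/-- Predictable sets are jointly measurable, so paths of predictable processes are measurable
functions of time. -/
lemma measurable_predSpace_mk : Measurable (PredSpace.mk M) := by
  rw [measurable_iff_comap_le, MeasurableSpace.comap_le_iff_le_map]
  refine measurableSpace_le_predictable_of_measurableSet ?_ ?_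
  · intro A hA
    exact (measurableSet_singleton _).prod (M.filtration.le _ _ hA)
  · intro i A hA
    exact measurableSet_Ioi.prod (M.filtration.le _ _ hA)

variable {M}

lemma measurableSet_filtration_of_null {N : Set Ω} (hN : P N = 0) (t : ℝ≥0) :
    MeasurableSet[M.filtration t] N := by
  have h : MeasurableSpace.generateFrom {N : Set Ω | P N = 0} ≤ M.filtration t := le_sup_right
  exact h _ (MeasurableSpace.measurableSet_generateFrom hN)

lemma measurable_count_filtration {s t : ℝ≥0} (h : s ≤ t) {B : Set K} (hB : MeasurableSet B) :
    Measurable[M.filtration t] (M.count s B) := by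
  have hle : MeasurableSpace.comap (M.count s B) inferInstance ≤ M.filtration t :=
    le_sup_of_le_left (le_iSup₂_of_le s h (le_iSup₂_of_le B hB le_rfl))
  exact (comap_measurable _).mono hle le_rfl

/-- Sections at a fixed time of predictable maps are adapted. -/
lemma measurable_filtration_of_predictable {β : Type*} [MeasurableSpace β] {f : PredSpace M → β}
    (hf : Measurable f) (t : ℝ≥0) :
    Measurable[M.filtration t] fun ω => f (PredSpace.mk M (t, ω)) := by
  have h1 := measurable_inclusion_predictable (𝓕 := M.filtration) (i := t)
  have h2 : @Measurable Ω (Set.Iic t × Ω) (M.filtration t)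
      (Subtype.instMeasurableSpace.prod (M.filtration t)) fun ω => (⟨t, mem_Iic.2 le_rfl⟩, ω) :=
    @measurable_prodMk_left _ _ _ (M.filtration t) _
  exact hf.comp (h1.comp h2)

/-- A quantity known at time `q` and used only after `q` is predictable. For indicators these are
the generators `(q, ∞) × A`; the rest is approximation by simple functions. -/
lemma measurable_indicator_Ioi {q : ℝ≥0} {f : Ω → ℝ≥0∞} (hf : Measurable[M.filtration q] f) :
    Measurable fun x : PredSpace M => if q < x.time then f x.pt else 0 := by
  refine @Measurable.ennreal_induction _ (M.filtration q) (fun f =>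
    Measurable fun x : PredSpace M => if q < x.time then f x.pt else 0) ?_ ?_ ?_ f hf
  · intro c s hs
    have : (fun x : PredSpace M => if q < x.time then s.indicator (fun _ => c) x.pt else 0) =
        Set.indicator {x : PredSpace M | q < x.time ∧ x.pt ∈ s} fun _ => c := by
      ext x
      by_cases h1 : q < x.time <;> by_cases h2 : x.pt ∈ s <;> simp [indicator, h1, h2]
    rw [this]
    refine measurable_const.indicator ?_
    exact measurableSet_predictable_Ioi_prod hs
  · intro f g _ _ _ hf hg
    convert hf.add hg using 2 with x
    simp only [Pi.add_apply]
    split_ifs <;> simp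
  · intro f _ _ hf
    convert Measurable.iSup hf using 2 with x
    split_ifs <;> simp

/-- Integrals over `(0, s)` of predictable integrands against an adapted random measure are
predictable. -/
lemma measurable_lintegral_Ioo {E : Type*} [MeasurableSpace E] {ρ : Ω → Measure (ℝ≥0 × E)}
    [∀ ω, IsFiniteMeasure (ρ ω)]
    (hρ : ∀ q B, MeasurableSet B → Measurable[M.filtration q] fun ω => ρ ω (Ioc 0 q ×ˢ B))
    {G : PredSpace M × E → ℝ≥0∞} (hG : Measurable G) :
    Measurable fun x : PredSpace M =>
      ∫⁻ z in Ioo 0 x.time ×ˢ univ, G (PredSpace.mk M (z.1, x.pt), z.2) ∂(ρ x.pt) := by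
  have hsec : ∀ ω, Measurable fun z : ℝ≥0 × E => ((PredSpace.mk M (z.1, ω), z.2) : PredSpace M × E) :=
    fun ω => (M.measurable_predSpace_mk.comp (measurable_fst.prodMk measurable_const)).prodMk
      measurable_snd
  have hIoo : ∀ t : ℝ≥0, MeasurableSet (Ioo 0 t ×ˢ (univ : Set E)) :=
    fun t => measurableSet_Ioo.prod MeasurableSet.univ
  -- The generators of the predictable σ-algebra. They form a π-system, so a Dynkin argument on
  -- rectangles over them reaches every measurable set of `PredSpace M × E`.
  set gen : Set (Set (PredSpace M)) := {s | ∃ A, MeasurableSet[M.filtration ⊥] A ∧ s = {⊥} ×ˢ A} ∪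
    {s | ∃ i A, MeasurableSet[M.filtration i] A ∧ s = Set.Ioi i ×ˢ A} with hgen
  have hpi : IsPiSystem gen := by
    have hempty : (∅ : Set (PredSpace M)) ∈ gen :=
      Or.inr ⟨0, ∅, @MeasurableSet.empty _ (M.filtration 0), prod_empty.symm⟩
    rintro _ (⟨A, hA, rfl⟩ | ⟨i, A, hA, rfl⟩) _ (⟨B, hB, rfl⟩ | ⟨j, B, hB, rfl⟩) -
    · refine Or.inl ⟨A ∩ B, hA.inter hB, ?_⟩
      exact (prod_inter_prod).trans (by rw [inter_self])
    · have : (({⊥} ×ˢ A) ∩ (Ioi j ×ˢ B) : Set (PredSpace M)) = ∅ := by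
        refine prod_inter_prod.trans ?_
        have : ({⊥} ∩ Ioi j : Set ℝ≥0) = ∅ := by ext x; simp +contextual
        rw [this, empty_prod]; rfl
      rw [this]; exact hempty
    · have : ((Ioi i ×ˢ A) ∩ ({⊥} ×ˢ B) : Set (PredSpace M)) = ∅ := by
        refine prod_inter_prod.trans ?_
        have : (Ioi i ∩ {⊥} : Set ℝ≥0) = ∅ := by ext x; simp +contextual
        rw [this, empty_prod]; rfl
      rw [this]; exact hempty
    · refine Or.inr ⟨max i j, A ∩ B, (M.filtration.mono (le_max_left i j) _ hA).inter
        (M.filtration.mono (le_max_right i j) _ hB), ?_⟩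
      exact prod_inter_prod.trans (by rw [Ioi_inter_Ioi])
  have hset : ∀ (i : ℝ≥0) (A : Set Ω) (B : Set E), MeasurableSet[M.filtration i] A →
      MeasurableSet B → Measurable fun x : PredSpace M =>
        ρ x.pt {z | z.1 ∈ Ioo i x.time ∧ x.pt ∈ A ∧ z.2 ∈ B} := by
    intro i A B hA hB
    classical
    -- Left-continuity in time gives predictability: the mass of `(i, t)` is the supremum, over
    -- countably many rational `q < t`, of the mass of `(i, q]`, which is known at time `q`.
    -- Negative rationals become `0` and contribute nothing.
    set e : ℚ → ℝ≥0 := fun q => Real.toNNReal q with he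
    have hq : ∀ q : ℚ, Measurable fun x : PredSpace M => if e q < x.time then
        (if i < e q ∧ x.pt ∈ A then ρ x.pt (Ioc i (e q) ×ˢ B) else 0) else 0 := by
      intro q
      by_cases hiq : i < e q
      swap
      · simp only [hiq, false_and, if_false, ite_self]
        exact measurable_const
      simp only [hiq, true_and]
      refine measurable_indicator_Ioi (f := fun ω => if ω ∈ A then ρ ω (Ioc i (e q) ×ˢ B) else 0) ?_
      suffices h : Measurable[M.filtration (e q)] fun ω => ρ ω (Ioc i (e q) ×ˢ B) from
        h.indicator (M.filtration.mono hiq.le _ hA)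
      -- Adaptedness is assumed only for intervals starting at `0`; the others are differences,
      -- which finiteness of `ρ ω` permits.
      have : ∀ ω, ρ ω (Ioc i (e q) ×ˢ B) = ρ ω (Ioc 0 (e q) ×ˢ B) - ρ ω (Ioc 0 i ×ˢ B) := by
        intro ω
        rw [← measure_sdiff (prod_mono_left (Ioc_subset_Ioc_right hiq.le))
          (measurableSet_Ioc.prod hB).nullMeasurableSet (measure_ne_top _ _)]
        congr 1
        ext z
        simp only [mem_prod, mem_Ioc, Set.mem_sdiff]
        constructor
        · rintro ⟨⟨h1, h2⟩, h3⟩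
          exact ⟨⟨⟨(zero_le).trans_lt h1, h2⟩, h3⟩, fun h => absurd h.1.2 (not_le.2 h1)⟩
        · rintro ⟨⟨⟨h1, h2⟩, h3⟩, h4⟩
          exact ⟨⟨not_le.1 fun h => h4 ⟨⟨h1, h⟩, h3⟩, h2⟩, h3⟩
      simp_rw [this]
      exact (hρ (e q) B hB).sub ((hρ i B hB).mono (M.filtration.mono hiq.le) le_rfl)
    convert Measurable.iSup hq using 2 with x
    by_cases hA' : x.pt ∈ A
    swap
    · simp [hA']
    have hU : {z : ℝ≥0 × E | z.1 ∈ Ioo i x.time ∧ x.pt ∈ A ∧ z.2 ∈ B} =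
        ⋃ q : ℚ, if e q < x.time then Ioc i (e q) ×ˢ B else ∅ := by
      ext z
      simp only [mem_ofPred_eq, mem_iUnion]
      constructor
      · rintro ⟨⟨h1, h2⟩, _, h3⟩
        obtain ⟨q, -, hq1, hq2⟩ := (NNReal.lt_iff_exists_rat_btwn _ _).1 h2
        exact ⟨q, by simp [he, hq2, h1, h3, hq1.le]⟩
      · rintro ⟨q, hq⟩
        split_ifs at hq with h
        · exact ⟨⟨hq.1.1, hq.1.2.trans_lt h⟩, hA', hq.2⟩
        · exact absurd hq (notMem_empty _)
    rw [hU, Directed.measure_iUnion]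
    · refine iSup_congr fun q => ?_
      by_cases h1 : e q < x.time
      · by_cases h2 : i < e q
        · simp [h1, h2, hA']
        · simp [h1, h2]
      · simp [h1]
    · intro q q'
      by_cases h1 : e q < x.time
      · by_cases h2 : e q' < x.time
        · rcases le_total (e q) (e q') with h | h
          · exact ⟨q', by simpa [h1, h2] using prod_mono_left (Ioc_subset_Ioc_right h), le_rfl⟩
          · exact ⟨q, le_rfl, by simpa [h1, h2] using prod_mono_left (Ioc_subset_Ioc_right h)⟩
        · exact ⟨q, le_rfl, by simp [h2]⟩
      · exact ⟨q', by simp [h1], le_rfl⟩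
  have hmeas : ∀ s : Set (PredSpace M × E), MeasurableSet s → Measurable fun x : PredSpace M =>
      ρ x.pt ((fun z : ℝ≥0 × E => ((PredSpace.mk M (z.1, x.pt), z.2) : PredSpace M × E)) ⁻¹' s ∩
        Ioo 0 x.time ×ˢ univ) := by
    have huniv : Measurable fun x : PredSpace M => ρ x.pt (Ioo 0 x.time ×ˢ (univ : Set E)) := by
      convert hset 0 univ univ MeasurableSet.univ MeasurableSet.univ using 3 with x
      ext z; simp
    refine MeasurableSpace.induction_on_inter (m := Prod.instMeasurableSpace)
      (s := image2 (· ×ˢ ·) gen {t : Set E | MeasurableSet t}) ?_ ?_ ?_ ?_ ?_ ?_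
    · have h1 : IsCountablySpanning gen := by
        refine ⟨fun n => if n = 0 then {⊥} ×ˢ univ else Ioi 0 ×ˢ univ, fun n => ?_, ?_⟩
        · by_cases hn : n = 0
          · exact Or.inl ⟨univ, MeasurableSet.univ, if_pos hn⟩
          · exact Or.inr ⟨0, univ, MeasurableSet.univ, if_neg hn⟩
        · refine eq_univ_of_forall fun x => mem_iUnion.2 ?_
          rcases eq_or_ne x.time 0 with h | h
          · exact ⟨0, h, trivial⟩
          · exact ⟨1, pos_iff_ne_zero.2 h, trivial⟩
      have h2 := generateFrom_eq_prod (C := gen) (D := {t : Set E | MeasurableSet t}) rfl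
        MeasurableSpace.generateFrom_measurableSet h1 isCountablySpanning_measurableSet
      exact h2.symm
    · exact hpi.prod MeasurableSpace.isPiSystem_measurableSet
    · simp
    · rintro _ ⟨s, (⟨A, hA, rfl⟩ | ⟨i, A, hA, rfl⟩), B, hB, rfl⟩
      -- Generators carried by time `0` do not meet `(0, t)`.
      · convert (measurable_const (a := (0 : ℝ≥0∞))) using 2 with x
        convert measure_empty (μ := ρ x.pt) using 2
        ext z
        simp only [mem_inter_iff, mem_preimage, mem_prod, mem_Ioo, mem_univ, and_true,
          mem_empty_iff_false, iff_false]
        rintro ⟨⟨⟨h1, -⟩, -⟩, h2, -⟩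
        exact h2.ne' h1
      · convert hset i A B hA hB using 3 with x
        ext z
        simp only [mem_inter_iff, mem_preimage, mem_prod, mem_Ioo, mem_univ, and_true,
          mem_ofPred_eq]
        constructor
        · rintro ⟨⟨⟨h1, h2⟩, h3⟩, h4, h5⟩
          exact ⟨⟨h1, h5⟩, h2, h3⟩
        · rintro ⟨⟨h1, h2⟩, h3, h4⟩
          exact ⟨⟨⟨h1, h3⟩, h4⟩, (zero_le).trans_lt h1, h2⟩
    · intro t ht h
      convert huniv.sub h using 2 with x
      rw [Pi.sub_apply, ← measure_sdiff inter_subset_right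
        (((hsec x.pt) ht).inter (hIoo _)).nullMeasurableSet (measure_ne_top _ _)]
      congr 1
      ext z; simp; tauto
    · intro f hd hf h
      have h' : Measurable fun x : PredSpace M => ∑' i, ρ x.pt
          ((fun z : ℝ≥0 × E => ((PredSpace.mk M (z.1, x.pt), z.2) : PredSpace M × E)) ⁻¹' f i ∩
            Ioo 0 x.time ×ˢ univ) := Measurable.tsum h
      convert h' using 2 with x
      rw [preimage_iUnion, iUnion_inter, measure_iUnion]
      · intro i j hij
        exact ((hd hij).preimage _).mono inter_subset_left inter_subset_left
      · exact fun i => ((hsec x.pt) (hf i)).inter (hIoo _)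
  refine hG.ennreal_induction ?_ ?_ ?_
  · intro c s hs
    convert (hmeas s hs).const_mul c using 2 with x
    have : MeasurableSet
        ((fun z : ℝ≥0 × E => ((PredSpace.mk M (z.1, x.pt), z.2) : PredSpace M × E)) ⁻¹' s) :=
      hsec x.pt hs
    rw [← Measure.restrict_apply this, ← lintegral_indicator_const this]
    rfl
  · intro f g _ hf _ hf' hg'
    convert hf'.add hg' using 2 with x
    exact lintegral_add_left (hf.comp (hsec x.pt)) _
  · intro f hf hm hf'
    convert Measurable.iSup hf' using 2 with x
    exact lintegral_iSup (fun n => (hf n).comp (hsec x.pt)) fun i j hij z => hm hij _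

end MarkedPointProcess

end MPPControl

/-! ### Jump measure and clock on `(0, T]`, and their duality -/

namespace MPPControl

set_option linter.unusedSectionVars false

variable {Ω : Type*} [mΩ : MeasurableSpace Ω] {P : Measure Ω} [P.IsComplete]
  {K : Type*} [mK : MeasurableSpace K]

namespace Compensator

variable {M : MarkedPointProcess P K} (C : Compensator M) (T : ℝ≥0)

/-- The almost sure path properties of the point process and of its compensator. -/
structure Regular (ω : Ω) : Prop where
  time_mono : Monotone fun n => M.time n ω
  time_strict : ∀ n, M.time n ω < ∞ → M.time n ω < M.time (n + 1) ω
  nonexplosive : Tendsto (fun n => M.time n ω) atTop (𝓝 ∞)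
  A_zero : C.A 0 ω = 0
  A_mono : Monotone fun t => C.A t ω
  A_continuous : Continuous fun t => C.A t ω

lemma ae_regular : ∀ᵐ ω ∂P, C.Regular ω := by
  filter_upwards [M.time_mono, M.time_strict, M.nonexplosive, C.A_zero, C.A_mono, C.A_continuous]
    with ω h1 h2 h3 h4 h5 h6 using ⟨h1, h2, h3, h4, h5, h6⟩

/-- The complement is a null set and the filtration is augmented. Hence `jumps` and `clock` can be
set to zero on it and stay adapted, which makes later path properties valid for every `ω`. -/
lemma measurableSet_regular (t : ℝ≥0) : MeasurableSet[M.filtration t] {ω | C.Regular ω} := by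
  have : P {ω | C.Regular ω}ᶜ = 0 := C.ae_regular
  have h := MarkedPointProcess.measurableSet_filtration_of_null (M := M) this t
  exact MeasurableSet.of_compl h

open scoped Classical in
/-- The restriction of the random measure `p` to `(0, T] × K`, set to zero off the regular set. -/
noncomputable def jumps (ω : Ω) : Measure (ℝ≥0 × K) :=
  if C.Regular ω then (M.p ω).restrict (Ioc 0 T ×ˢ univ) else 0

open scoped Classical in
/-- The random measure `dA` on `(0, T]`, set to zero off the regular set. -/
noncomputable def clock (ω : Ω) : Measure ℝ≥0 := if C.Regular ω then C.dA T ω else 0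

variable {C}

lemma Regular.time_pos {ω : Ω} (h : C.Regular ω) (n : ℕ) : 0 < M.time (n + 1) ω := by
  have h1 : M.time 0 ω < M.time 1 ω := h.time_strict 0 (by simp [M.time_zero])
  rw [M.time_zero] at h1
  exact h1.trans_le (h.time_mono (by omega))

lemma Regular.exists_count {ω : Ω} (h : C.Regular ω) :
    ∃ m : ℕ, ∀ j, M.time (j + 1) ω ≤ T ↔ j < m := by
  have hex : ∃ j, (T : ℝ≥0∞) < M.time (j + 1) ω := by
    have := Tendsto.eventually_const_lt (ENNReal.coe_lt_top (r := T))
      (h.nonexplosive.comp (tendsto_add_atTop_nat 1))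
    exact this.exists
  classical
  refine ⟨Nat.find hex, fun j => ⟨fun hj => ?_, fun hj => not_lt.1 (Nat.find_min hex hj)⟩⟩
  by_contra hcon
  exact absurd hj (not_le.2 ((Nat.find_spec hex).trans_le (h.time_mono (by omega))))

lemma Regular.jumps_eq {ω : Ω} (h : C.Regular ω) {m : ℕ}
    (hm : ∀ j, M.time (j + 1) ω ≤ T ↔ j < m) :
    C.jumps T ω = ∑ j ∈ Finset.range m,
      Measure.dirac ((M.time (j + 1) ω).toNNReal, M.mark (j + 1) ω) := by
  have hS : MeasurableSet (Ioc 0 T ×ˢ (univ : Set K)) := measurableSet_Ioc.prod MeasurableSet.univ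
  ext s hs
  rw [jumps, if_pos h, Measure.restrict_apply hs, MarkedPointProcess.p,
    Measure.sum_apply _ (hs.inter hS), Measure.finsetSum_apply, tsum_eq_sum (s := Finset.range m)]
  · refine Finset.sum_congr rfl fun j hj => ?_
    have hj' := (hm j).2 (Finset.mem_range.1 hj)
    have hfin : M.time (j + 1) ω < ∞ := hj'.trans_lt ENNReal.coe_lt_top
    rw [if_pos hfin, Measure.dirac_apply' _ (hs.inter hS), Measure.dirac_apply' _ hs]
    have hmem : ((M.time (j + 1) ω).toNNReal, M.mark (j + 1) ω) ∈ Ioc 0 T ×ˢ (univ : Set K) :=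
      ⟨⟨ENNReal.toNNReal_pos (h.time_pos j).ne' hfin.ne,
        by simpa using ENNReal.toNNReal_mono ENNReal.coe_ne_top hj'⟩, trivial⟩
    by_cases hjs : ((M.time (j + 1) ω).toNNReal, M.mark (j + 1) ω) ∈ s
    · rw [indicator_of_mem hjs, indicator_of_mem (mem_inter hjs hmem)]
    · rw [indicator_of_notMem hjs, indicator_of_notMem fun h => hjs h.1]
  · intro j hj
    split_ifs with hfin
    · rw [Measure.dirac_apply' _ (hs.inter hS), indicator_of_notMem]
      rintro ⟨-, hmem, -⟩
      have h1 : (M.time (j + 1) ω).toNNReal ≤ T := hmem.2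
      rw [← ENNReal.coe_le_coe, ENNReal.coe_toNNReal hfin.ne, hm j] at h1
      exact hj (Finset.mem_range.2 h1)
    · simp

lemma Regular.toNNReal_time_lt {ω : Ω} (h : C.Regular ω) {m : ℕ}
    (hm : ∀ j, M.time (j + 1) ω ≤ T ↔ j < m) (i j : ℕ) (hij : i < j) (hj : j < m) :
    (M.time (i + 1) ω).toNNReal < (M.time (j + 1) ω).toNNReal := by
  have hj' := ((hm j).2 hj).trans_lt ENNReal.coe_lt_top
  have hi' := ((hm i).2 (hij.trans hj)).trans_lt ENNReal.coe_lt_top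
  refine ENNReal.toNNReal_strict_mono hj'.ne ?_
  exact (h.time_strict _ hi').trans_le (h.time_mono (by omega))

variable (C)

/-- Nonexplosion leaves finitely many points in `(0, T]`; off the regular set the measure is zero
and `m = 0` serves. Every pathwise computation starts from this form. -/
lemma exists_jumps_eq (ω : Ω) : ∃ (m : ℕ) (τ : ℕ → ℝ≥0) (ξ : ℕ → K),
    (∀ i j, i < j → j < m → τ i < τ j) ∧ (∀ j < m, 0 < τ j ∧ τ j ≤ T) ∧
      C.jumps T ω = ∑ j ∈ Finset.range m, Measure.dirac (τ j, ξ j) := by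
  by_cases h : C.Regular ω
  · obtain ⟨m, hm⟩ := h.exists_count T
    refine ⟨m, _, _, h.toNNReal_time_lt T hm, fun j hj => ?_, h.jumps_eq T hm⟩
    have hj' := (hm j).2 hj
    exact ⟨ENNReal.toNNReal_pos (h.time_pos j).ne' (hj'.trans_lt ENNReal.coe_lt_top).ne,
      by simpa using ENNReal.toNNReal_mono ENNReal.coe_ne_top hj'⟩
  · refine ⟨0, fun _ => 0, fun _ => M.initMark, by simp, by simp, ?_⟩
    simp [jumps, h]

instance (ω : Ω) : IsFiniteMeasure (C.jumps T ω) := by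
  obtain ⟨m, τ, ξ, -, -, h⟩ := C.exists_jumps_eq T ω
  rw [h]; infer_instance

lemma ae_mem_Ioc_jumps (ω : Ω) : ∀ᵐ z ∂(C.jumps T ω), z.1 ∈ Ioc 0 T := by
  by_cases h : C.Regular ω
  · rw [jumps, if_pos h]
    filter_upwards [ae_restrict_mem (measurableSet_Ioc.prod MeasurableSet.univ)] with z hz
    exact hz.1
  · simp [jumps, h]

/-- The mass is the counting process at time `min q T`, so the jump measure is adapted to the
filtration generated by these processes. -/
lemma jumps_apply_Ioc (ω : Ω) (q : ℝ≥0) {B : Set K} (hB : MeasurableSet B) :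
    C.jumps T ω (Ioc 0 q ×ˢ B) = {ω | C.Regular ω}.indicator (M.count (min q T) B) ω := by
  classical
  by_cases h : C.Regular ω
  swap
  · simp [jumps, h]
  have hS : MeasurableSet (Ioc 0 q ×ˢ B) := measurableSet_Ioc.prod hB
  rw [indicator_of_mem (by exact h), jumps, if_pos h, Measure.restrict_apply hS, prod_inter_prod,
    Ioc_inter_Ioc, max_self, inter_univ, MarkedPointProcess.p,
    Measure.sum_apply _ (measurableSet_Ioc.prod hB), MarkedPointProcess.count]
  refine tsum_congr fun n => ?_
  by_cases hfin : M.time (n + 1) ω < ∞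
  · have h1 : (M.time (n + 1) ω).toNNReal ≤ min q T ↔ M.time (n + 1) ω ≤ ((min q T : ℝ≥0) : ℝ≥0∞) := by
      rw [← ENNReal.coe_le_coe, ENNReal.coe_toNNReal hfin.ne]
    have h2 : 0 < (M.time (n + 1) ω).toNNReal := ENNReal.toNNReal_pos (h.time_pos n).ne' hfin.ne
    rw [if_pos hfin, Measure.dirac_apply' _ (measurableSet_Ioc.prod hB)]
    simp only [indicator, mem_prod, mem_Ioc, h2, true_and, h1, Pi.one_apply]
  · have : ¬ M.time (n + 1) ω ≤ ((min q T : ℝ≥0) : ℝ≥0∞) :=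
      fun h' => hfin (h'.trans_lt ENNReal.coe_lt_top)
    rw [if_neg hfin, if_neg fun h => this h.1]
    rfl

lemma measurable_jumps_Ioc (q : ℝ≥0) (B : Set K) (hB : MeasurableSet B) :
    Measurable[M.filtration q] fun ω => C.jumps T ω (Ioc 0 q ×ˢ B) := by
  simp_rw [C.jumps_apply_Ioc T _ q hB]
  exact (MarkedPointProcess.measurable_count_filtration (min_le_left _ _) hB).indicator
    (C.measurableSet_regular q)

lemma Regular.stieltjes_Ioc {C : Compensator M} {ω : Ω} (h : C.Regular ω) (s t : ℝ≥0) :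
    stieltjes (fun t => C.A t ω) (Ioc s t) = ENNReal.ofReal (C.A t ω - C.A s ω) := by
  have h' : Monotone fun t => C.A t ω := h.A_mono
  rw [stieltjes, dif_pos h', StieltjesFunction.measure_Ioc, h'.stieltjesFunction_eq,
    h'.stieltjesFunction_eq, (h.A_continuous.continuousAt).continuousWithinAt.rightLim_eq,
    (h.A_continuous.continuousAt).continuousWithinAt.rightLim_eq]

lemma Regular.stieltjes_singleton {C : Compensator M} {ω : Ω} (h : C.Regular ω) (t : ℝ≥0) :
    stieltjes (fun t => C.A t ω) {t} = 0 := by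
  have h' : Monotone fun t => C.A t ω := h.A_mono
  have hc : ⇑h'.stieltjesFunction = fun t => C.A t ω := by
    ext t
    rw [h'.stieltjesFunction_eq]
    exact (h.A_continuous.continuousAt).continuousWithinAt.rightLim_eq
  rw [stieltjes, dif_pos h', StieltjesFunction.measure_singleton, hc,
    (h.A_continuous.continuousAt).continuousWithinAt.leftLim_eq]
  simp

lemma Regular.A_nonneg {C : Compensator M} {ω : Ω} (h : C.Regular ω) (t : ℝ≥0) : 0 ≤ C.A t ω := by
  rw [← h.A_zero]; exact h.A_mono (zero_le)

lemma clock_apply_Ioc (ω : Ω) (q : ℝ≥0) :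
    C.clock T ω (Ioc 0 q) =
      {ω | C.Regular ω}.indicator (fun ω => ENNReal.ofReal (C.A (min q T) ω)) ω := by
  by_cases h : C.Regular ω
  · rw [indicator_of_mem (by exact h), clock, if_pos h, dA, Measure.restrict_apply measurableSet_Ioc,
      Ioc_inter_Ioc, max_self, h.stieltjes_Ioc, h.A_zero, sub_zero]
  · simp [clock, h]

lemma ae_mem_Ioc_clock (ω : Ω) : ∀ᵐ t ∂(C.clock T ω), t ∈ Ioc 0 T := by
  by_cases h : C.Regular ω
  · rw [clock, if_pos h]
    exact ae_restrict_mem measurableSet_Ioc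
  · simp [clock, h]

lemma clock_univ (ω : Ω) :
    C.clock T ω univ = {ω | C.Regular ω}.indicator (fun ω => ENNReal.ofReal (C.A T ω)) ω := by
  have h1 : C.clock T ω univ = C.clock T ω (Ioc 0 T) := by
    refine measure_congr ?_
    filter_upwards [C.ae_mem_Ioc_clock T ω] with t ht
    exact propext ⟨fun _ => ht, fun _ => trivial⟩
  rw [h1, clock_apply_Ioc, min_self]

instance (ω : Ω) : IsFiniteMeasure (C.clock T ω) := by
  refine ⟨?_⟩
  rw [clock_univ]
  by_cases h : C.Regular ω <;> simp [h]

/-- Continuity of `A` enters here: it makes the clock atomless, as required by the exponential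
formula and by the exchange of `X` and `X_-`. -/
instance (ω : Ω) : NullSingletonClass (C.clock T ω) := by
  refine ⟨fun t => ?_⟩
  by_cases h : C.Regular ω
  · rw [clock, if_pos h, dA]
    exact le_antisymm ((Measure.restrict_apply_le _ _).trans (h.stieltjes_singleton t).le) (zero_le)
  · simp [clock, h]

lemma measurable_clock_Ioc (q : ℝ≥0) :
    Measurable[M.filtration q] fun ω => C.clock T ω (Ioc 0 q) := by
  simp_rw [C.clock_apply_Ioc T _ q]
  have h : Measurable[M.filtration q] fun ω => C.A (min q T) ω :=
    (MarkedPointProcess.measurable_filtration_of_predictable (M := M)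
      (f := fun x : PredSpace M => C.A x.time x.pt) C.A_predictable (min q T)).mono
      (M.filtration.mono (min_le_left _ _)) le_rfl
  exact (ENNReal.measurable_ofReal.comp h).indicator (C.measurableSet_regular q)

lemma measurable_clock : Measurable (C.clock T) := by
  refine Measurable.measure_of_isPiSystem (borel_eq_generateFrom_Iic ℝ≥0 ▸
    BorelSpace.measurable_eq) isPiSystem_Iic ?_ ?_
  · rintro _ ⟨q, rfl⟩
    have : ∀ ω, C.clock T ω (Iic q) = C.clock T ω (Ioc 0 q) := by
      intro ω
      refine measure_congr ?_
      filter_upwards [C.ae_mem_Ioc_clock T ω] with t ht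
      exact propext ⟨fun h => ⟨ht.1, h⟩, fun h => h.2⟩
    simp_rw [this]
    exact (C.measurable_clock_Ioc T q).mono (M.filtration.le _) le_rfl
  · have : ∀ ω, C.clock T ω univ = C.clock T ω (Ioc 0 T) := fun ω => by
      rw [clock_univ, clock_apply_Ioc, min_self]
    simp_rw [this]
    exact (C.measurable_clock_Ioc T T).mono (M.filtration.le _) le_rfl

/-- Primitives of predictable processes with respect to the jump measure are predictable. -/
lemma measurable_lintegral_Iio_jumps {G : PredSpace M × K → ℝ≥0∞} (hG : Measurable G) :
    Measurable fun x : PredSpace M =>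
      ∫⁻ z in Iio x.time ×ˢ univ, G (PredSpace.mk M (z.1, x.pt), z.2) ∂(C.jumps T x.pt) := by
  convert MarkedPointProcess.measurable_lintegral_Ioo (C.measurable_jumps_Ioc T) hG using 2 with x
  refine setLIntegral_congr ?_
  filter_upwards [C.ae_mem_Ioc_jumps T x.pt] with z hz
  exact propext ⟨fun h => ⟨⟨hz.1, h.1⟩, trivial⟩, fun h => ⟨h.1.2, trivial⟩⟩

/-- Primitives of predictable processes with respect to the compensator are predictable. -/
lemma measurable_lintegral_Iio_clock {G : PredSpace M → ℝ≥0∞} (hG : Measurable G) :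
    Measurable fun x : PredSpace M =>
      ∫⁻ t in Iio x.time, G (PredSpace.mk M (t, x.pt)) ∂(C.clock T x.pt) := by
  have hm : Measurable fun t : ℝ≥0 => (t, ()) := measurable_id.prodMk measurable_const
  have hρ : ∀ q (B : Set Unit), MeasurableSet B → Measurable[M.filtration q] fun ω =>
      (C.clock T ω).map (fun t => (t, ())) (Ioc 0 q ×ˢ B) := by
    intro q B hB
    simp_rw [Measure.map_apply hm (measurableSet_Ioc.prod hB)]
    by_cases hu : () ∈ B
    · convert C.measurable_clock_Ioc T q using 3 with ω
      ext t; simp [hu]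
    · convert (measurable_const (a := (0 : ℝ≥0∞))) using 2 with ω
      convert measure_empty (μ := C.clock T ω) using 2
      ext t; simp [hu]
  have hfin : ∀ ω, IsFiniteMeasure ((C.clock T ω).map fun t => (t, ())) := fun ω => inferInstance
  convert MarkedPointProcess.measurable_lintegral_Ioo hρ (hG.comp measurable_fst) using 2 with x
  rw [setLIntegral_map (measurableSet_Ioo.prod MeasurableSet.univ) _ hm]
  · refine setLIntegral_congr ?_
    filter_upwards [C.ae_mem_Ioc_clock T x.pt] with z hz
    exact propext ⟨fun h => ⟨⟨hz.1, h⟩, trivial⟩, fun h => h.1.2⟩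
  · exact hG.comp (M.measurable_predSpace_mk.comp (measurable_fst.prodMk measurable_const))

/-- Primitives are taken over the open interval `[0, s)` to be predictable, so a jump at `T` is seen
only for `s > T`. Terminal values are therefore read at `T + 1`, after which nothing more happens.
-/
lemma setLIntegral_jumps_eq (ω : Ω) (f : ℝ≥0 × K → ℝ≥0∞) :
    ∫⁻ z in Iio (T + 1) ×ˢ univ, f z ∂(C.jumps T ω) = ∫⁻ z, f z ∂(C.jumps T ω) := by
  rw [Measure.restrict_eq_self_of_ae_mem]
  filter_upwards [C.ae_mem_Ioc_jumps T ω] with z hz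
  exact ⟨hz.2.trans_lt (lt_add_one T), trivial⟩

lemma clock_restrict (ω : Ω) : (C.clock T ω).restrict (Iio (T + 1)) = C.clock T ω := by
  rw [Measure.restrict_eq_self_of_ae_mem]
  filter_upwards [C.ae_mem_Ioc_clock T ω] with z hz
  exact hz.2.trans_lt (lt_add_one T)

lemma measurable_lintegral_jumps {G : PredSpace M × K → ℝ≥0∞} (hG : Measurable G) :
    Measurable fun ω => ∫⁻ z, G (PredSpace.mk M (z.1, ω), z.2) ∂(C.jumps T ω) := by
  have h := (MarkedPointProcess.measurable_filtration_of_predictable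
    (C.measurable_lintegral_Iio_jumps T hG) (T + 1)).mono (M.filtration.le _) le_rfl
  simpa only [PredSpace.time_mk, PredSpace.pt_mk, setLIntegral_jumps_eq] using h

lemma measurable_lintegral_clock {G : PredSpace M → ℝ≥0∞} (hG : Measurable G) :
    Measurable fun ω => ∫⁻ t, G (PredSpace.mk M (t, ω)) ∂(C.clock T ω) := by
  have h := (MarkedPointProcess.measurable_filtration_of_predictable
    (C.measurable_lintegral_Iio_clock T hG) (T + 1)).mono (M.filtration.le _) le_rfl
  simpa only [PredSpace.time_mk, PredSpace.pt_mk, clock_restrict] using h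

/-- The transition probabilities `φ` as a kernel on the predictable space. -/
noncomputable def kernel : ProbabilityTheory.Kernel (PredSpace M) K where
  toFun x := C.φ x.time x.pt
  measurable' := Measure.measurable_of_measurable_coe _ fun B hB => C.φ_predictable B hB

instance : ProbabilityTheory.IsMarkovKernel C.kernel := ⟨fun x => C.φ_prob x.time x.pt⟩

/-- The defining duality, applied to `G` times the indicator of the predictable set `(0, T] × Ω`. -/
lemma lintegral_jumps {G : PredSpace M × K → ℝ≥0∞} (hG : Measurable G) :
    ∫⁻ ω, ∫⁻ z, G (PredSpace.mk M (z.1, ω), z.2) ∂(C.jumps T ω) ∂P =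
      ∫⁻ ω, ∫⁻ t, ∫⁻ y, G (PredSpace.mk M (t, ω), y) ∂(C.kernel (PredSpace.mk M (t, ω)))
        ∂(C.clock T ω) ∂P := by
  have hS : MeasurableSet {x : PredSpace M × K | x.1.time ∈ Ioc 0 T} := by
    have : MeasurableSet {x : PredSpace M | x.time ∈ Ioc 0 T} := by
      have e : {x : PredSpace M | x.time ∈ Ioc 0 T} = (Ioc 0 T ×ˢ univ : Set (ℝ≥0 × Ω)) :=
        Set.ext fun x => ⟨fun h => ⟨h, trivial⟩, fun h => h.1⟩
      rw [e]
      exact measurableSet_predictable_Ioc_prod 0 T MeasurableSet.univ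
    exact measurable_fst this
  have h := C.φ_dual ({x : PredSpace M × K | x.1.time ∈ Ioc 0 T}.indicator G) (hG.indicator hS)
  have e1 : ∀ᵐ ω ∂P, ∫⁻ x in Ioi 0 ×ˢ univ,
      {x : PredSpace M × K | x.1.time ∈ Ioc 0 T}.indicator G ((x.1, ω), x.2) ∂(M.p ω) =
        ∫⁻ z, G (PredSpace.mk M (z.1, ω), z.2) ∂(C.jumps T ω) := by
    filter_upwards [C.ae_regular] with ω hω
    rw [jumps, if_pos hω, ← lintegral_indicator (measurableSet_Ioi.prod MeasurableSet.univ),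
      ← lintegral_indicator (measurableSet_Ioc.prod MeasurableSet.univ)]
    refine lintegral_congr fun z => ?_
    by_cases h1 : z.1 ∈ Ioc 0 T
    · rw [indicator_of_mem (show z ∈ Ioi 0 ×ˢ univ from ⟨h1.1, trivial⟩),
        indicator_of_mem (show z ∈ Ioc 0 T ×ˢ univ from ⟨h1, trivial⟩)]
      exact indicator_of_mem (s := {x : PredSpace M × K | x.1.time ∈ Ioc 0 T})
        (a := (PredSpace.mk M (z.1, ω), z.2)) h1 G
    · rw [indicator_of_notMem (s := Ioc 0 T ×ˢ univ) fun h => h1 h.1]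
      refine indicator_apply_eq_zero.2 fun _ => ?_
      exact indicator_of_notMem (s := {x : PredSpace M × K | x.1.time ∈ Ioc 0 T})
        (a := (PredSpace.mk M (z.1, ω), z.2)) h1 G
  have e2 : ∀ᵐ ω ∂P, ∫⁻ t in Ioi 0, ∫⁻ y,
      {x : PredSpace M × K | x.1.time ∈ Ioc 0 T}.indicator G ((t, ω), y) ∂(C.φ t ω)
        ∂(stieltjes fun t => C.A t ω) =
        ∫⁻ t, ∫⁻ y, G (PredSpace.mk M (t, ω), y) ∂(C.kernel (PredSpace.mk M (t, ω)))
        ∂(C.clock T ω) := by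
    filter_upwards [C.ae_regular] with ω hω
    rw [clock, if_pos hω, dA, ← lintegral_indicator measurableSet_Ioi,
      ← lintegral_indicator measurableSet_Ioc]
    refine lintegral_congr fun t => ?_
    by_cases h1 : t ∈ Ioc 0 T
    · rw [indicator_of_mem (show t ∈ Ioi 0 from h1.1), indicator_of_mem h1]
      refine lintegral_congr fun y => ?_
      exact indicator_of_mem (s := {x : PredSpace M × K | x.1.time ∈ Ioc 0 T})
        (a := (PredSpace.mk M (t, ω), y)) h1 G
    · rw [indicator_of_notMem h1]
      refine indicator_apply_eq_zero.2 fun _ => ?_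
      refine (lintegral_congr fun y => ?_).trans lintegral_zero
      exact indicator_of_notMem (s := {x : PredSpace M × K | x.1.time ∈ Ioc 0 T})
        (a := (PredSpace.mk M (t, ω), y)) h1 G
  rw [← lintegral_congr_ae e1, ← lintegral_congr_ae e2]
  exact h

end Compensator

end MPPControl

/-! ### The Doléans exponential and its mean -/

namespace MPPControl

set_option linter.unusedSectionVars false

variable {Ω : Type*} [mΩ : MeasurableSpace Ω] {P : Measure Ω} [P.IsComplete]
  {K : Type*} [mK : MeasurableSpace K]

/-- Predictable random fields with values in `[0, c]`. -/
structure IsBddField {M : MarkedPointProcess P K} (R : PredSpace M × K → ℝ) (c : ℝ) : Prop where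
  measurable : Measurable R
  nonneg : ∀ x, 0 ≤ R x
  le : ∀ x, R x ≤ c

namespace Compensator

variable {M : MarkedPointProcess P K} (C : Compensator M) (T : ℝ≥0)

/-- The integral of `R` with respect to the transition probabilities `φ`. -/
noncomputable def rate (R : PredSpace M × K → ℝ) (x : PredSpace M) : ℝ :=
  ∫ y, R (x, y) ∂(C.kernel x)

/-- The left-continuous version of the process
`exp (∫_0^s ∫ (1 - a - R) dφ dA) ∏_{T_n < s} R(T_n, ξ_n)`, with time stopped at `T`. -/
noncomputable def doleans (R : PredSpace M × K → ℝ) (a : ℝ) (s : ℝ≥0) (ω : Ω) : ℝ :=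
  Real.exp (∫ v in Iio s, (1 - a - C.rate R (PredSpace.mk M (v, ω))) ∂(C.clock T ω)) *
    jumpProd (C.jumps T ω) (fun z => R (PredSpace.mk M (z.1, ω), z.2)) s

lemma measurable_section (M : MarkedPointProcess P K) (ω : Ω) :
    Measurable fun z : ℝ≥0 × K => ((PredSpace.mk M (z.1, ω), z.2) : PredSpace M × K) :=
  (M.measurable_predSpace_mk.comp (measurable_fst.prodMk measurable_const)).prodMk measurable_snd

lemma measurable_time_section (M : MarkedPointProcess P K) (ω : Ω) :
    Measurable fun t : ℝ≥0 => PredSpace.mk M (t, ω) :=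
  M.measurable_predSpace_mk.comp (measurable_id.prodMk measurable_const)

variable {R : PredSpace M × K → ℝ} {c a : ℝ}

section

variable {C}

lemma measurable_rate (hR : Measurable R) : Measurable (C.rate R) :=
  (hR.stronglyMeasurable.integral_kernel_prod_right' (κ := C.kernel)).measurable

lemma integrable_field (hR : IsBddField R c) (x : PredSpace M) :
    Integrable (fun y => R (x, y)) (C.kernel x) := by
  refine Integrable.of_bound (hR.measurable.comp measurable_prodMk_left).aestronglyMeasurable c
    (ae_of_all _ fun y => ?_)
  rw [Real.norm_eq_abs, abs_of_nonneg (hR.nonneg _)]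
  exact hR.le _

lemma rate_nonneg (hR : IsBddField R c) (x : PredSpace M) : 0 ≤ C.rate R x :=
  integral_nonneg fun _ => hR.nonneg _

lemma rate_le (hR : IsBddField R c) (x : PredSpace M) : C.rate R x ≤ c := by
  have := integral_mono (integrable_field (C := C) hR x) (integrable_const c) fun y => hR.le (x, y)
  simpa [rate] using this

lemma lintegral_field (hR : IsBddField R c) (x : PredSpace M) :
    ∫⁻ y, ENNReal.ofReal (R (x, y)) ∂(C.kernel x) = ENNReal.ofReal (C.rate R x) :=
  (ofReal_integral_eq_lintegral_ofReal (integrable_field hR x)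
    (ae_of_all _ fun _ => hR.nonneg _)).symm

lemma integrable_rate (hR : IsBddField R c) (ω : Ω) :
    Integrable (fun v => 1 - a - C.rate R (PredSpace.mk M (v, ω))) (C.clock T ω) := by
  refine (integrable_const _).sub (Integrable.of_bound
    ((measurable_rate hR.measurable).comp (measurable_time_section M ω)).aestronglyMeasurable c
    (ae_of_all _ fun y => ?_))
  rw [Real.norm_eq_abs]
  exact (abs_of_nonneg (rate_nonneg hR _)).trans_le (rate_le hR _)

/-- All ingredients are primitives over `[0, s)`, hence predictable. This is what the
left-continuous version and the logarithmic form of the product are for: the duality needs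
predictable integrands. -/
lemma measurable_doleans (hR : IsBddField R c) :
    Measurable fun x : PredSpace M => C.doleans T R a x.time x.pt := by
  have hk : Measurable fun x : PredSpace M => 1 - a - C.rate R x :=
    measurable_const.sub (measurable_rate hR.measurable)
  refine Measurable.mul (Real.measurable_exp.comp ?_) ?_
  · have h1 := (C.measurable_lintegral_Iio_clock T hk.ennreal_ofReal).ennreal_toReal
    have h2 := (C.measurable_lintegral_Iio_clock T hk.neg.ennreal_ofReal).ennreal_toReal
    convert h1.sub h2 using 2 with x
    exact integral_eq_lintegral_pos_part_sub_lintegral_neg_part (integrable_rate T hR x.pt).restrict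
  · have hlog : Measurable fun x => Real.log (R x) := Real.measurable_log.comp hR.measurable
    have h1 := (C.measurable_lintegral_Iio_jumps T hlog.ennreal_ofReal).ennreal_toReal
    have h2 := (C.measurable_lintegral_Iio_jumps T hlog.neg.ennreal_ofReal).ennreal_toReal
    have hz : MeasurableSet (R ⁻¹' {0}) := hR.measurable (measurableSet_singleton 0)
    have h3 := C.measurable_lintegral_Iio_jumps T
      ((measurable_const (a := (1 : ℝ≥0∞))).indicator hz)
    unfold jumpProd
    refine Measurable.ite ?_ (Real.measurable_exp.comp (h1.sub h2)) measurable_const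
    -- The condition in `jumpProd` says that the indicator of `{R = 0}` has zero integral against
    -- the jumps before the current time.
    convert h3 (measurableSet_singleton 0) using 1
    ext x
    have hz' : MeasurableSet ((fun z : ℝ≥0 × K => R (PredSpace.mk M (z.1, x.pt), z.2)) ⁻¹' {0}) :=
      (hR.measurable.comp (measurable_section M x.pt)) (measurableSet_singleton 0)
    simp only [mem_ofPred_eq, mem_preimage, mem_singleton_iff]
    rw [← Measure.restrict_apply hz', ← lintegral_indicator_one hz']
    rfl

lemma doleans_eq (hR : IsBddField R c) {ω : Ω} {m : ℕ} {τ : ℕ → ℝ≥0} {ξ : ℕ → K}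
    (hJ : C.jumps T ω = ∑ j ∈ Finset.range m, Measure.dirac (τ j, ξ j)) (s : ℝ≥0) :
    C.doleans T R a s ω =
      Real.exp (∫ v in Iio s, (1 - a - C.rate R (PredSpace.mk M (v, ω))) ∂(C.clock T ω)) *
        ∏ j ∈ Finset.range m with τ j < s, R (PredSpace.mk M (τ j, ω), ξ j) := by
  rw [doleans, hJ, jumpProd_sum_dirac (R := fun z => R (PredSpace.mk M (z.1, ω), z.2))
    (hR.measurable.comp (measurable_section M ω)) fun _ => hR.nonneg _]

lemma doleans_nonneg (hR : IsBddField R c) (s : ℝ≥0) (ω : Ω) : 0 ≤ C.doleans T R a s ω := by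
  obtain ⟨m, τ, ξ, -, -, hJ⟩ := C.exists_jumps_eq T ω
  rw [doleans_eq T hR hJ]
  exact mul_nonneg (Real.exp_pos _).le (Finset.prod_nonneg fun _ _ => hR.nonneg _)

lemma integral_rate_le (hR : IsBddField R c) (ha : 0 ≤ a) (s : ℝ≥0) (ω : Ω) :
    ∫ v in Iio s, (1 - a - C.rate R (PredSpace.mk M (v, ω))) ∂(C.clock T ω) ≤
      (C.clock T ω).real (Iio s) := by
  have := setIntegral_mono (s := Iio s) (integrable_rate (a := a) T hR ω).integrableOn
    (integrable_const (1 : ℝ)).integrableOn fun v => (show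
      1 - a - C.rate R (PredSpace.mk M (v, ω)) ≤ 1 by linarith [rate_nonneg (C := C) hR (PredSpace.mk M (v, ω))])
  simpa using this

lemma integrable_doleans (hR : IsBddField R c) (ha : 0 ≤ a) (ω : Ω) :
    Integrable (fun v => C.doleans T R a v ω) (C.clock T ω) := by
  obtain ⟨m, τ, ξ, -, -, hJ⟩ := C.exists_jumps_eq T ω
  refine Integrable.of_bound ((measurable_doleans T hR).comp
    (measurable_time_section M ω)).aestronglyMeasurable
    (Real.exp ((C.clock T ω).real univ) * (∏ _j ∈ Finset.range m, max 1 c)) (ae_of_all _ fun v => ?_)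
  rw [Real.norm_eq_abs, abs_of_nonneg (doleans_nonneg T hR v ω), doleans_eq T hR hJ]
  have h1 := (integral_rate_le T hR ha v ω).trans (measureReal_mono (subset_univ (Iio v)))
  refine mul_le_mul (Real.exp_le_exp.2 h1) ?_ (Finset.prod_nonneg fun _ _ => hR.nonneg _)
    (Real.exp_pos _).le
  rw [Finset.prod_filter]
  refine Finset.prod_le_prod (fun j _ => ?_) fun j _ => ?_
  · split_ifs
    exacts [hR.nonneg _, zero_le_one]
  · split_ifs
    exacts [(hR.le _).trans (le_max_right _ _), le_max_left _ _]

lemma lintegral_sum_dirac {m : ℕ} {τ : ℕ → ℝ≥0} {ξ : ℕ → K} {f : ℝ≥0 × K → ℝ≥0∞}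
    (hf : Measurable f) :
    ∫⁻ z, f z ∂(∑ j ∈ Finset.range m, Measure.dirac (τ j, ξ j)) =
      ∑ j ∈ Finset.range m, f (τ j, ξ j) := by
  rw [lintegral_finsetSum_measure]
  exact Finset.sum_congr rfl fun j _ => lintegral_dirac' _ hf

/-- The equation solved by `doleans`, with all terms nonnegative. -/
lemma doleans_equation (hR : IsBddField R c) (ha : 0 ≤ a) (ω : Ω) :
    ENNReal.ofReal (C.doleans T R a (T + 1) ω) +
        ∫⁻ z, ENNReal.ofReal (C.doleans T R a z.1 ω) ∂(C.jumps T ω) +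
        ∫⁻ v, ENNReal.ofReal (C.doleans T R a v ω) *
          ENNReal.ofReal (a + C.rate R (PredSpace.mk M (v, ω))) ∂(C.clock T ω) =
      1 + ∫⁻ z, ENNReal.ofReal (C.doleans T R a z.1 ω) *
          ENNReal.ofReal (R (PredSpace.mk M (z.1, ω), z.2)) ∂(C.jumps T ω) +
        ∫⁻ v, ENNReal.ofReal (C.doleans T R a v ω) ∂(C.clock T ω) := by
  obtain ⟨m, τ, ξ, hτ, hτT, hJ⟩ := C.exists_jumps_eq T ω
  set D : ℝ≥0 → ℝ := fun s => C.doleans T R a s ω with hD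
  set ρ : ℝ≥0 → ℝ := fun v => C.rate R (PredSpace.mk M (v, ω)) with hρ
  have hD0 : ∀ s, 0 ≤ D s := fun s => doleans_nonneg T hR s ω
  have hρ0 : ∀ s, 0 ≤ ρ s := fun s => rate_nonneg hR _
  have hDm : Measurable D := (measurable_doleans T hR).comp (measurable_time_section M ω)
  have hρm : Measurable ρ := (measurable_rate hR.measurable).comp (measurable_time_section M ω)
  have hRm : Measurable fun z : ℝ≥0 × K => R (PredSpace.mk M (z.1, ω), z.2) :=
    hR.measurable.comp (measurable_section M ω)
  -- The real equation is signed. Its negative terms are moved to the other side below, so that both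
  -- sides can be integrated over `Ω` before any integrability is known.
  obtain ⟨hi, hmain⟩ := exp_mul_prod_eq (a := C.clock T ω) (k := fun v => 1 - a - ρ v)
    (measurable_const.sub hρm) (integrable_rate T hR ω) hτ
    (fun j => R (PredSpace.mk M (τ j, ω), ξ j)) (S := T + 1)
    (fun j hj => (hτT j hj).2.trans_lt (lt_add_one T)) D (fun s => doleans_eq T hR hJ s)
  rw [clock_restrict] at hmain
  have hDi : Integrable D (C.clock T ω) := integrable_doleans T hR ha ω
  have hDi2 : Integrable (fun v => D v * (a + ρ v)) (C.clock T ω) := by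
    have := hDi.sub hi
    refine this.congr (ae_of_all _ fun v => ?_)
    simp only [Pi.sub_apply]
    ring
  have hint : ∫ v, D v * (1 - a - ρ v) ∂(C.clock T ω) =
      (∫ v, D v ∂(C.clock T ω)) - ∫ v, D v * (a + ρ v) ∂(C.clock T ω) := by
    rw [← integral_sub hDi hDi2]
    exact integral_congr_ae (ae_of_all _ fun v => by ring)
  have e1 : ∫⁻ v, ENNReal.ofReal (D v) ∂(C.clock T ω) =
      ENNReal.ofReal (∫ v, D v ∂(C.clock T ω)) :=
    (ofReal_integral_eq_lintegral_ofReal hDi (ae_of_all _ hD0)).symm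
  have e2 : ∫⁻ v, ENNReal.ofReal (D v) * ENNReal.ofReal (a + ρ v) ∂(C.clock T ω) =
      ENNReal.ofReal (∫ v, D v * (a + ρ v) ∂(C.clock T ω)) := by
    rw [ofReal_integral_eq_lintegral_ofReal hDi2
      (ae_of_all _ fun v => mul_nonneg (hD0 v) (add_nonneg ha (hρ0 v)))]
    exact lintegral_congr fun v => (ENNReal.ofReal_mul (hD0 v)).symm
  have e3 : ∫⁻ z, ENNReal.ofReal (D z.1) ∂(C.jumps T ω) =
      ENNReal.ofReal (∑ j ∈ Finset.range m, D (τ j)) := by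
    rw [hJ, lintegral_sum_dirac (f := fun z => ENNReal.ofReal (D z.1))
      (hDm.comp measurable_fst).ennreal_ofReal,
      ENNReal.ofReal_sum_of_nonneg fun _ _ => hD0 _]
  have e4 : ∫⁻ z, ENNReal.ofReal (D z.1) *
      ENNReal.ofReal (R (PredSpace.mk M (z.1, ω), z.2)) ∂(C.jumps T ω) =
      ENNReal.ofReal (∑ j ∈ Finset.range m, D (τ j) * R (PredSpace.mk M (τ j, ω), ξ j)) := by
    rw [hJ, lintegral_sum_dirac (f := fun z => ENNReal.ofReal (D z.1) *
      ENNReal.ofReal (R (PredSpace.mk M (z.1, ω), z.2))) ((hDm.comp measurable_fst).ennreal_ofReal.mul hRm.ennreal_ofReal),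
      ENNReal.ofReal_sum_of_nonneg fun _ _ => mul_nonneg (hD0 _) (hR.nonneg _)]
    exact Finset.sum_congr rfl fun j _ => (ENNReal.ofReal_mul (hD0 _)).symm
  have n1 : 0 ≤ ∫ v, D v ∂(C.clock T ω) := integral_nonneg hD0
  have n2 : 0 ≤ ∫ v, D v * (a + ρ v) ∂(C.clock T ω) :=
    integral_nonneg fun v => mul_nonneg (hD0 v) (add_nonneg ha (hρ0 v))
  have n3 : 0 ≤ ∑ j ∈ Finset.range m, D (τ j) := Finset.sum_nonneg fun _ _ => hD0 _
  have n4 : 0 ≤ ∑ j ∈ Finset.range m, D (τ j) * R (PredSpace.mk M (τ j, ω), ξ j) :=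
    Finset.sum_nonneg fun _ _ => mul_nonneg (hD0 _) (hR.nonneg _)
  change ENNReal.ofReal (D (T + 1)) + _ + _ = _
  rw [e1, e2, e3, e4, ← ENNReal.ofReal_one, ← ENNReal.ofReal_add (hD0 _) n3,
    ← ENNReal.ofReal_add (add_nonneg (hD0 _) n3) n2, ← ENNReal.ofReal_add zero_le_one n4,
    ← ENNReal.ofReal_add (add_nonneg zero_le_one n4) n1]
  congr 1
  rw [hmain, hint]
  simp_rw [mul_sub, Finset.sum_sub_distrib, mul_one]
  ring

lemma lintegral_doleans_mul_rate_le (hR : IsBddField R c) :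
    ∫⁻ ω, ∫⁻ v, ENNReal.ofReal (C.doleans T R a v ω) *
        ENNReal.ofReal (C.rate R (PredSpace.mk M (v, ω))) ∂(C.clock T ω) ∂P ≤
      (∫⁻ ω, ∫⁻ v, ENNReal.ofReal (C.doleans T R a v ω) ∂(C.clock T ω) ∂P) * ENNReal.ofReal c := by
  rw [← lintegral_mul_const' _ _ ENNReal.ofReal_ne_top]
  refine lintegral_mono fun ω => ?_
  rw [← lintegral_mul_const' _ _ ENNReal.ofReal_ne_top]
  exact lintegral_mono fun v => mul_le_mul_right (ENNReal.ofReal_le_ofReal (rate_le hR _)) _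

lemma measurable_doleans_end (hR : IsBddField R c) (t : ℝ≥0) :
    Measurable fun ω => C.doleans T R a t ω :=
  (measurable_doleans T hR).comp
    (M.measurable_predSpace_mk.comp (measurable_const.prodMk measurable_id))

lemma measurable_lintegral_doleans (hR : IsBddField R c) :
    Measurable fun ω => ∫⁻ v, ENNReal.ofReal (C.doleans T R a v ω) ∂(C.clock T ω) :=
  C.measurable_lintegral_clock T (measurable_doleans T hR).ennreal_ofReal

/-- Duality for integrands of product form. -/
lemma lintegral_jumps_mul {D : ℝ≥0 → Ω → ℝ}
    (hD : Measurable fun x : PredSpace M => D x.time x.pt)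
    {H : PredSpace M × K → ℝ≥0∞} (hH : Measurable H) :
    ∫⁻ ω, ∫⁻ z, ENNReal.ofReal (D z.1 ω) * H (PredSpace.mk M (z.1, ω), z.2) ∂(C.jumps T ω) ∂P =
      ∫⁻ ω, ∫⁻ v, ENNReal.ofReal (D v ω) *
        ∫⁻ y, H (PredSpace.mk M (v, ω), y) ∂(C.kernel (PredSpace.mk M (v, ω)))
          ∂(C.clock T ω) ∂P := by
  refine (C.lintegral_jumps T (G := fun x => ENNReal.ofReal (D x.1.time x.1.pt) * H x)
    ((hD.comp measurable_fst).ennreal_ofReal.mul hH)).trans ?_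
  refine lintegral_congr fun ω => lintegral_congr fun v => ?_
  exact lintegral_const_mul' (ENNReal.ofReal (D v ω)) (fun y => H (PredSpace.mk M (v, ω), y))
    ENNReal.ofReal_ne_top

/-- If `E ∫ D dA < ∞` then `E D_T + a E ∫ D dA = 1`. -/
lemma lintegral_doleans_eq_one [IsProbabilityMeasure P] (hR : IsBddField R c) (ha : 0 ≤ a)
    (hfin : ∫⁻ ω, ∫⁻ v, ENNReal.ofReal (C.doleans T R a v ω) ∂(C.clock T ω) ∂P ≠ ∞) :
    ∫⁻ ω, ENNReal.ofReal (C.doleans T R a (T + 1) ω) +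
      ENNReal.ofReal a * ∫⁻ v, ENNReal.ofReal (C.doleans T R a v ω) ∂(C.clock T ω) ∂P = 1 := by
  set D := C.doleans T R a with hD
  have hDP : Measurable fun x : PredSpace M => D x.time x.pt := measurable_doleans T hR
  have m1 : Measurable fun ω => ENNReal.ofReal (D (T + 1) ω) :=
    (measurable_doleans_end T hR _).ennreal_ofReal
  have m2 : Measurable fun ω => ∫⁻ v, ENNReal.ofReal (D v ω) ∂(C.clock T ω) :=
    measurable_lintegral_doleans T hR
  have m3 : Measurable fun ω => ∫⁻ z, ENNReal.ofReal (D z.1 ω) ∂(C.jumps T ω) :=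
    C.measurable_lintegral_jumps T (G := fun x => ENNReal.ofReal (D x.1.time x.1.pt))
      (hDP.comp measurable_fst).ennreal_ofReal
  have m4 : Measurable fun ω => ∫⁻ z, ENNReal.ofReal (D z.1 ω) *
      ENNReal.ofReal (R (PredSpace.mk M (z.1, ω), z.2)) ∂(C.jumps T ω) :=
    C.measurable_lintegral_jumps T
      (G := fun x => ENNReal.ofReal (D x.1.time x.1.pt) * ENNReal.ofReal (R x))
      ((hDP.comp measurable_fst).ennreal_ofReal.mul hR.measurable.ennreal_ofReal)
  -- Duality for the integrand `D`, which does not depend on the mark; `φ` has total mass one.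
  have j1 : ∫⁻ ω, ∫⁻ z, ENNReal.ofReal (D z.1 ω) ∂(C.jumps T ω) ∂P =
      ∫⁻ ω, ∫⁻ v, ENNReal.ofReal (D v ω) ∂(C.clock T ω) ∂P := by
    have := lintegral_jumps_mul (C := C) T hDP (H := fun _ => 1) measurable_const
    simpa only [mul_one, lintegral_const, measure_univ] using this
  have j2 : ∫⁻ ω, ∫⁻ z, ENNReal.ofReal (D z.1 ω) *
      ENNReal.ofReal (R (PredSpace.mk M (z.1, ω), z.2)) ∂(C.jumps T ω) ∂P =
      ∫⁻ ω, ∫⁻ v, ENNReal.ofReal (D v ω) *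
        ENNReal.ofReal (C.rate R (PredSpace.mk M (v, ω))) ∂(C.clock T ω) ∂P := by
    have := lintegral_jumps_mul (C := C) T hDP hR.measurable.ennreal_ofReal
    simpa only [lintegral_field hR] using this
  have hb := (lintegral_doleans_mul_rate_le (a := a) (C := C) T hR).trans_lt
    (ENNReal.mul_lt_top hfin.lt_top ENNReal.ofReal_lt_top)
  have split : ∀ ω, ∫⁻ v, ENNReal.ofReal (D v ω) *
      ENNReal.ofReal (a + C.rate R (PredSpace.mk M (v, ω))) ∂(C.clock T ω) =
      ENNReal.ofReal a * ∫⁻ v, ENNReal.ofReal (D v ω) ∂(C.clock T ω) +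
      ∫⁻ v, ENNReal.ofReal (D v ω) *
        ENNReal.ofReal (C.rate R (PredSpace.mk M (v, ω))) ∂(C.clock T ω) := by
    intro ω
    rw [← lintegral_const_mul' _ _ ENNReal.ofReal_ne_top, ← lintegral_add_left]
    · refine lintegral_congr fun v => ?_
      rw [ENNReal.ofReal_add ha (rate_nonneg hR _)]
      ring
    · exact ((hDP.comp (measurable_time_section M ω)).ennreal_ofReal).const_mul _
  have hkey : ∀ ω, ENNReal.ofReal (D (T + 1) ω) +
      ∫⁻ z, ENNReal.ofReal (D z.1 ω) ∂(C.jumps T ω) +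
      (ENNReal.ofReal a * ∫⁻ v, ENNReal.ofReal (D v ω) ∂(C.clock T ω) +
      ∫⁻ v, ENNReal.ofReal (D v ω) *
        ENNReal.ofReal (C.rate R (PredSpace.mk M (v, ω))) ∂(C.clock T ω)) =
      1 + ∫⁻ z, ENNReal.ofReal (D z.1 ω) *
          ENNReal.ofReal (R (PredSpace.mk M (z.1, ω), z.2)) ∂(C.jumps T ω) +
        ∫⁻ v, ENNReal.ofReal (D v ω) ∂(C.clock T ω) := fun ω => by
    rw [← split ω]
    exact doleans_equation T hR ha ω
  have key := lintegral_congr (μ := P) hkey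
  rw [lintegral_add_left (m1.fun_add m3), lintegral_add_left m1, lintegral_add_left (m2.const_mul _),
    lintegral_add_left (measurable_const.fun_add m4), lintegral_add_left measurable_const, j1, j2,
    lintegral_const, measure_univ, mul_one] at key
  rw [lintegral_add_left m1]
  set x := ∫⁻ ω, ∫⁻ v, ENNReal.ofReal (D v ω) ∂(C.clock T ω) ∂P
  set y := ∫⁻ ω, ∫⁻ v, ENNReal.ofReal (D v ω) *
        ENNReal.ofReal (C.rate R (PredSpace.mk M (v, ω))) ∂(C.clock T ω) ∂P
  -- The finiteness assumption is used here: after duality `x + y` stands on both sides, and it can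
  -- be cancelled in `ℝ≥0∞` only if finite.
  have hxy : x + y ≠ ∞ := ENNReal.add_ne_top.2 ⟨hfin, hb.ne⟩
  refine (ENNReal.add_left_inj hxy).1 ?_
  rw [add_add_add_comm] at key
  calc _ = _ := by ring
    _ = _ := key
    _ = _ := by ring

end

end Compensator

end MPPControl

/-! ### Localization by number of points, and moment bounds -/

namespace MPPControl

set_option linter.unusedSectionVars false

variable {Ω : Type*} [mΩ : MeasurableSpace Ω] {P : Measure Ω} [P.IsComplete]
  {K : Type*} [mK : MeasurableSpace K]

/-- Only the first `n` factors can exceed `1`. The bound does not involve the total number `m` of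
points, which is random. -/
lemma prod_filter_le_pow {m n : ℕ} {p : ℕ → Prop} [DecidablePred p] {f : ℕ → ℝ} {b : ℝ}
    (hb : 1 ≤ b) (h0 : ∀ j, 0 ≤ f j) (h1 : ∀ j < m, j < n → f j ≤ b)
    (h2 : ∀ j < m, n ≤ j → f j ≤ 1) : ∏ j ∈ Finset.range m with p j, f j ≤ b ^ n := by
  calc ∏ j ∈ Finset.range m with p j, f j
      ≤ ∏ j ∈ Finset.range m, if j < n then b else 1 := by
        rw [Finset.prod_filter]
        refine Finset.prod_le_prod (fun j _ => ?_) fun j hj => ?_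
        · split_ifs
          exacts [h0 j, zero_le_one]
        · have hj' := Finset.mem_range.1 hj
          split_ifs with hp hn hn
          exacts [h1 j hj' hn, h2 j hj' (not_lt.1 hn), hb, le_rfl]
    _ = b ^ ((Finset.range m).filter (· < n)).card := by
        rw [← Finset.prod_filter, Finset.prod_const]
    _ ≤ b ^ n := by
        refine pow_le_pow_right₀ hb ?_
        calc _ ≤ (Finset.range n).card := Finset.card_le_card fun j hj =>
              Finset.mem_range.2 (Finset.mem_filter.1 hj).2
          _ = n := Finset.card_range n

namespace Compensator

variable {M : MarkedPointProcess P K} (C : Compensator M) (T : ℝ≥0)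

/-- The total mass of the clock, which is `A_T` almost surely. -/
noncomputable def mass (ω : Ω) : ℝ := (C.clock T ω).real univ

lemma mass_nonneg (ω : Ω) : 0 ≤ C.mass T ω := measureReal_nonneg

lemma measurable_mass : Measurable (C.mass T) :=
  ((Measure.measurable_coe MeasurableSet.univ).comp (C.measurable_clock T)).ennreal_toReal

lemma Regular.mass_eq {C : Compensator M} {ω : Ω} (h : C.Regular ω) : C.mass T ω = C.A T ω := by
  rw [mass, Measure.real, clock_univ, indicator_of_mem (by exact h),
    ENNReal.toReal_ofReal (h.A_nonneg T)]

lemma clock_univ_eq (ω : Ω) : C.clock T ω univ = ENNReal.ofReal (C.mass T ω) := by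
  rw [mass, ofReal_measureReal]

/-- The predictable set on which fewer than `n` points have occurred strictly before the current
time. -/
def cutSet (n : ℕ) : Set (PredSpace M) :=
  {x | C.jumps T x.pt (Iio x.time ×ˢ univ) < n}

lemma measurableSet_cutSet (n : ℕ) : MeasurableSet (C.cutSet T n) := by
  have := C.measurable_lintegral_Iio_jumps T (measurable_const (a := (1 : ℝ≥0∞)))
  simp only [lintegral_const, Measure.restrict_apply MeasurableSet.univ, univ_inter, one_mul] at this
  exact measurableSet_lt this measurable_const

variable {C T}

lemma jumps_Iio {ω : Ω} {m : ℕ} {τ : ℕ → ℝ≥0} {ξ : ℕ → K}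
    (hJ : C.jumps T ω = ∑ j ∈ Finset.range m, Measure.dirac (τ j, ξ j)) (s : ℝ≥0) :
    C.jumps T ω (Iio s ×ˢ univ) = ((Finset.range m).filter (τ · < s)).card := by
  have := lintegral_sum_dirac_restrict (m := m) (τ := τ) (ξ := ξ) (f := fun _ => 1)
    measurable_const s
  rw [← hJ] at this
  simpa using this

lemma mem_cutSet_of_lt {ω : Ω} {m : ℕ} {τ : ℕ → ℝ≥0} {ξ : ℕ → K}
    (hJ : C.jumps T ω = ∑ j ∈ Finset.range m, Measure.dirac (τ j, ξ j)) {n : ℕ} (h : m < n)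
    (t : ℝ≥0) : PredSpace.mk M (t, ω) ∈ C.cutSet T n := by
  change C.jumps T ω (Iio t ×ˢ univ) < n
  rw [jumps_Iio hJ, Nat.cast_lt]
  exact ((Finset.card_filter_le _ _).trans_eq (Finset.card_range m)).trans_lt h

/-- Points are indexed from `0`, so exactly `j` of them lie strictly before `τ j`. -/
lemma mem_cutSet_iff {ω : Ω} {m : ℕ} {τ : ℕ → ℝ≥0} {ξ : ℕ → K}
    (hτ : ∀ i j, i < j → j < m → τ i < τ j)
    (hJ : C.jumps T ω = ∑ j ∈ Finset.range m, Measure.dirac (τ j, ξ j)) {n j : ℕ} (h : j < m) :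
    PredSpace.mk M (τ j, ω) ∈ C.cutSet T n ↔ j < n := by
  change C.jumps T ω (Iio (τ j) ×ˢ univ) < n ↔ _
  have : (Finset.range m).filter (τ · < τ j) = Finset.range j := by
    ext i
    simp only [Finset.mem_filter, Finset.mem_range]
    constructor
    · rintro ⟨hi, hij⟩
      by_contra hcon
      rcases (not_lt.1 hcon).eq_or_lt with h' | h'
      · exact absurd (h' ▸ hij) (lt_irrefl _)
      · exact absurd (hτ j i h' hi) hij.asymm
    · exact fun hij => ⟨hij.trans h, hτ i j hij h⟩
  rw [jumps_Iio hJ, Nat.cast_lt, this, Finset.card_range]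

variable {R : PredSpace M × K → ℝ} {c a : ℝ}

lemma integral_rate_le_mass (hR : IsBddField R c) (ha : 0 ≤ a) (s : ℝ≥0) (ω : Ω) :
    ∫ v in Iio s, (1 - a - C.rate R (PredSpace.mk M (v, ω))) ∂(C.clock T ω) ≤ C.mass T ω :=
  (integral_rate_le T hR ha s ω).trans (measureReal_mono (subset_univ _))

lemma exp_mul_mass_ne_top {κ κ' : ℝ} (h : κ' ≤ κ)
    (hE : ∫⁻ ω, ENNReal.ofReal (Real.exp (κ * C.mass T ω)) ∂P ≠ ∞) :
    ∫⁻ ω, ENNReal.ofReal (Real.exp (κ' * C.mass T ω)) ∂P ≠ ∞ :=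
  ne_top_of_le_ne_top hE (lintegral_mono fun ω => ENNReal.ofReal_le_ofReal
    (Real.exp_le_exp.2 (mul_le_mul_of_nonneg_right h (C.mass_nonneg T ω))))

/-- The field equal to `R` until the `n`-th point and to `1` afterwards. -/
noncomputable def cutField (C : Compensator M) (T : ℝ≥0) (R : PredSpace M × K → ℝ) (n : ℕ) :
    PredSpace M × K → ℝ :=
  open scoped Classical in fun x => if x.1 ∈ C.cutSet T n then R x else 1

lemma isBddField_cutField (hR : IsBddField R c) (n : ℕ) :
    IsBddField (C.cutField T R n) (max 1 c) where
  measurable := Measurable.ite (measurable_fst (C.measurableSet_cutSet T n)) hR.measurable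
    measurable_const
  nonneg x := by
    unfold cutField
    split_ifs
    exacts [hR.nonneg x, zero_le_one]
  le x := by
    unfold cutField
    split_ifs
    exacts [(hR.le x).trans (le_max_right _ _), le_max_left _ _]

/-- At most `n` factors of the product differ from `1`, and the exponent is at most the mass of the
clock because the rate and `a` are nonnegative. -/
lemma doleans_cutField_le (hR : IsBddField R c) (ha : 0 ≤ a) (n : ℕ) (s : ℝ≥0) (ω : Ω) :
    C.doleans T (C.cutField T R n) a s ω ≤ Real.exp (C.mass T ω) * max 1 c ^ n := by
  obtain ⟨m, τ, ξ, hτ, -, hJ⟩ := C.exists_jumps_eq T ω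
  have hR' := isBddField_cutField (C := C) (T := T) hR n
  rw [doleans_eq T hR' hJ]
  refine mul_le_mul (Real.exp_le_exp.2 (integral_rate_le_mass hR' ha s ω))
    (prod_filter_le_pow (le_max_left _ _) (fun j => hR'.nonneg _) (fun j _ _ => hR'.le _) ?_)
    (Finset.prod_nonneg fun _ _ => hR'.nonneg _) (Real.exp_pos _).le
  intro j hj hn
  unfold cutField
  rw [if_neg]
  rw [mem_cutSet_iff hτ hJ hj]
  exact not_lt.2 hn

/-- A path with fewer than `n` points is never cut, so the localized exponentials are eventually
constant in `n` on each path. -/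
lemma doleans_cutField_eq {ω : Ω} {m : ℕ} {τ : ℕ → ℝ≥0} {ξ : ℕ → K}
    (hJ : C.jumps T ω = ∑ j ∈ Finset.range m, Measure.dirac (τ j, ξ j)) {n : ℕ} (h : m < n)
    (s : ℝ≥0) : C.doleans T (C.cutField T R n) a s ω = C.doleans T R a s ω := by
  have h1 : ∀ t y, C.cutField T R n (PredSpace.mk M (t, ω), y) = R (PredSpace.mk M (t, ω), y) :=
    fun t y => if_pos (mem_cutSet_of_lt hJ h t)
  simp only [doleans, rate, h1]

/-- The supermartingale property of the Doléans exponential. -/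
lemma lintegral_doleans_le_one [IsProbabilityMeasure P] (hR : IsBddField R c) (ha : 0 ≤ a)
    (hE : ∫⁻ ω, ENNReal.ofReal (Real.exp (2 * C.mass T ω)) ∂P ≠ ∞) :
    ∫⁻ ω, ENNReal.ofReal (C.doleans T R a (T + 1) ω) +
      ENNReal.ofReal a * ∫⁻ v, ENNReal.ofReal (C.doleans T R a v ω) ∂(C.clock T ω) ∂P ≤ 1 := by
  set Φ : ℕ → Ω → ℝ≥0∞ := fun n ω =>
    ENNReal.ofReal (C.doleans T (C.cutField T R n) a (T + 1) ω) + ENNReal.ofReal a *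
      ∫⁻ v, ENNReal.ofReal (C.doleans T (C.cutField T R n) a v ω) ∂(C.clock T ω) with hΦ
  have hone : ∀ n, ∫⁻ ω, Φ n ω ∂P = 1 := by
    intro n
    have hR' := isBddField_cutField (C := C) (T := T) hR n
    refine lintegral_doleans_eq_one T hR' ha ?_
    have hle : ∀ ω, ∫⁻ v, ENNReal.ofReal (C.doleans T (C.cutField T R n) a v ω) ∂(C.clock T ω) ≤
        ENNReal.ofReal (max 1 c ^ n) * ENNReal.ofReal (Real.exp (2 * C.mass T ω)) := by
      intro ω
      calc _ ≤ ∫⁻ v, ENNReal.ofReal (Real.exp (C.mass T ω) * max 1 c ^ n) ∂(C.clock T ω) :=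
            lintegral_mono fun v => ENNReal.ofReal_le_ofReal (doleans_cutField_le hR ha n v ω)
        _ = ENNReal.ofReal (Real.exp (C.mass T ω) * max 1 c ^ n * C.mass T ω) := by
            rw [lintegral_const, clock_univ_eq, ← ENNReal.ofReal_mul (by positivity)]
        _ ≤ _ := by
            rw [← ENNReal.ofReal_mul (by positivity)]
            refine ENNReal.ofReal_le_ofReal ?_
            have h1 : C.mass T ω ≤ Real.exp (C.mass T ω) :=
              (by linarith : C.mass T ω ≤ C.mass T ω + 1).trans (Real.add_one_le_exp _)
            rw [two_mul, Real.exp_add]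
            calc _ = max 1 c ^ n * (Real.exp (C.mass T ω) * C.mass T ω) := by ring
              _ ≤ _ := by gcongr
    refine ne_top_of_le_ne_top ?_ (lintegral_mono hle)
    rw [lintegral_const_mul' _ _ ENNReal.ofReal_ne_top]
    exact ENNReal.mul_ne_top ENNReal.ofReal_ne_top hE
  have hlim : ∀ ω, ENNReal.ofReal (C.doleans T R a (T + 1) ω) + ENNReal.ofReal a *
      ∫⁻ v, ENNReal.ofReal (C.doleans T R a v ω) ∂(C.clock T ω) =
        -- The sequence is eventually constant, so its limit inferior is its final value and Fatou's
        -- lemma applies.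
        liminf (fun n => Φ n ω) atTop := by
    intro ω
    obtain ⟨m, τ, ξ, -, -, hJ⟩ := C.exists_jumps_eq T ω
    refine (Tendsto.liminf_eq ?_).symm
    refine tendsto_const_nhds.congr' ?_
    filter_upwards [eventually_gt_atTop m] with n hn
    simp only [hΦ, doleans_cutField_eq hJ hn]
  rw [lintegral_congr hlim]
  refine (lintegral_liminf_le fun n => ?_).trans ?_
  · have hR' := isBddField_cutField (C := C) (T := T) hR n
    exact (measurable_doleans_end T hR' _).ennreal_ofReal.add
      ((measurable_lintegral_doleans T hR').const_mul _)
  · simp [hone]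

lemma _root_.MPPControl.IsBddField.pow_four (hR : IsBddField R c) : IsBddField (fun x => R x ^ 4) (c ^ 4) where
  measurable := hR.measurable.pow_const 4
  nonneg x := pow_nonneg (hR.nonneg x) 4
  le x := pow_le_pow_left₀ (hR.nonneg x) (hR.le x) 4

/-- The products over jumps agree exactly; only the exponents are compared. There `4 (1 - rate R) ≤
4 ≤ (1 - a - rate (R^4)) + (3 + a + c^4)`, since `0 ≤ rate R` and `rate (R^4) ≤ c^4`. -/
lemma doleans_pow_four_le (hR : IsBddField R c) (ha : 0 ≤ a) (s : ℝ≥0) (ω : Ω) :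
    C.doleans T R 0 s ω ^ 4 ≤
      C.doleans T (fun x => R x ^ 4) a s ω * Real.exp ((3 + a + c ^ 4) * C.mass T ω) := by
  obtain ⟨m, τ, ξ, -, -, hJ⟩ := C.exists_jumps_eq T ω
  rw [doleans_eq T hR hJ, doleans_eq T hR.pow_four hJ, mul_pow, ← Finset.prod_pow, mul_right_comm,
    ← Real.exp_nat_mul, ← Real.exp_add]
  refine mul_le_mul_of_nonneg_right (Real.exp_le_exp.2 ?_)
    (Finset.prod_nonneg fun _ _ => pow_nonneg (hR.nonneg _) 4)
  have h1 : ∫ v in Iio s, (3 + a + c ^ 4) ∂(C.clock T ω) ≤ (3 + a + c ^ 4) * C.mass T ω := by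
    rw [setIntegral_const, smul_eq_mul, mul_comm]
    exact mul_le_mul_of_nonneg_left (measureReal_mono (subset_univ _)) (by positivity)
  refine le_trans ?_ (add_le_add_right h1 _)
  have i1 := (integrable_rate (C := C) (a := 0) T hR ω).restrict (s := Iio s)
  have i2 := (integrable_rate (C := C) (a := a) T hR.pow_four ω).restrict (s := Iio s)
  rw [← integral_const_mul, ← integral_add i2 (integrable_const _)]
  refine integral_mono (i1.const_mul _) (i2.add (integrable_const _)) fun v => ?_
  have := rate_nonneg (C := C) hR (PredSpace.mk M (v, ω))
  have := rate_le (C := C) hR.pow_four (PredSpace.mk M (v, ω))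
  push_cast
  linarith

/-- A weighted geometric mean of `y` and `w` is at most their maximum. -/
lemma le_add_of_pow_four_le {x y w : ℝ} (hy : 0 ≤ y) (hw : 0 ≤ w) (h : x ^ 4 ≤ y * w ^ 3) :
    x ≤ y + w := by
  by_contra! hcon
  have h1 : y < x := by linarith
  have h2 : w ≤ x := by linarith
  have hx : 0 < x := hy.trans_lt h1
  have h3 : w ^ 3 ≤ x ^ 3 := pow_le_pow_left₀ hw h2 3
  have h4 : y * w ^ 3 ≤ y * x ^ 3 := mul_le_mul_of_nonneg_left h3 hy
  have h5 : y * x ^ 3 < x * x ^ 3 := mul_lt_mul_of_pos_right h1 (by positivity)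
  nlinarith

lemma sq_le_add_of_pow_four_le {x y w : ℝ} (hy : 0 ≤ y) (hw : 0 ≤ w) (h : x ^ 4 ≤ y * w) :
    x ^ 2 ≤ y + w := by
  nlinarith [sq_nonneg x, mul_nonneg hy hw]

/-- The choice `a = 1` makes the supermartingale bound control `E ∫ D dA` for the field `R^4`, and
the fourth-power comparison passes this to `R`. -/
lemma lintegral_doleans_clock_ne_top [IsProbabilityMeasure P] (hR : IsBddField R c)
    (hE : ∫⁻ ω, ENNReal.ofReal (Real.exp ((3 + c ^ 4) * C.mass T ω)) ∂P ≠ ∞) :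
    ∫⁻ ω, ∫⁻ v, ENNReal.ofReal (C.doleans T R 0 v ω) ∂(C.clock T ω) ∂P ≠ ∞ := by
  have hc4 : 0 ≤ c ^ 4 := by positivity
  have h2 := exp_mul_mass_ne_top (κ' := 2) (by linarith) hE
  have hR4 := hR.pow_four
  have hle : ∀ ω, ∫⁻ v, ENNReal.ofReal (C.doleans T R 0 v ω) ∂(C.clock T ω) ≤
      (ENNReal.ofReal (C.doleans T (fun x => R x ^ 4) 1 (T + 1) ω) + ENNReal.ofReal 1 *
        ∫⁻ v, ENNReal.ofReal (C.doleans T (fun x => R x ^ 4) 1 v ω) ∂(C.clock T ω)) +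
        ENNReal.ofReal (Real.exp ((3 + c ^ 4) * C.mass T ω)) := by
    intro ω
    -- Chosen so that `w ^ 3` is the exponential factor of `doleans_pow_four_le` at `a = 1`.
    -- Integrating `w` over the clock costs one more factor `exp(mass)`, and `(7 + c^4)/3 ≤ 3 +
    -- c^4`.
    set w := Real.exp ((4 + c ^ 4) / 3 * C.mass T ω) with hw
    have hbound : ∀ v, C.doleans T R 0 v ω ≤ C.doleans T (fun x => R x ^ 4) 1 v ω + w := by
      intro v
      refine le_add_of_pow_four_le (doleans_nonneg T hR4 v ω) (Real.exp_pos _).le ?_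
      refine (doleans_pow_four_le hR zero_le_one v ω).trans_eq ?_
      rw [hw, ← Real.exp_nat_mul]
      congr 2
      push_cast
      ring
    have hdm : Measurable fun v => ENNReal.ofReal (C.doleans T (fun x => R x ^ 4) 1 v ω) :=
      ((measurable_doleans T hR4).comp (measurable_time_section M ω)).ennreal_ofReal
    calc _ ≤ ∫⁻ v, ENNReal.ofReal (C.doleans T (fun x => R x ^ 4) 1 v ω) + ENNReal.ofReal w
          ∂(C.clock T ω) := lintegral_mono fun v =>
            (ENNReal.ofReal_le_ofReal (hbound v)).trans ENNReal.ofReal_add_le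
      _ = ∫⁻ v, ENNReal.ofReal (C.doleans T (fun x => R x ^ 4) 1 v ω) ∂(C.clock T ω) +
          ENNReal.ofReal (w * C.mass T ω) := by
            rw [lintegral_add_left hdm, lintegral_const, clock_univ_eq,
              ← ENNReal.ofReal_mul (Real.exp_pos _).le]
      _ ≤ _ := by
            rw [ENNReal.ofReal_one, one_mul]
            refine add_le_add le_add_self (ENNReal.ofReal_le_ofReal ?_)
            have h1 : C.mass T ω ≤ Real.exp (C.mass T ω) :=
              (by linarith : C.mass T ω ≤ C.mass T ω + 1).trans (Real.add_one_le_exp _)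
            calc w * C.mass T ω ≤ w * Real.exp (C.mass T ω) := by gcongr
              _ = Real.exp ((7 + c ^ 4) / 3 * C.mass T ω) := by
                  rw [hw, ← Real.exp_add]; congr 1; ring
              _ ≤ _ := Real.exp_le_exp.2
                  (mul_le_mul_of_nonneg_right (by linarith) (C.mass_nonneg T ω))
  refine ne_top_of_le_ne_top ?_ (lintegral_mono hle)
  rw [lintegral_add_right _ (by
    exact (Real.measurable_exp.comp ((C.measurable_mass T).const_mul _)).ennreal_ofReal)]
  exact ENNReal.add_ne_top.2
    ⟨ne_top_of_le_ne_top ENNReal.one_ne_top (lintegral_doleans_le_one hR4 zero_le_one h2), hE⟩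

lemma lintegral_doleans_end_eq_one [IsProbabilityMeasure P] (hR : IsBddField R c)
    (hE : ∫⁻ ω, ENNReal.ofReal (Real.exp ((3 + c ^ 4) * C.mass T ω)) ∂P ≠ ∞) :
    ∫⁻ ω, ENNReal.ofReal (C.doleans T R 0 (T + 1) ω) ∂P = 1 := by
  simpa using lintegral_doleans_eq_one T hR le_rfl (lintegral_doleans_clock_ne_top hR hE)

/-- The fourth-power comparison with `a = 0` at the terminal time: its factor is exactly `exp((3 +
c^4) mass)`, and `x^4 ≤ y w` bounds `x^2` by `y + w`. -/
lemma lintegral_doleans_sq_ne_top [IsProbabilityMeasure P] (hR : IsBddField R c)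
    (hE : ∫⁻ ω, ENNReal.ofReal (Real.exp ((3 + c ^ 4) * C.mass T ω)) ∂P ≠ ∞) :
    ∫⁻ ω, ENNReal.ofReal (C.doleans T R 0 (T + 1) ω ^ 2) ∂P ≠ ∞ := by
  have hc4 : 0 ≤ c ^ 4 := by positivity
  have h2 := exp_mul_mass_ne_top (κ' := 2) (by linarith) hE
  have hle : ∀ ω, ENNReal.ofReal (C.doleans T R 0 (T + 1) ω ^ 2) ≤
      (ENNReal.ofReal (C.doleans T (fun x => R x ^ 4) 0 (T + 1) ω) + ENNReal.ofReal 0 *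
        ∫⁻ v, ENNReal.ofReal (C.doleans T (fun x => R x ^ 4) 0 v ω) ∂(C.clock T ω)) +
        ENNReal.ofReal (Real.exp ((3 + c ^ 4) * C.mass T ω)) := by
    intro ω
    rw [ENNReal.ofReal_zero, zero_mul, add_zero,
      ← ENNReal.ofReal_add (doleans_nonneg T hR.pow_four _ ω) (Real.exp_pos _).le]
    refine ENNReal.ofReal_le_ofReal (sq_le_add_of_pow_four_le
      (doleans_nonneg T hR.pow_four _ ω) (Real.exp_pos _).le ?_)
    simpa using doleans_pow_four_le (a := 0) hR le_rfl (T + 1) ω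
  refine ne_top_of_le_ne_top ?_ (lintegral_mono hle)
  rw [lintegral_add_right _ (by
    exact (Real.measurable_exp.comp ((C.measurable_mass T).const_mul _)).ennreal_ofReal)]
  exact ENNReal.add_ne_top.2
    ⟨ne_top_of_le_ne_top ENNReal.one_ne_top (lintegral_doleans_le_one hR.pow_four le_rfl h2), hE⟩

end Compensator

end MPPControl

/-! ### Change of compensator by perturbation of the density -/

namespace MPPControl

set_option linter.unusedSectionVars false

variable {Ω : Type*} [mΩ : MeasurableSpace Ω] {P : Measure Ω} [P.IsComplete]
  {K : Type*} [mK : MeasurableSpace K]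

/-- Bounds the difference quotient in `ε` uniformly on `[0, 1]`, for dominated convergence. It rests
on `1 + x ≤ exp x` and `exp x - 1 ≤ x exp x`. -/
lemma abs_prod_mul_exp_sub_one_le {m : ℕ} {f : ℕ → ℝ} (hf : ∀ j, 0 ≤ f j) {W ε : ℝ} (hW : 0 ≤ W)
    (hε : 0 ≤ ε) (hε1 : ε ≤ 1) :
    |(∏ j ∈ Finset.range m, (1 + ε * f j)) * Real.exp (-(ε * W)) - 1| ≤
      ε * ((∑ j ∈ Finset.range m, f j) * Real.exp (∑ j ∈ Finset.range m, f j) + W) := by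
  set V := ∑ j ∈ Finset.range m, f j with hV
  set p := ∏ j ∈ Finset.range m, (1 + ε * f j) with hp
  have hV0 : 0 ≤ V := Finset.sum_nonneg fun j _ => hf j
  have h1 : 1 ≤ p := by
    calc (1 : ℝ) = ∏ j ∈ Finset.range m, (1 : ℝ) := by simp
      _ ≤ p := Finset.prod_le_prod (fun _ _ => zero_le_one) fun j _ => by
        have := mul_nonneg hε (hf j)
        linarith
  have h2 : p ≤ Real.exp (ε * V) := by
    rw [hV, Finset.mul_sum, Real.exp_sum]
    refine Finset.prod_le_prod (fun j _ => ?_) fun j _ => ?_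
    · have := mul_nonneg hε (hf j)
      linarith
    · rw [add_comm]; exact Real.add_one_le_exp _
  have h3 : Real.exp (ε * V) - 1 ≤ ε * V * Real.exp (ε * V) := by
    have h := mul_le_mul_of_nonneg_left (Real.add_one_le_exp (-(ε * V))) (Real.exp_pos (ε * V)).le
    rw [← Real.exp_add, add_neg_cancel, Real.exp_zero] at h
    linarith
  have h4 : Real.exp (ε * V) ≤ Real.exp V := Real.exp_le_exp.2 (mul_le_of_le_one_left hV0 hε1)
  have h5 : ε * V * Real.exp (ε * V) ≤ ε * V * Real.exp V :=
    mul_le_mul_of_nonneg_left h4 (mul_nonneg hε hV0)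
  have h6 : Real.exp (-(ε * W)) ≤ 1 := Real.exp_le_one_iff.2 (by
    have := mul_nonneg hε hW
    linarith)
  have h7 := Real.add_one_le_exp (-(ε * W))
  have h8 : 0 < Real.exp (-(ε * W)) := Real.exp_pos _
  have h9 : 0 ≤ ε * W := mul_nonneg hε hW
  have h10 : 0 ≤ ε * V * Real.exp V := by positivity
  rw [abs_le]
  constructor
  · nlinarith
  · nlinarith

lemma tendsto_prod_mul_exp_sub_one (m : ℕ) (f : ℕ → ℝ) (W : ℝ) :
    Tendsto (fun ε : ℝ => ε⁻¹ *
      ((∏ j ∈ Finset.range m, (1 + ε * f j)) * Real.exp (-(ε * W)) - 1)) (𝓝[≠] 0)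
      (𝓝 ((∑ j ∈ Finset.range m, f j) - W)) := by
  have h1 : HasDerivAt (fun ε : ℝ => ∏ j ∈ Finset.range m, (1 + ε * f j))
      (∑ j ∈ Finset.range m, f j) 0 := by
    have := HasDerivAt.fun_finsetProd (u := Finset.range m) (f := fun j (ε : ℝ) => 1 + ε * f j)
      (f' := f) (x := 0) fun j _ => by
        simpa using ((hasDerivAt_id (0 : ℝ)).mul_const (f j)).const_add 1
    simpa using this
  have h2 : HasDerivAt (fun ε : ℝ => Real.exp (-(ε * W))) (-W) 0 := by
    simpa using (((hasDerivAt_id (0 : ℝ)).mul_const W).neg).exp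
  have h3 := (h1.mul h2).tendsto_slope_zero
  simpa [sub_eq_add_neg] using h3

namespace Compensator

variable {M : MarkedPointProcess P K} {C : Compensator M} {T : ℝ≥0}
  {R H : PredSpace M × K → ℝ} {c h : ℝ}

lemma integrable_rate_section (hR : IsBddField R c) (ω : Ω) :
    Integrable (fun v => C.rate R (PredSpace.mk M (v, ω))) (C.clock T ω) := by
  refine Integrable.of_bound ((measurable_rate hR.measurable).comp
    (measurable_time_section M ω)).aestronglyMeasurable c (ae_of_all _ fun v => ?_)
  exact (abs_of_nonneg (rate_nonneg hR _)).trans_le (rate_le hR _)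

lemma isBddField_mul (hR : IsBddField R c) (hH : IsBddField H h) (hh : 0 ≤ h) :
    IsBddField (fun x => H x * R x) (h * c) where
  measurable := hH.measurable.mul hR.measurable
  nonneg x := mul_nonneg (hH.nonneg x) (hR.nonneg x)
  le x := mul_le_mul (hH.le x) (hR.le x) (hR.nonneg x) hh

lemma isBddField_perturb (hR : IsBddField R c) (hH : IsBddField H h) (hc : 0 ≤ c) {ε : ℝ}
    (hε : 0 ≤ ε) (hε1 : ε ≤ 1) : IsBddField (fun x => R x * (1 + ε * H x)) (c * (1 + h)) where
  measurable := hR.measurable.mul (measurable_const.add (hH.measurable.const_mul ε))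
  nonneg x := mul_nonneg (hR.nonneg x) (add_nonneg zero_le_one (mul_nonneg hε (hH.nonneg x)))
  le x := by
    have h1 := hH.nonneg x
    have h2 := hH.le x
    exact mul_le_mul (hR.le x) (by nlinarith) (by nlinarith) hc

lemma rate_perturb (hR : IsBddField R c) (hH : IsBddField H h) (hh : 0 ≤ h) (ε : ℝ)
    (x : PredSpace M) : C.rate (fun x => R x * (1 + ε * H x)) x =
      C.rate R x + ε * C.rate (fun x => H x * R x) x := by
  have h1 := integrable_field (C := C) hR x
  have h2 := integrable_field (C := C) (isBddField_mul hR hH hh) x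
  rw [rate, rate, rate, ← integral_const_mul, ← integral_add h1 (h2.const_mul ε)]
  exact integral_congr_ae (ae_of_all _ fun y => by ring)

/-- The exponential is multiplicative: the factors `1 + ε H` come out of the product and the extra
rate, linear in `ε`, out of the exponent. -/
lemma doleans_perturb (hR : IsBddField R c) (hH : IsBddField H h) (hh : 0 ≤ h) (hc : 0 ≤ c)
    {ε : ℝ} (hε : 0 ≤ ε) (hε1 : ε ≤ 1) {ω : Ω} {m : ℕ} {τ : ℕ → ℝ≥0} {ξ : ℕ → K}
    (hJ : C.jumps T ω = ∑ j ∈ Finset.range m, Measure.dirac (τ j, ξ j)) (s : ℝ≥0) :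
    C.doleans T (fun x => R x * (1 + ε * H x)) 0 s ω = C.doleans T R 0 s ω *
      ((∏ j ∈ Finset.range m with τ j < s, (1 + ε * H (PredSpace.mk M (τ j, ω), ξ j))) *
        Real.exp (-(ε * ∫ v in Iio s,
          C.rate (fun x => H x * R x) (PredSpace.mk M (v, ω)) ∂(C.clock T ω)))) := by
  have hHR := isBddField_mul hR hH hh
  rw [doleans_eq T hR hJ, doleans_eq T (isBddField_perturb hR hH hc hε hε1) hJ,
    Finset.prod_mul_distrib]
  have hi : Integrable (fun v => C.rate (fun x => H x * R x) (PredSpace.mk M (v, ω)))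
      (C.clock T ω) :=
    integrable_rate_section hHR ω
  have e1 : ∫ v in Iio s, (1 - 0 - C.rate (fun x => R x * (1 + ε * H x)) (PredSpace.mk M (v, ω)))
      ∂(C.clock T ω) = (∫ v in Iio s, (1 - 0 - C.rate R (PredSpace.mk M (v, ω))) ∂(C.clock T ω)) +
      -(ε * ∫ v in Iio s, C.rate (fun x => H x * R x) (PredSpace.mk M (v, ω)) ∂(C.clock T ω)) := by
    rw [← integral_const_mul, ← sub_eq_add_neg,
      ← integral_sub (integrable_rate T hR ω).restrict (hi.restrict.const_mul ε)]
    refine integral_congr_ae (ae_of_all _ fun v => ?_)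
    simp only [rate_perturb hR hH hh]
    ring
  rw [e1, Real.exp_add]
  ring

/-- The perturbed field is bounded by `c (1 + h)` only, and no exponential moment is assumed for
that constant. As `H` vanishes after `n` points, the perturbed exponential is at most `(1 + h)^n`
times the original one, and inherits its integrability. -/
lemma lintegral_doleans_perturb [IsProbabilityMeasure P] (hR : IsBddField R c)
    (hH : IsBddField H h) (hh : 0 ≤ h) (hc : 0 ≤ c) {n : ℕ}
    (hcut : ∀ x : PredSpace M × K, x.1 ∉ C.cutSet T n → H x = 0)
    (hE : ∫⁻ ω, ENNReal.ofReal (Real.exp ((3 + c ^ 4) * C.mass T ω)) ∂P ≠ ∞)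
    {ε : ℝ} (hε : 0 ≤ ε) (hε1 : ε ≤ 1) :
    ∫⁻ ω, ENNReal.ofReal (C.doleans T (fun x => R x * (1 + ε * H x)) 0 (T + 1) ω) ∂P = 1 := by
  have hRε := isBddField_perturb hR hH hc hε hε1
  suffices hfin : ∫⁻ ω, ∫⁻ v, ENNReal.ofReal (C.doleans T (fun x => R x * (1 + ε * H x)) 0 v ω)
      ∂(C.clock T ω) ∂P ≠ ∞ by
    simpa using lintegral_doleans_eq_one T hRε le_rfl hfin
  have hle : ∀ ω v, C.doleans T (fun x => R x * (1 + ε * H x)) 0 v ω ≤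
      (1 + h) ^ n * C.doleans T R 0 v ω := by
    intro ω v
    obtain ⟨m, τ, ξ, hτ, -, hJ⟩ := C.exists_jumps_eq T ω
    rw [doleans_perturb hR hH hh hc hε hε1 hJ, mul_comm]
    refine mul_le_mul_of_nonneg_right ?_ (doleans_nonneg T hR v ω)
    have h0 : ∀ j, 0 ≤ ε * H (PredSpace.mk M (τ j, ω), ξ j) := fun j => mul_nonneg hε (hH.nonneg _)
    have h1 : ∏ j ∈ Finset.range m with τ j < v, (1 + ε * H (PredSpace.mk M (τ j, ω), ξ j)) ≤
        (1 + h) ^ n := by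
      refine prod_filter_le_pow (by linarith) (fun j => by linarith [h0 j]) ?_ ?_
      · intro j _ _
        have := hH.le (PredSpace.mk M (τ j, ω), ξ j)
        have := hH.nonneg (PredSpace.mk M (τ j, ω), ξ j)
        nlinarith
      · intro j hj hn
        rw [hcut _ fun hmem => absurd ((mem_cutSet_iff hτ hJ hj).1 hmem) (not_lt.2 hn)]
        simp
    refine (mul_le_of_le_one_right (Finset.prod_nonneg fun j _ => by linarith [h0 j]) ?_).trans h1
    refine Real.exp_le_one_iff.2 (neg_nonpos.2 (mul_nonneg hε (integral_nonneg fun v => ?_)))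
    exact rate_nonneg (isBddField_mul hR hH hh) _
  refine ne_top_of_le_ne_top ?_ (lintegral_mono fun ω => lintegral_mono fun v =>
    ENNReal.ofReal_le_ofReal (hle ω v))
  simp_rw [ENNReal.ofReal_mul (pow_nonneg (by linarith : 0 ≤ 1 + h) n),
    lintegral_const_mul' _ _ ENNReal.ofReal_ne_top]
  exact ENNReal.mul_ne_top ENNReal.ofReal_ne_top (lintegral_doleans_clock_ne_top hR hE)

lemma integrable_of_lintegral_ofReal_ne_top {f : Ω → ℝ} (hf : Measurable f) (h0 : ∀ ω, 0 ≤ f ω)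
    (h : ∫⁻ ω, ENNReal.ofReal (f ω) ∂P ≠ ∞) : Integrable f P :=
  (lintegral_ofReal_ne_top_iff_integrable hf.aestronglyMeasurable (ae_of_all _ h0)).1 h

/-- Both factors are square integrable: the density by `lintegral_doleans_sq_ne_top`, the mass
because it is at most its exponential. -/
lemma integrable_doleans_mul_mass [IsProbabilityMeasure P] (hR : IsBddField R c)
    (hE : ∫⁻ ω, ENNReal.ofReal (Real.exp ((3 + c ^ 4) * C.mass T ω)) ∂P ≠ ∞) :
    Integrable (fun ω => C.doleans T R 0 (T + 1) ω * C.mass T ω) P := by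
  have hm : Measurable fun ω => C.doleans T R 0 (T + 1) ω := measurable_doleans_end T hR _
  have i1 : Integrable (fun ω => C.doleans T R 0 (T + 1) ω ^ 2) P :=
    integrable_of_lintegral_ofReal_ne_top (hm.pow_const 2) (fun ω => sq_nonneg _)
      (lintegral_doleans_sq_ne_top hR hE)
  have hc4 : 0 ≤ c ^ 4 := by positivity
  have i2 : Integrable (fun ω => Real.exp (2 * C.mass T ω)) P :=
    integrable_of_lintegral_ofReal_ne_top
      (Real.measurable_exp.comp ((C.measurable_mass T).const_mul 2)) (fun ω => (Real.exp_pos _).le)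
      (exp_mul_mass_ne_top (by linarith) hE)
  refine (i1.add i2).mono' (hm.mul (C.measurable_mass T)).aestronglyMeasurable
    (ae_of_all _ fun ω => ?_)
  have h1 : C.mass T ω ≤ Real.exp (C.mass T ω) :=
    (by linarith : C.mass T ω ≤ C.mass T ω + 1).trans (Real.add_one_le_exp _)
  have h2 := C.mass_nonneg T ω
  have h3 := doleans_nonneg (C := C) T (a := 0) hR (T + 1) ω
  rw [Real.norm_eq_abs, abs_of_nonneg (mul_nonneg h3 h2)]
  simp only [Pi.add_apply]
  rw [two_mul, Real.exp_add]
  nlinarith [sq_nonneg (C.doleans T R 0 (T + 1) ω - C.mass T ω)]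

/-- The compensator of the jump measure under the density `doleans`, for bounded integrands that
vanish after finitely many points. -/
lemma lintegral_doleans_mul_jumps_of_cut [IsProbabilityMeasure P] (hR : IsBddField R c)
    (hH : IsBddField H h) (hh : 0 ≤ h) (hc : 0 ≤ c) {n : ℕ}
    (hcut : ∀ x : PredSpace M × K, x.1 ∉ C.cutSet T n → H x = 0)
    (hE : ∫⁻ ω, ENNReal.ofReal (Real.exp ((3 + c ^ 4) * C.mass T ω)) ∂P ≠ ∞) :
    ∫⁻ ω, ENNReal.ofReal (C.doleans T R 0 (T + 1) ω) *
        ∫⁻ z, ENNReal.ofReal (H (PredSpace.mk M (z.1, ω), z.2)) ∂(C.jumps T ω) ∂P =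
      ∫⁻ ω, ENNReal.ofReal (C.doleans T R 0 (T + 1) ω) *
        ∫⁻ v, ENNReal.ofReal (C.rate (fun x => H x * R x) (PredSpace.mk M (v, ω)))
          ∂(C.clock T ω) ∂P := by
  have hHR := isBddField_mul hR hH hh
  set L : Ω → ℝ := fun ω => C.doleans T R 0 (T + 1) ω with hL
  set V : Ω → ℝ := fun ω =>
    (∫⁻ z, ENNReal.ofReal (H (PredSpace.mk M (z.1, ω), z.2)) ∂(C.jumps T ω)).toReal with hV
  set W : Ω → ℝ := fun ω =>
    ∫ v, C.rate (fun x => H x * R x) (PredSpace.mk M (v, ω)) ∂(C.clock T ω) with hW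
  have hL0 : ∀ ω, 0 ≤ L ω := fun ω => doleans_nonneg T hR _ ω
  have hLm : Measurable L := measurable_doleans_end T hR _
  have hrate : ∀ ω, Integrable (fun v => C.rate (fun x => H x * R x) (PredSpace.mk M (v, ω)))
      (C.clock T ω) := fun ω => integrable_rate_section hHR ω
  have hWl : ∀ ω, ∫⁻ v, ENNReal.ofReal (C.rate (fun x => H x * R x) (PredSpace.mk M (v, ω)))
      ∂(C.clock T ω) = ENNReal.ofReal (W ω) := fun ω =>
    (ofReal_integral_eq_lintegral_ofReal (hrate ω) (ae_of_all _ fun v => rate_nonneg hHR _)).symm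
  have hW0 : ∀ ω, 0 ≤ W ω := fun ω => integral_nonneg fun v => rate_nonneg hHR _
  have hWm : Measurable W := by
    have := (C.measurable_lintegral_clock T
      (measurable_rate (C := C) hHR.measurable).ennreal_ofReal).ennreal_toReal
    simp_rw [hWl, ENNReal.toReal_ofReal (hW0 _)] at this
    exact this
  have hWle : ∀ ω, W ω ≤ h * c * C.mass T ω := fun ω => by
    have := integral_mono (hrate ω) (integrable_const (h * c)) fun v => rate_le hHR _
    rw [integral_const, smul_eq_mul, mul_comm] at this
    exact this
  have hsec : ∀ ω, Measurable fun z : ℝ≥0 × K =>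
      ENNReal.ofReal (H (PredSpace.mk M (z.1, ω), z.2)) := fun ω =>
    (hH.measurable.comp (measurable_section M ω)).ennreal_ofReal
  have hVs : ∀ {ω : Ω} {m : ℕ} {τ : ℕ → ℝ≥0} {ξ : ℕ → K},
      C.jumps T ω = ∑ j ∈ Finset.range m, Measure.dirac (τ j, ξ j) →
      V ω = ∑ j ∈ Finset.range m, H (PredSpace.mk M (τ j, ω), ξ j) := by
    intro ω m τ ξ hJ
    rw [hV]
    simp only
    rw [hJ, lintegral_sum_dirac (hsec ω), ENNReal.toReal_sum fun _ _ => ENNReal.ofReal_ne_top]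
    exact Finset.sum_congr rfl fun j _ => ENNReal.toReal_ofReal (hH.nonneg _)
  have hVl : ∀ ω, ∫⁻ z, ENNReal.ofReal (H (PredSpace.mk M (z.1, ω), z.2)) ∂(C.jumps T ω) =
      ENNReal.ofReal (V ω) := by
    intro ω
    refine (ENNReal.ofReal_toReal ?_).symm
    obtain ⟨m, τ, ξ, -, -, hJ⟩ := C.exists_jumps_eq T ω
    rw [hJ, lintegral_sum_dirac (hsec ω)]
    simp
  have hV0 : ∀ ω, 0 ≤ V ω := fun ω => ENNReal.toReal_nonneg
  have hVm : Measurable V :=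
    (C.measurable_lintegral_jumps T hH.measurable.ennreal_ofReal).ennreal_toReal
  have hVle : ∀ ω, V ω ≤ n * h := by
    intro ω
    obtain ⟨m, τ, ξ, hτ, -, hJ⟩ := C.exists_jumps_eq T ω
    rw [hVs hJ]
    calc ∑ j ∈ Finset.range m, H (PredSpace.mk M (τ j, ω), ξ j)
        ≤ ∑ j ∈ Finset.range m, if j < n then h else 0 := by
          refine Finset.sum_le_sum fun j hj => ?_
          split_ifs with hn
          · exact hH.le _
          · refine (hcut _ fun hmem => hn ?_).le
            exact (mem_cutSet_iff hτ hJ (Finset.mem_range.1 hj)).1 hmem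
      _ = ((Finset.range m).filter (· < n)).card * h := by
          rw [← Finset.sum_filter, Finset.sum_const, nsmul_eq_mul]
      _ ≤ n * h := by
          refine mul_le_mul_of_nonneg_right (Nat.cast_le.2 ?_) hh
          calc _ ≤ (Finset.range n).card := Finset.card_le_card fun j hj =>
                Finset.mem_range.2 (Finset.mem_filter.1 hj).2
            _ = n := Finset.card_range n
  have hLi : Integrable L P := integrable_of_lintegral_ofReal_ne_top hLm hL0 (by
    rw [lintegral_doleans_end_eq_one hR hE]; exact ENNReal.one_ne_top)
  have hLmass : Integrable (fun ω => L ω * C.mass T ω) P := integrable_doleans_mul_mass hR hE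
  have hLV : Integrable (fun ω => L ω * V ω) P := by
    refine (hLi.mul_const (n * h)).mono' (hLm.mul hVm).aestronglyMeasurable (ae_of_all _ fun ω => ?_)
    rw [Real.norm_eq_abs, abs_of_nonneg (mul_nonneg (hL0 ω) (hV0 ω))]
    exact mul_le_mul_of_nonneg_left (hVle ω) (hL0 ω)
  have hLW : Integrable (fun ω => L ω * W ω) P := by
    refine (hLmass.const_mul (h * c)).mono' (hLm.mul hWm).aestronglyMeasurable
      (ae_of_all _ fun ω => ?_)
    rw [Real.norm_eq_abs, abs_of_nonneg (mul_nonneg (hL0 ω) (hW0 ω))]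
    calc L ω * W ω ≤ L ω * (h * c * C.mass T ω) := mul_le_mul_of_nonneg_left (hWle ω) (hL0 ω)
      _ = _ := by ring
  set ε : ℕ → ℝ := fun k => 1 / ((k : ℝ) + 1) with hε
  have hε0 : ∀ k, 0 < ε k := fun k => by positivity
  have hε1 : ∀ k, ε k ≤ 1 := fun k => by
    rw [hε]; simp only
    rw [div_le_one (by positivity)]
    have : (0 : ℝ) ≤ k := by positivity
    linarith
  have hεlim : Tendsto ε atTop (𝓝[≠] 0) := by
    refine tendsto_nhdsWithin_iff.2 ⟨tendsto_one_div_add_atTop_nhds_zero_nat, ?_⟩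
    exact Eventually.of_forall fun k => (hε0 k).ne'
  set Q : ℕ → Ω → ℝ := fun k ω =>
    C.doleans T (fun x => R x * (1 + ε k * H x)) 0 (T + 1) ω with hQ
  have hbdd : ∀ k, IsBddField (fun x => R x * (1 + ε k * H x)) (c * (1 + h)) := fun k =>
    isBddField_perturb hR hH hc (hε0 k).le (hε1 k)
  have hQm : ∀ k, Measurable (Q k) := fun k => measurable_doleans_end T (hbdd k) _
  have hQ0 : ∀ k ω, 0 ≤ Q k ω := fun k ω => doleans_nonneg T (hbdd k) _ ω
  have hQ1 : ∀ k, ∫⁻ ω, ENNReal.ofReal (Q k ω) ∂P = 1 := fun k =>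
    lintegral_doleans_perturb hR hH hh hc hcut hE (hε0 k).le (hε1 k)
  have hQi : ∀ k, Integrable (Q k) P := fun k =>
    integrable_of_lintegral_ofReal_ne_top (hQm k) (hQ0 k) (by
      rw [hQ1]; exact ENNReal.one_ne_top)
  have hQint : ∀ k, ∫ ω, Q k ω ∂P = 1 := fun k => by
    rw [integral_eq_lintegral_of_nonneg_ae (ae_of_all _ (hQ0 k)) (hQm k).aestronglyMeasurable, hQ1,
      ENNReal.toReal_one]
  have hLint : ∫ ω, L ω ∂P = 1 := by
    rw [integral_eq_lintegral_of_nonneg_ae (ae_of_all _ hL0) hLm.aestronglyMeasurable,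
      lintegral_doleans_end_eq_one hR hE, ENNReal.toReal_one]
  have hQL : ∀ k {ω : Ω} {m : ℕ} {τ : ℕ → ℝ≥0} {ξ : ℕ → K},
      (∀ j < m, 0 < τ j ∧ τ j ≤ T) →
      C.jumps T ω = ∑ j ∈ Finset.range m, Measure.dirac (τ j, ξ j) →
      (ε k)⁻¹ * (Q k ω - L ω) = L ω * ((ε k)⁻¹ *
        ((∏ j ∈ Finset.range m, (1 + ε k * H (PredSpace.mk M (τ j, ω), ξ j))) *
          Real.exp (-(ε k * W ω)) - 1)) := by
    intro k ω m τ ξ hτT hJ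
    rw [hQ]
    simp only
    rw [doleans_perturb hR hH hh hc (hε0 k).le (hε1 k) hJ, clock_restrict,
      Finset.filter_true_of_mem fun j hj =>
        (hτT j (Finset.mem_range.1 hj)).2.trans_lt (lt_add_one T)]
    ring
  -- Differentiation under the expectation at `ε = 0`. The dominating function uses `V ≤ n h`, which
  -- holds because `H` vanishes after `n` points.
  have hlim : Tendsto (fun k => ∫ ω, (ε k)⁻¹ * (Q k ω - L ω) ∂P) atTop
      (𝓝 (∫ ω, L ω * (V ω - W ω) ∂P)) := by
    refine tendsto_integral_of_dominated_convergence
      (fun ω => L ω * (n * h * Real.exp (n * h)) + L ω * W ω)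
      (fun k => (((hQm k).sub hLm).const_mul _).aestronglyMeasurable)
      ((hLi.mul_const _).add hLW) (fun k => ae_of_all _ fun ω => ?_) (ae_of_all _ fun ω => ?_)
    · obtain ⟨m, τ, ξ, hτ, hτT, hJ⟩ := C.exists_jumps_eq T ω
      have hb := abs_prod_mul_exp_sub_one_le (m := m)
        (f := fun j => H (PredSpace.mk M (τ j, ω), ξ j)) (fun j => hH.nonneg _) (hW0 ω)
        (hε0 k).le (hε1 k)
      rw [← hVs hJ] at hb
      rw [hQL k hτT hJ, Real.norm_eq_abs, abs_mul, abs_mul, abs_of_nonneg (hL0 ω),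
        abs_of_pos (inv_pos.2 (hε0 k)), ← mul_add]
      refine mul_le_mul_of_nonneg_left ?_ (hL0 ω)
      rw [inv_mul_le_iff₀ (hε0 k)]
      refine hb.trans (mul_le_mul_of_nonneg_left ?_ (hε0 k).le)
      have := hVle ω
      have := hV0 ω
      gcongr
    · obtain ⟨m, τ, ξ, hτ, hτT, hJ⟩ := C.exists_jumps_eq T ω
      simp_rw [fun k => hQL k hτT hJ]
      rw [hVs hJ]
      exact ((tendsto_prod_mul_exp_sub_one m _ (W ω)).comp hεlim).const_mul (L ω)
  -- Both densities have mean one, so every difference quotient has mean zero, and so has its limit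
  -- `L (V - W)`.
  have hzero : ∀ k, ∫ ω, (ε k)⁻¹ * (Q k ω - L ω) ∂P = 0 := fun k => by
    rw [integral_const_mul, integral_sub (hQi k) hLi, hQint, hLint, sub_self, mul_zero]
  simp_rw [hzero] at hlim
  have heq := tendsto_nhds_unique hlim tendsto_const_nhds
  simp_rw [mul_sub] at heq
  rw [integral_sub hLV hLW, sub_eq_zero] at heq
  simp_rw [hVl, hWl]
  calc _ = ∫⁻ ω, ENNReal.ofReal (L ω * V ω) ∂P :=
        lintegral_congr fun ω => (ENNReal.ofReal_mul (hL0 ω)).symm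
    _ = ∫⁻ ω, ENNReal.ofReal (L ω * W ω) ∂P := by
        rw [← ofReal_integral_eq_lintegral_ofReal hLV
          (ae_of_all _ fun ω => mul_nonneg (hL0 ω) (hV0 ω)),
          ← ofReal_integral_eq_lintegral_ofReal hLW
          (ae_of_all _ fun ω => mul_nonneg (hL0 ω) (hW0 ω)), heq]
    _ = _ := lintegral_congr fun ω => ENNReal.ofReal_mul (hL0 ω)

/-- Under the density `doleans`, the compensator of the jump measure is `R φ dA`. -/
theorem lintegral_doleans_mul_jumps [IsProbabilityMeasure P] (hR : IsBddField R c) (hc : 0 ≤ c)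
    (hE : ∫⁻ ω, ENNReal.ofReal (Real.exp ((3 + c ^ 4) * C.mass T ω)) ∂P ≠ ∞)
    {H : PredSpace M × K → ℝ≥0∞} (hH : Measurable H) :
    ∫⁻ ω, ENNReal.ofReal (C.doleans T R 0 (T + 1) ω) *
        ∫⁻ z, H (PredSpace.mk M (z.1, ω), z.2) ∂(C.jumps T ω) ∂P =
      ∫⁻ ω, ENNReal.ofReal (C.doleans T R 0 (T + 1) ω) *
        ∫⁻ v, ∫⁻ y, H (PredSpace.mk M (v, ω), y) * ENNReal.ofReal (R (PredSpace.mk M (v, ω), y))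
          ∂(C.kernel (PredSpace.mk M (v, ω))) ∂(C.clock T ω) ∂P := by
  -- Truncation both in size and in number of points brings `H` into the previous lemma. Each path
  -- has finitely many points, so `G n` increases to `H`.
  set G : ℕ → PredSpace M × K → ℝ≥0∞ := fun n =>
    (Prod.fst ⁻¹' (C.cutSet T n)).indicator fun x => min (H x) n with hG
  have hset : ∀ n, MeasurableSet (Prod.fst ⁻¹' (C.cutSet T n) : Set (PredSpace M × K)) := fun n =>
    measurable_fst (C.measurableSet_cutSet T n)
  have hGm : ∀ n, Measurable (G n) := fun n => (hH.min measurable_const).indicator (hset n)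
  have hGmono : Monotone G := by
    intro i j hij x
    simp only [hG]
    have hsub : x ∈ (Prod.fst ⁻¹' (C.cutSet T i) : Set (PredSpace M × K)) →
        x ∈ (Prod.fst ⁻¹' (C.cutSet T j) : Set (PredSpace M × K)) := fun hx =>
      lt_of_lt_of_le (show _ < (i : ℝ≥0∞) from hx) (Nat.cast_le.2 hij)
    by_cases hx : x ∈ (Prod.fst ⁻¹' (C.cutSet T i) : Set (PredSpace M × K))
    · rw [indicator_of_mem hx, indicator_of_mem (hsub hx)]
      exact min_le_min_left _ (Nat.cast_le.2 hij)
    · rw [indicator_of_notMem hx]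
      exact zero_le
  have hGsup : ∀ x, ⨆ n, G n x = H x := by
    intro x
    refine iSup_eq_of_tendsto (fun i j hij => hGmono hij x) ?_
    have h1 : Tendsto (fun n : ℕ => min (H x) (n : ℝ≥0∞)) atTop (𝓝 (H x)) := by
      simpa using (tendsto_const_nhds (x := H x)).min ENNReal.tendsto_nat_nhds_top
    refine h1.congr' ?_
    have h2 : C.jumps T x.1.pt (Iio x.1.time ×ˢ univ) < ∞ := measure_lt_top _ _
    filter_upwards [ENNReal.tendsto_nat_nhds_top.eventually_const_lt h2] with n hn
    exact (indicator_of_mem (s := (Prod.fst ⁻¹' (C.cutSet T n) : Set (PredSpace M × K))) hn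
      fun x => min (H x) (n : ℝ≥0∞)).symm
  have hGtop : ∀ n x, G n x ≠ ∞ := by
    intro n x
    simp only [hG, indicator]
    split_ifs
    · exact ne_top_of_le_ne_top (ENNReal.natCast_ne_top n) (min_le_right _ _)
    · exact ENNReal.zero_ne_top
  have hb : ∀ n : ℕ, IsBddField (fun x => (G n x).toReal) (n : ℝ) := fun n =>
    { measurable := (hGm n).ennreal_toReal
      nonneg := fun x => ENNReal.toReal_nonneg
      le := fun x => by
        refine ENNReal.toReal_le_of_le_ofReal (by positivity) ?_
        rw [ENNReal.ofReal_natCast]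
        simp only [hG, indicator]
        split_ifs
        · exact min_le_right _ _
        · exact zero_le }
  have hstep : ∀ n, ∫⁻ ω, ENNReal.ofReal (C.doleans T R 0 (T + 1) ω) *
        ∫⁻ z, G n (PredSpace.mk M (z.1, ω), z.2) ∂(C.jumps T ω) ∂P =
      ∫⁻ ω, ENNReal.ofReal (C.doleans T R 0 (T + 1) ω) *
        ∫⁻ v, ∫⁻ y, G n (PredSpace.mk M (v, ω), y) * ENNReal.ofReal (R (PredSpace.mk M (v, ω), y))
          ∂(C.kernel (PredSpace.mk M (v, ω))) ∂(C.clock T ω) ∂P := by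
    intro n
    have hcut : ∀ x : PredSpace M × K, x.1 ∉ C.cutSet T n → (G n x).toReal = 0 := fun x hx => by
      simp only [hG]
      rw [indicator_of_notMem (by exact hx), ENNReal.toReal_zero]
    have := lintegral_doleans_mul_jumps_of_cut hR (hb n) (Nat.cast_nonneg n) hc hcut hE
    simp_rw [ENNReal.ofReal_toReal (hGtop n _)] at this
    rw [this]
    refine lintegral_congr fun ω => congrArg _ (lintegral_congr fun v => ?_)
    rw [← lintegral_field (isBddField_mul hR (hb n) (Nat.cast_nonneg n))]
    refine lintegral_congr fun y => ?_
    rw [ENNReal.ofReal_mul ENNReal.toReal_nonneg, ENNReal.ofReal_toReal (hGtop n _)]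
  have hDm := (measurable_doleans_end (C := C) T (a := 0) hR (T + 1)).ennreal_ofReal
  have hGR : ∀ n, Measurable fun x => G n x * ENNReal.ofReal (R x) := fun n =>
    (hGm n).mul hR.measurable.ennreal_ofReal
  have hker : ∀ n, Measurable fun x : PredSpace M =>
      ∫⁻ y, G n (x, y) * ENNReal.ofReal (R (x, y)) ∂(C.kernel x) := fun n =>
    (hGR n).lintegral_kernel_prod_right'
  have lhs : ∫⁻ ω, ENNReal.ofReal (C.doleans T R 0 (T + 1) ω) *
        ∫⁻ z, H (PredSpace.mk M (z.1, ω), z.2) ∂(C.jumps T ω) ∂P =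
      ⨆ n, ∫⁻ ω, ENNReal.ofReal (C.doleans T R 0 (T + 1) ω) *
        ∫⁻ z, G n (PredSpace.mk M (z.1, ω), z.2) ∂(C.jumps T ω) ∂P := by
    rw [← lintegral_iSup]
    · refine lintegral_congr fun ω => ?_
      rw [← ENNReal.mul_iSup, ← lintegral_iSup]
      · simp_rw [hGsup]
      · exact fun n => (hGm n).comp (measurable_section M ω)
      · exact fun i j hij z => hGmono hij _
    · exact fun n => hDm.mul (C.measurable_lintegral_jumps T (hGm n))
    · exact fun i j hij ω => mul_le_mul_right (lintegral_mono fun z => hGmono hij _) _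
  have rhs : ∫⁻ ω, ENNReal.ofReal (C.doleans T R 0 (T + 1) ω) *
        ∫⁻ v, ∫⁻ y, H (PredSpace.mk M (v, ω), y) * ENNReal.ofReal (R (PredSpace.mk M (v, ω), y))
          ∂(C.kernel (PredSpace.mk M (v, ω))) ∂(C.clock T ω) ∂P =
      ⨆ n, ∫⁻ ω, ENNReal.ofReal (C.doleans T R 0 (T + 1) ω) *
        ∫⁻ v, ∫⁻ y, G n (PredSpace.mk M (v, ω), y) * ENNReal.ofReal (R (PredSpace.mk M (v, ω), y))
          ∂(C.kernel (PredSpace.mk M (v, ω))) ∂(C.clock T ω) ∂P := by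
    rw [← lintegral_iSup]
    · refine lintegral_congr fun ω => ?_
      rw [← ENNReal.mul_iSup, ← lintegral_iSup]
      · refine congrArg _ (lintegral_congr fun v => ?_)
        rw [← lintegral_iSup]
        · simp_rw [← ENNReal.iSup_mul, hGsup]
        · exact fun n => (hGR n).comp measurable_prodMk_left
        · exact fun i j hij y => mul_le_mul_left (hGmono hij _) _
      · exact fun n => (hker n).comp (measurable_time_section M ω)
      · exact fun i j hij v => lintegral_mono fun y => mul_le_mul_left (hGmono hij _) _
    · exact fun n => hDm.mul (C.measurable_lintegral_clock T (hker n))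
    · exact fun i j hij ω => mul_le_mul_right (lintegral_mono fun v => lintegral_mono fun y =>
        mul_le_mul_left (hGmono hij _) _) _
  rw [lhs, rhs]
  exact iSup_congr hstep

end Compensator

end MPPControl

/-! ### Measurability, triviality of `𝓕_0`, and signed integrals -/

namespace MPPControl

set_option linter.unusedSectionVars false

open ProbabilityTheory in
-- A finite kernel needs a uniform mass bound, whereas `A_T` is only finite path by path. Cutting
-- the base by the integer part of the mass gives countably many finite kernels.
lemma isSFiniteKernel_of_isFiniteMeasure {α β : Type*} [MeasurableSpace α] [MeasurableSpace β]
    (κ : Kernel α β) [∀ a, IsFiniteMeasure (κ a)] : IsSFiniteKernel κ := by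
  classical
  set N : α → ℕ := fun a => ⌊((κ a) univ).toReal⌋₊ with hN
  have hNm : Measurable N :=
    Nat.measurable_floor.comp (κ.measurable_coe MeasurableSet.univ).ennreal_toReal
  have hs : ∀ n, MeasurableSet {a | N a = n} := fun n => hNm (measurableSet_singleton n)
  refine ⟨fun n => Kernel.piecewise (hs n) κ 0, fun n => ?_, ?_⟩
  · refine ⟨⟨n + 1, ENNReal.add_lt_top.2 ⟨ENNReal.natCast_lt_top n, ENNReal.one_lt_top⟩,
      fun a => ?_⟩⟩
    rw [Kernel.piecewise_apply]
    split_ifs with h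
    · have h1 := (Nat.lt_floor_add_one ((κ a) univ).toReal).le
      rw [show ⌊((κ a) univ).toReal⌋₊ = n from h] at h1
      have h2 := ENNReal.ofReal_le_ofReal h1
      rw [ENNReal.ofReal_toReal (measure_ne_top _ _)] at h2
      refine h2.trans_eq ?_
      rw [ENNReal.ofReal_add (by positivity) zero_le_one, ENNReal.ofReal_natCast,
        ENNReal.ofReal_one]
    · simp
  · ext a s h
    rw [Kernel.sum_apply' _ _ h, tsum_eq_single (N a)]
    · rw [Kernel.piecewise_apply, if_pos (show a ∈ {b | N b = N a} from rfl)]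
    · intro n hn
      rw [Kernel.piecewise_apply, if_neg (by exact fun h => hn h.symm)]
      simp

/-- Measurability of the selection of an entry of a sequence by the first index with a given
property. -/
lemma measurable_dite_find {α β : Type*} [MeasurableSpace α] [MeasurableSpace β]
    {p : ℕ → α → Prop} [∀ x, DecidablePred fun n => p n x] [∀ x, Decidable (∃ n, p n x)]
    (hp : ∀ n, MeasurableSet {x | p n x}) {F : ℕ → α → β}
    (hF : ∀ n, Measurable (F n)) (c : β) :
    Measurable fun x => if h : ∃ n, p n x then F (Nat.find h) x else c := by
  intro B hB
  have : (fun x => if h : ∃ n, p n x then F (Nat.find h) x else c) ⁻¹' B =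
      (⋃ n, ({x | p n x} \ ⋃ k ∈ {k | k < n}, {x | p k x}) ∩ F n ⁻¹' B) ∪
        ((⋃ n, {x | p n x})ᶜ ∩ {_x | c ∈ B}) := by
    ext x
    simp only [mem_preimage, mem_union, mem_iUnion, mem_inter_iff, Set.mem_sdiff, mem_ofPred_eq,
      mem_compl_iff, exists_prop, not_exists, not_and]
    split_ifs with h
    · constructor
      · intro hx
        exact Or.inl ⟨Nat.find h, ⟨Nat.find_spec h, fun k hk => Nat.find_min h hk⟩, hx⟩
      · rintro (⟨n, ⟨h1, h2⟩, h3⟩ | ⟨h1, -⟩)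
        · have : Nat.find h = n := (Nat.find_eq_iff h).2 ⟨h1, fun k hk => h2 k hk⟩
          rwa [this]
        · exact absurd h (not_exists.2 h1)
    · constructor
      · exact fun hx => Or.inr ⟨not_exists.1 h, hx⟩
      · rintro (⟨n, ⟨h1, -⟩, -⟩ | ⟨-, h1⟩)
        · exact absurd ⟨n, h1⟩ h
        · exact h1
  rw [this]
  refine (MeasurableSet.iUnion fun n => ((hp n).diff ?_).inter (hF n hB)).union
    ((MeasurableSet.iUnion hp).compl.inter (MeasurableSet.const _))
  exact MeasurableSet.biUnion (to_countable _) fun k _ => hp k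

lemma dite_find_congr {β : Type*} {p q : ℕ → Prop} [DecidablePred p] [DecidablePred q]
    [Decidable (∃ n, p n)] [Decidable (∃ n, q n)] (h : ∀ n, p n ↔ q n) (F : ℕ → β) (c : β) :
    (if h : ∃ n, p n then F (Nat.find h) else c) = if h : ∃ n, q n then F (Nat.find h) else c := by
  obtain rfl : p = q := funext fun n => propext (h n)
  split_ifs with h1
  · congr!
  · rfl

/-- The σ-algebra of the sets that are null or have a null complement. -/
@[reducible] def nullTrivialSpace {Ω : Type*} {mΩ : MeasurableSpace Ω} (P : Measure Ω) :
    MeasurableSpace Ω where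
  MeasurableSet' := fun s => (∀ᵐ ω ∂P, ω ∈ s) ∨ ∀ᵐ ω ∂P, ω ∉ s
  measurableSet_empty := Or.inr (by simp)
  measurableSet_compl := fun s hs => by
    rcases hs with hs | hs
    · exact Or.inr (by filter_upwards [hs] with ω hω using fun h => h hω)
    · exact Or.inl (by filter_upwards [hs] with ω hω using hω)
  measurableSet_iUnion := fun f hf => by
    by_cases h : ∃ n, ∀ᵐ ω ∂P, ω ∈ f n
    · obtain ⟨n, hn⟩ := h
      exact Or.inl (by filter_upwards [hn] with ω hω using mem_iUnion.2 ⟨n, hω⟩)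
    · refine Or.inr ?_
      have := ae_all_iff.2 fun n => (hf n).resolve_left (not_exists.1 h n)
      filter_upwards [this] with ω hω
      simpa using hω

variable {Ω : Type*} [mΩ : MeasurableSpace Ω] {P : Measure Ω} [P.IsComplete]
  {K : Type*} [mK : MeasurableSpace K]

namespace MarkedPointProcess

variable (M : MarkedPointProcess P K)

lemma measurable_X (t : ℝ≥0) : Measurable (M.X t) := by
  classical
  unfold X
  exact measurable_dite_find (p := fun n ω => M.time n ω ≤ (t : ℝ≥0∞) ∧ (t : ℝ≥0∞) < M.time (n + 1) ω)
    (fun n => (measurableSet_le (M.measurable_time n) measurable_const).inter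
    (measurableSet_lt measurable_const (M.measurable_time (n + 1)))) M.measurable_mark M.initMark

lemma measurable_leftX : Measurable fun x : ℝ≥0 × Ω => M.leftX x.1 x.2 := by
  have ht : Measurable fun x : ℝ≥0 × Ω => (x.1 : ℝ≥0∞) :=
    measurable_coe_nnreal_ennreal.comp measurable_fst
  classical
  unfold leftX
  exact measurable_dite_find (F := fun n (x : ℝ≥0 × Ω) => M.mark n x.2)
    (p := fun n x => M.time n x.2 < (x.1 : ℝ≥0∞) ∧ (x.1 : ℝ≥0∞) ≤ M.time (n + 1) x.2)
    (fun n => MeasurableSet.inter (measurableSet_lt ((M.measurable_time n).comp measurable_snd) ht)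
      (measurableSet_le ht ((M.measurable_time (n + 1)).comp measurable_snd)))
    (fun n => (M.measurable_mark n).comp measurable_snd) M.initMark

lemma X_eq_leftX {t : ℝ≥0} {ω : Ω} (h : ∀ n, M.time n ω ≠ t) : M.X t ω = M.leftX t ω := by
  classical
  unfold X leftX
  exact dite_find_congr (fun n => ⟨fun h' => ⟨lt_of_le_of_ne h'.1 (h n), h'.2.le⟩,
    fun h' => ⟨h'.1.le, lt_of_le_of_ne h'.2 (h (n + 1)).symm⟩⟩) (fun n => M.mark n ω) _

/-- The σ-algebra `𝓕_0` is trivial up to null sets. -/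
lemma ae_mem_or_ae_notMem_of_filtration_zero (C : Compensator M) {s : Set Ω}
    (hs : MeasurableSet[M.filtration 0] s) : (∀ᵐ ω ∂P, ω ∈ s) ∨ ∀ᵐ ω ∂P, ω ∉ s := by
  suffices hle : M.filtration 0 ≤ nullTrivialSpace P from hle s hs
  refine sup_le (iSup_le fun t => iSup_le fun ht => iSup_le fun B => iSup_le fun hB => ?_)
    (MeasurableSpace.generateFrom_le fun N hN => Or.inr (measure_eq_zero_iff_ae_notMem.1 hN))
  rintro _ ⟨S, -, rfl⟩
  -- No point occurs at time `0`, because `T_1 > T_0 = 0`.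
  have h0 : ∀ᵐ ω ∂P, M.count t B ω = 0 := by
    filter_upwards [C.ae_regular] with ω hω
    have ht0 : t = 0 := le_antisymm ht (zero_le)
    rw [count, ENNReal.tsum_eq_zero]
    intro n
    rw [if_neg]
    rintro ⟨h1, -⟩
    rw [ht0, ENNReal.coe_zero] at h1
    exact absurd h1 (not_le.2 (hω.time_pos n))
  by_cases hS : (0 : ℝ≥0∞) ∈ S
  · exact Or.inl (by filter_upwards [h0] with ω hω; rw [mem_preimage, hω]; exact hS)
  · exact Or.inr (by filter_upwards [h0] with ω hω; rw [mem_preimage, hω]; exact hS)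

/-- Events of `𝓕_0` are null or conull, and countably many Borel sets separate the reals. A constant
initial value has the same mean under every `P_u`. -/
lemma exists_ae_eq_const (C : Compensator M) {Y : Ω → ℝ}
    (hY : StronglyMeasurable[M.filtration 0] Y) : ∃ y, ∀ᵐ ω ∂P, Y ω = y := by
  obtain ⟨y, hy⟩ := exists_eventuallyEq_const_of_forall_separating (l := ae P) (f := Y)
    (MeasurableSet : Set ℝ → Prop) fun U hU =>
      M.ae_mem_or_ae_notMem_of_filtration_zero C (hY.measurable hU)
  exact ⟨y, hy⟩

end MarkedPointProcess

namespace Compensator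

variable {M : MarkedPointProcess P K} (C : Compensator M) (T : ℝ≥0)

/-- The measure `φ_t(dy) dA_t` on `(0, T] × K`. -/
noncomputable def comp (ω : Ω) : Measure (ℝ≥0 × K) :=
  (C.clock T ω).compProd
    (C.kernel.comap (fun t => PredSpace.mk M (t, ω)) (measurable_time_section M ω))

lemma lintegral_comp {ω : Ω} {f : ℝ≥0 × K → ℝ≥0∞} (hf : Measurable f) :
    ∫⁻ z, f z ∂(C.comp T ω) =
      ∫⁻ v, ∫⁻ y, f (v, y) ∂(C.kernel (PredSpace.mk M (v, ω))) ∂(C.clock T ω) :=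
  Measure.lintegral_compProd hf

lemma integrable_comp {ω : Ω} {f : ℝ≥0 × K → ℝ} (hf : Integrable f (C.comp T ω)) :
    (∀ᵐ v ∂(C.clock T ω), Integrable (fun y => f (v, y)) (C.kernel (PredSpace.mk M (v, ω)))) ∧
    Integrable (fun v => ∫ y, f (v, y) ∂(C.kernel (PredSpace.mk M (v, ω)))) (C.clock T ω) := by
  have h := (Measure.integrable_compProd_iff hf.aestronglyMeasurable).1 hf
  exact ⟨h.1, Integrable.integral_compProd (κ := ProbabilityTheory.Kernel.const Unit (C.clock T ω)) hf⟩

lemma integral_comp {ω : Ω} {f : ℝ≥0 × K → ℝ} (hf : Integrable f (C.comp T ω)) :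
    ∫ z, f z ∂(C.comp T ω) =
      ∫ v, ∫ y, f (v, y) ∂(C.kernel (PredSpace.mk M (v, ω))) ∂(C.clock T ω) :=
  Measure.integral_compProd hf

lemma measurable_lintegral_comp {G : PredSpace M × K → ℝ≥0∞} (hG : Measurable G) :
    Measurable fun ω => ∫⁻ z, G (PredSpace.mk M (z.1, ω), z.2) ∂(C.comp T ω) := by
  have h : Measurable fun x => ∫⁻ y, G (x, y) ∂(C.kernel x) := hG.lintegral_kernel_prod_right'
  have := C.measurable_lintegral_clock T h
  convert this using 2 with ω
  exact C.lintegral_comp T (hG.comp (measurable_section M ω))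

/-- Random integrals against a random measure, through positive and negative parts. -/
lemma integral_integral_eq {m : Ω → Measure (ℝ≥0 × K)} {ν : Measure Ω}
    (hm : ∀ G : PredSpace M × K → ℝ≥0∞, Measurable G →
      Measurable fun ω => ∫⁻ z, G (PredSpace.mk M (z.1, ω), z.2) ∂(m ω))
    {f : PredSpace M × K → ℝ} (hf : Measurable f)
    (hfin : ∫⁻ ω, ∫⁻ z, ENNReal.ofReal |f (PredSpace.mk M (z.1, ω), z.2)| ∂(m ω) ∂ν ≠ ∞) :
    (∀ᵐ ω ∂ν, Integrable (fun z => f (PredSpace.mk M (z.1, ω), z.2)) (m ω)) ∧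
    Integrable (fun ω => ∫ z, f (PredSpace.mk M (z.1, ω), z.2) ∂(m ω)) ν ∧
    ∫ ω, ∫ z, f (PredSpace.mk M (z.1, ω), z.2) ∂(m ω) ∂ν =
      (∫⁻ ω, ∫⁻ z, ENNReal.ofReal (f (PredSpace.mk M (z.1, ω), z.2)) ∂(m ω) ∂ν).toReal -
      (∫⁻ ω, ∫⁻ z, ENNReal.ofReal (-f (PredSpace.mk M (z.1, ω), z.2)) ∂(m ω) ∂ν).toReal := by
  have hae : ∀ᵐ ω ∂ν, Integrable (fun z => f (PredSpace.mk M (z.1, ω), z.2)) (m ω) := by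
    have hlt := ae_lt_top (hm _ (continuous_abs.measurable.comp hf).ennreal_ofReal) hfin
    filter_upwards [hlt] with ω hω
    refine ⟨(hf.comp (measurable_section M ω)).aestronglyMeasurable, ?_⟩
    rw [hasFiniteIntegral_iff_norm]
    exact hω
  have hpos : ∫⁻ ω, ∫⁻ z, ENNReal.ofReal (f (PredSpace.mk M (z.1, ω), z.2)) ∂(m ω) ∂ν ≠ ∞ :=
    ne_top_of_le_ne_top hfin (lintegral_mono fun ω => lintegral_mono fun z =>
      ENNReal.ofReal_le_ofReal (le_abs_self _))
  have hneg : ∫⁻ ω, ∫⁻ z, ENNReal.ofReal (-f (PredSpace.mk M (z.1, ω), z.2)) ∂(m ω) ∂ν ≠ ∞ :=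
    ne_top_of_le_ne_top hfin (lintegral_mono fun ω => lintegral_mono fun z =>
      ENNReal.ofReal_le_ofReal (neg_le_abs _))
  have mpos := hm _ hf.ennreal_ofReal
  have mneg := hm _ hf.neg.ennreal_ofReal
  have ipos := integrable_toReal_of_lintegral_ne_top mpos.aemeasurable hpos
  have ineg := integrable_toReal_of_lintegral_ne_top mneg.aemeasurable hneg
  have heq : (fun ω => ∫ z, f (PredSpace.mk M (z.1, ω), z.2) ∂(m ω)) =ᵐ[ν] fun ω =>
      (∫⁻ z, ENNReal.ofReal (f (PredSpace.mk M (z.1, ω), z.2)) ∂(m ω)).toReal -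
      (∫⁻ z, ENNReal.ofReal (-f (PredSpace.mk M (z.1, ω), z.2)) ∂(m ω)).toReal := by
    filter_upwards [hae] with ω hω
    exact integral_eq_lintegral_pos_part_sub_lintegral_neg_part hω
  refine ⟨hae, (ipos.sub ineg).congr heq.symm, ?_⟩
  rw [integral_congr_ae heq]
  refine (integral_sub ipos ineg).trans ?_
  rw [integral_toReal mpos.aemeasurable (ae_lt_top mpos hpos),
    integral_toReal mneg.aemeasurable (ae_lt_top mneg hneg)]
  rfl

variable {C T} {R : PredSpace M × K → ℝ} {c : ℝ}

/-- Under the probability with density `doleans`, integrals against the jump measure and against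
`R φ dA` have the same mean. -/
lemma integral_jumps_eq_integral_comp [IsProbabilityMeasure P] (hR : IsBddField R c) (hc : 0 ≤ c)
    (hE : ∫⁻ ω, ENNReal.ofReal (Real.exp ((3 + c ^ 4) * C.mass T ω)) ∂P ≠ ∞) {ν : Measure Ω}
    (hν : ν = P.withDensity fun ω => ENNReal.ofReal (C.doleans T R 0 (T + 1) ω))
    {f : PredSpace M × K → ℝ} (hf : Measurable f)
    (hfin : ∫⁻ ω, ∫⁻ z, ENNReal.ofReal |f (PredSpace.mk M (z.1, ω), z.2)| ∂(C.comp T ω) ∂ν ≠ ∞) :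
    Integrable (fun ω => ∫ z, f (PredSpace.mk M (z.1, ω), z.2) ∂(C.jumps T ω)) ν ∧
    Integrable (fun ω => ∫ z, f (PredSpace.mk M (z.1, ω), z.2) *
      R (PredSpace.mk M (z.1, ω), z.2) ∂(C.comp T ω)) ν ∧
    ∫ ω, ∫ z, f (PredSpace.mk M (z.1, ω), z.2) ∂(C.jumps T ω) ∂ν =
      ∫ ω, ∫ z, f (PredSpace.mk M (z.1, ω), z.2) *
        R (PredSpace.mk M (z.1, ω), z.2) ∂(C.comp T ω) ∂ν := by
  have hdm := (measurable_doleans_end (C := C) T (a := 0) hR (T + 1)).ennreal_ofReal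
  have girsanov : ∀ H : PredSpace M × K → ℝ≥0∞, Measurable H →
      ∫⁻ ω, ∫⁻ z, H (PredSpace.mk M (z.1, ω), z.2) ∂(C.jumps T ω) ∂ν =
      ∫⁻ ω, ∫⁻ z, H (PredSpace.mk M (z.1, ω), z.2) *
        ENNReal.ofReal (R (PredSpace.mk M (z.1, ω), z.2)) ∂(C.comp T ω) ∂ν := by
    intro H hH
    have hHR : Measurable fun x => H x * ENNReal.ofReal (R x) :=
      hH.mul hR.measurable.ennreal_ofReal
    rw [hν, lintegral_withDensity_eq_lintegral_mul _ hdm (C.measurable_lintegral_jumps T hH),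
      lintegral_withDensity_eq_lintegral_mul _ hdm (C.measurable_lintegral_comp T hHR)]
    refine (lintegral_doleans_mul_jumps hR hc hE hH).trans (lintegral_congr fun ω => ?_)
    simp only [Pi.mul_apply]
    congr 1
    exact (C.lintegral_comp T (hHR.comp (measurable_section M ω))).symm
  have hmulR : ∀ x : PredSpace M × K, ENNReal.ofReal |f x * R x| =
      ENNReal.ofReal |f x| * ENNReal.ofReal (R x) := fun x => by
    rw [abs_mul, abs_of_nonneg (hR.nonneg x), ENNReal.ofReal_mul (abs_nonneg _)]
  have hfinR : ∫⁻ ω, ∫⁻ z, ENNReal.ofReal |f (PredSpace.mk M (z.1, ω), z.2) *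
      R (PredSpace.mk M (z.1, ω), z.2)| ∂(C.comp T ω) ∂ν ≠ ∞ := by
    simp_rw [hmulR]
    refine ne_top_of_le_ne_top (ENNReal.mul_ne_top hfin (ENNReal.ofReal_ne_top (r := c))) ?_
    rw [← lintegral_mul_const' _ _ ENNReal.ofReal_ne_top]
    refine lintegral_mono fun ω => ?_
    rw [← lintegral_mul_const' _ _ ENNReal.ofReal_ne_top]
    exact lintegral_mono fun z => mul_le_mul_right (ENNReal.ofReal_le_ofReal (hR.le _)) _
  have hfinJ : ∫⁻ ω, ∫⁻ z, ENNReal.ofReal |f (PredSpace.mk M (z.1, ω), z.2)|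
      ∂(C.jumps T ω) ∂ν ≠ ∞ := by
    rw [girsanov (fun x => ENNReal.ofReal |f x|) (continuous_abs.measurable.comp hf).ennreal_ofReal]
    simpa only [hmulR] using hfinR
  obtain ⟨-, i1, e1⟩ := integral_integral_eq (fun G hG => C.measurable_lintegral_jumps T hG) hf hfinJ
  obtain ⟨-, i2, e2⟩ := integral_integral_eq (f := fun x => f x * R x) (fun G hG => C.measurable_lintegral_comp T hG)
    (hf.mul hR.measurable) hfinR
  refine ⟨i1, i2, e1.trans (Eq.trans ?_ e2.symm)⟩
  rw [girsanov (fun x => ENNReal.ofReal (f x)) hf.ennreal_ofReal,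
    girsanov (fun x => ENNReal.ofReal (-f x)) hf.neg.ennreal_ofReal]
  simp only [← neg_mul, ENNReal.ofReal_mul' (hR.nonneg _)]

lemma measurable_integral_clock {f : ℝ≥0 × Ω → ℝ} (hf : Measurable f) :
    Measurable fun ω => ∫ v, f (v, ω) ∂(C.clock T ω) := by
  let κ : ProbabilityTheory.Kernel Ω ℝ≥0 := ⟨C.clock T, C.measurable_clock T⟩
  have hfin : ∀ ω, IsFiniteMeasure (κ ω) := fun ω =>
    inferInstanceAs (IsFiniteMeasure (C.clock T ω))
  have := isSFiniteKernel_of_isFiniteMeasure κ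
  exact ((hf.comp measurable_swap).stronglyMeasurable.integral_kernel_prod_right' (κ := κ)).measurable

/-- `∫_0^T exp(-β A_t) dA_t ≤ 1 / β`. -/
lemma Regular.lintegral_exp_neg_le {ω : Ω} (h : C.Regular ω) {β : ℝ} (hβ : 0 < β) :
    ∫⁻ v, ENNReal.ofReal (Real.exp (-(β * C.A v ω))) ∂(C.clock T ω) ≤ ENNReal.ofReal (1 / β) := by
  have hA : ∀ v ≤ T, (C.clock T ω).real (Iio v) = C.A v ω := by
    intro v hv
    have h1 : C.clock T ω (Iio v) = C.clock T ω (Ioc 0 v) := by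
      have hne : ∀ᵐ t ∂(C.clock T ω), t ≠ v :=
        measure_eq_zero_iff_ae_notMem.1 (measure_singleton v)
      refine measure_congr ?_
      filter_upwards [C.ae_mem_Ioc_clock T ω, hne] with t ht htv
      exact propext ⟨fun h => ⟨ht.1, le_of_lt h⟩, fun h => lt_of_le_of_ne h.2 htv⟩
    rw [Measure.real, h1, clock_apply_Ioc, indicator_of_mem (by exact h), min_eq_left hv,
      ENNReal.toReal_ofReal (h.A_nonneg v)]
  -- The exponential formula with `k = -β` reads `exp(-β A_T) = 1 - β ∫ exp(-β A) dA`, and the left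
  -- side is positive.
  have hexp := exp_integral_Iio (μ := C.clock T ω) (k := fun _ => -β) measurable_const
    (integrable_const _) (T + 1)
  simp only [setIntegral_const, smul_eq_mul, clock_restrict, integral_mul_const] at hexp
  have hi : Integrable (fun v => Real.exp ((C.clock T ω).real (Iio v) * -β)) (C.clock T ω) := by
    have hm : Measurable fun v => (C.clock T ω).real (Iio v) := by
      have := measurable_integral_Iio (μ := C.clock T ω) (k := fun _ => 1) measurable_const
      simpa using this
    refine Integrable.of_bound (Real.measurable_exp.comp (hm.mul_const _)).aestronglyMeasurable 1
      (ae_of_all _ fun v => ?_)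
    rw [Real.norm_eq_abs, abs_of_pos (Real.exp_pos _)]
    refine Real.exp_le_one_iff.2 ?_
    have : 0 ≤ (C.clock T ω).real (Iio v) := measureReal_nonneg
    nlinarith
  have e1 : ∫⁻ v, ENNReal.ofReal (Real.exp (-(β * C.A v ω))) ∂(C.clock T ω) =
      ∫⁻ v, ENNReal.ofReal (Real.exp ((C.clock T ω).real (Iio v) * -β)) ∂(C.clock T ω) := by
    refine lintegral_congr_ae ?_
    filter_upwards [C.ae_mem_Ioc_clock T ω] with v hv
    rw [hA v hv.2]
    ring_nf
  rw [e1, ← ofReal_integral_eq_lintegral_ofReal hi (ae_of_all _ fun v => (Real.exp_pos _).le)]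
  refine ENNReal.ofReal_le_ofReal ?_
  rw [le_div_iff₀ hβ]
  have := Real.exp_pos (∫ _, -β ∂(C.clock T ω))
  linarith

lemma Regular.clock_eq {ω : Ω} (h : C.Regular ω) : C.clock T ω = C.dA T ω := if_pos h

/-- Weighted square integrable fields are integrable against square integrable densities. -/
lemma MemL2.lintegral_mul_ne_top {β : ℝ} {Z : ℝ≥0 → Ω → K → ℝ} (hZ : C.MemL2 T β Z) (hβ : 0 < β)
    {L : Ω → ℝ} (hL : Measurable L) (hL0 : ∀ ω, 0 ≤ L ω)
    (hL2 : ∫⁻ ω, ENNReal.ofReal (L ω ^ 2) ∂P ≠ ∞) :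
    ∫⁻ ω, ENNReal.ofReal (L ω) * ∫⁻ z, ENNReal.ofReal |Z z.1 ω z.2| ∂(C.comp T ω) ∂P ≠ ∞ := by
  have hZm : Measurable fun x : PredSpace M × K => Z x.1.time x.1.pt x.2 := hZ.1
  have hZω : ∀ ω, Measurable fun z : ℝ≥0 × K => Z z.1 ω z.2 := fun ω =>
    hZm.comp (measurable_section M ω)
  have hAm : Measurable fun x : PredSpace M => C.A x.time x.pt := C.A_predictable
  have hAω : ∀ ω, Measurable fun v => C.A v ω := fun ω => hAm.comp (measurable_time_section M ω)
  have hle : ∀ᵐ ω ∂P, ENNReal.ofReal (L ω) * ∫⁻ z, ENNReal.ofReal |Z z.1 ω z.2| ∂(C.comp T ω) ≤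
      ENNReal.ofReal (L ω ^ 2) * ENNReal.ofReal (1 / β) +
      ∫⁻ t, ∫⁻ y, ENNReal.ofReal (Real.exp (β * C.A t ω) * (Z t ω y) ^ 2)
        ∂(C.φ t ω) ∂(C.dA T ω) := by
    filter_upwards [C.ae_regular] with ω hω
    have hw : Measurable fun z : ℝ≥0 × K =>
        ENNReal.ofReal (Real.exp (β * C.A z.1 ω) * (Z z.1 ω z.2) ^ 2) :=
      ((Real.measurable_exp.comp (((hAω ω).comp measurable_fst).const_mul β)).mul
        ((hZω ω).pow_const 2)).ennreal_ofReal
    have hw2 : Measurable fun z : ℝ≥0 × K =>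
        ENNReal.ofReal (L ω ^ 2) * ENNReal.ofReal (Real.exp (-(β * C.A z.1 ω))) :=
      ((Real.measurable_exp.comp (((hAω ω).comp measurable_fst).const_mul
        β).neg).ennreal_ofReal).const_mul _
    have e2 : ∫⁻ z, ENNReal.ofReal (L ω ^ 2) * ENNReal.ofReal (Real.exp (-(β * C.A z.1 ω)))
        ∂(C.comp T ω) = ENNReal.ofReal (L ω ^ 2) *
          ∫⁻ v, ENNReal.ofReal (Real.exp (-(β * C.A v ω))) ∂(C.clock T ω) := by
      rw [C.lintegral_comp T hw2, ← lintegral_const_mul' _ _ ENNReal.ofReal_ne_top]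
      refine lintegral_congr fun v => ?_
      simp only [lintegral_const, measure_univ, mul_one]
    calc ENNReal.ofReal (L ω) * ∫⁻ z, ENNReal.ofReal |Z z.1 ω z.2| ∂(C.comp T ω)
        = ∫⁻ z, ENNReal.ofReal (L ω) * ENNReal.ofReal |Z z.1 ω z.2| ∂(C.comp T ω) :=
          (lintegral_const_mul' _ _ ENNReal.ofReal_ne_top).symm
      _ ≤ ∫⁻ z, (ENNReal.ofReal (L ω ^ 2) * ENNReal.ofReal (Real.exp (-(β * C.A z.1 ω))) +
          ENNReal.ofReal (Real.exp (β * C.A z.1 ω) * (Z z.1 ω z.2) ^ 2)) ∂(C.comp T ω) := by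
          refine lintegral_mono fun z => ?_
          rw [← ENNReal.ofReal_mul (hL0 ω), ← ENNReal.ofReal_mul (sq_nonneg _),
            ← ENNReal.ofReal_add (by positivity) (by positivity)]
          refine ENNReal.ofReal_le_ofReal ?_
          -- Half of the weight goes to each factor: `L |Z| = (L / e) (e |Z|)` is at most the sum of
          -- the two squares. The first square integrates to at most `L^2 / β`, the second to the
          -- weighted norm of `Z`.
          set e := Real.exp (β * C.A z.1 ω / 2) with he
          have he0 : 0 < e := Real.exp_pos _
          have h1 : Real.exp (β * C.A z.1 ω) = e ^ 2 := by
            rw [he, ← Real.exp_nat_mul]; congr 1; push_cast; ring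
          have h2 : Real.exp (-(β * C.A z.1 ω)) = (e⁻¹) ^ 2 := by
            rw [Real.exp_neg, h1, inv_pow]
          rw [h1, h2, ← sq_abs (Z z.1 ω z.2)]
          have h3 : e⁻¹ * e = 1 := inv_mul_cancel₀ he0.ne'
          have h4 : L ω * |Z z.1 ω z.2| = (L ω * e⁻¹) * (e * |Z z.1 ω z.2|) := by
            calc _ = L ω * (e⁻¹ * e) * |Z z.1 ω z.2| := by rw [h3, mul_one]
              _ = _ := by ring
          rw [h4, ← mul_pow, ← mul_pow]
          nlinarith [sq_nonneg (L ω * e⁻¹ - e * |Z z.1 ω z.2|),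
            sq_nonneg (L ω * e⁻¹), sq_nonneg (e * |Z z.1 ω z.2|)]
      _ = ENNReal.ofReal (L ω ^ 2) *
          ∫⁻ v, ENNReal.ofReal (Real.exp (-(β * C.A v ω))) ∂(C.clock T ω) +
          ∫⁻ z, ENNReal.ofReal (Real.exp (β * C.A z.1 ω) * (Z z.1 ω z.2) ^ 2) ∂(C.comp T ω) := by
          rw [lintegral_add_left hw2, e2]
      _ ≤ _ := by
          refine add_le_add (mul_le_mul_right (hω.lintegral_exp_neg_le hβ) _) ?_
          rw [C.lintegral_comp T hw, hω.clock_eq]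
          rfl
  refine ne_top_of_le_ne_top ?_ (lintegral_mono_ae hle)
  rw [lintegral_add_left ((hL.pow_const 2).ennreal_ofReal.mul_const _),
    lintegral_mul_const' _ _ ENNReal.ofReal_ne_top]
  exact ENNReal.add_ne_top.2 ⟨ENNReal.mul_ne_top hL2 ENNReal.ofReal_ne_top, hZ.2.ne⟩

end Compensator

end MPPControl

/-! ### The controlled density and verification -/

namespace MPPControl

set_option linter.unusedSectionVars false

variable {Ω : Type*} [mΩ : MeasurableSpace Ω] {P : Measure Ω} [P.IsComplete]
  {K : Type*} [mK : MeasurableSpace K] {U : Type*} [mU : MeasurableSpace U]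

/-- The field `(t, ω, y) ↦ r_t(ω, y, u_t(ω))`, truncated to `[0, c]`. -/
def controlField (M : MarkedPointProcess P K) (r : ℝ≥0 → Ω → K → U → ℝ) (u : ℝ≥0 → Ω → U) (c : ℝ)
    (x : PredSpace M × K) : ℝ :=
  max 0 (min (r x.1.time x.1.pt x.2 (u x.1.time x.1.pt)) c)

variable {M : MarkedPointProcess P K} {C : Compensator M} {T : ℝ≥0}
  {r l : ℝ≥0 → Ω → K → U → ℝ} {g : Ω → K → ℝ} {Cr Cl : ℝ} {u : ℝ≥0 → Ω → U}

lemma Admissible.measurable_field (hu : Admissible M u) {F : ℝ≥0 → Ω → K → U → ℝ}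
    (hF : Measurable[(M.filtration.predictable.prod mK).prod mU]
      fun x : ((ℝ≥0 × Ω) × K) × U => F x.1.1.1 x.1.1.2 x.1.2 x.2) :
    Measurable fun x : PredSpace M × K => F x.1.time x.1.pt x.2 (u x.1.time x.1.pt) := by
  have h1 : Measurable fun x : (PredSpace M × K) × U => F x.1.1.time x.1.1.pt x.1.2 x.2 := hF
  have h2 : Measurable fun x : PredSpace M => u x.time x.pt := hu
  exact h1.comp (measurable_id.prodMk (h2.comp measurable_fst))

namespace ControlHypothesis

lemma isBddField (h : ControlHypothesis M T r l g Cr Cl) (hu : Admissible M u) :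
    IsBddField (controlField M r u Cr) Cr where
  measurable := measurable_const.max ((hu.measurable_field h.r_measurable).min measurable_const)
  nonneg _ := le_max_left _ _
  le _ := max_le (zero_le_one.trans h.one_lt_Cr.le) (min_le_right _ _)

lemma measurable_g (h : ControlHypothesis M T r l g Cr Cl) :
    Measurable fun ω => g ω (M.X T ω) := by
  have h1 : Measurable fun x : Ω × K => g x.1 x.2 :=
    h.g_measurable.mono (sup_le_sup (MeasurableSpace.comap_mono (M.filtration.le T)) le_rfl) le_rfl
  exact h1.comp (measurable_id.prodMk (M.measurable_X T))

lemma measurable_leftX_cost (h : ControlHypothesis M T r l g Cr Cl) (hu : Admissible M u) :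
    Measurable fun x : ℝ≥0 × Ω => l x.1 x.2 (M.leftX x.1 x.2) (u x.1 x.2) :=
  (hu.measurable_field h.l_measurable).comp
    (M.measurable_predSpace_mk.prodMk M.measurable_leftX)

end ControlHypothesis

/-- The path `ω` satisfies the bounds of `ControlHypothesis`. -/
def PathBounds (T : ℝ≥0) (r l : ℝ≥0 → Ω → K → U → ℝ) (Cr Cl : ℝ) (ω : Ω) : Prop :=
  ∀ t ≤ T, ∀ (y : K) (u : U), 0 ≤ r t ω y u ∧ r t ω y u ≤ Cr ∧ |l t ω y u| ≤ Cl

/-- The bounds on `r` hold only on almost every path, while the exponential is built from fields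
bounded everywhere. The truncation is invisible on the good paths. -/
lemma PathBounds.controlField_eq {ω : Ω} (hb : PathBounds T r l Cr Cl ω) {t : ℝ≥0} (ht : t ≤ T)
    (y : K) : controlField M r u Cr (PredSpace.mk M (t, ω), y) = r t ω y (u t ω) := by
  have h := hb t ht y (u t ω)
  simp only [controlField, PredSpace.time_mk, PredSpace.pt_mk]
  rw [min_eq_left h.2.1, max_eq_right h.1]

namespace Compensator

lemma Regular.density_eq {ω : Ω} (hω : C.Regular ω) (h : ControlHypothesis M T r l g Cr Cl)
    (hu : Admissible M u) (hb : PathBounds T r l Cr Cl ω) :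
    C.density r u T ω = C.doleans T (controlField M r u Cr) 0 (T + 1) ω := by
  obtain ⟨m, hm⟩ := hω.exists_count T
  have hR := h.isBddField hu
  rw [doleans_eq T hR (hω.jumps_eq T hm), clock_restrict, hω.clock_eq, density]
  congr 1
  · congr 1
    refine integral_congr_ae ?_
    filter_upwards [ae_restrict_mem (μ := stieltjes fun t => C.A t ω)
      (measurableSet_Ioc (a := (0 : ℝ≥0)) (b := T))] with s hs
    calc ∫ y, (1 - r s ω y (u s ω)) ∂(C.φ s ω)
        = ∫ y, (1 - controlField M r u Cr (PredSpace.mk M (s, ω), y))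
            ∂(C.kernel (PredSpace.mk M (s, ω))) :=
          integral_congr_ae (ae_of_all _ fun y => by simp only [hb.controlField_eq hs.2])
      _ = 1 - 0 - C.rate (controlField M r u Cr) (PredSpace.mk M (s, ω)) := by
          rw [integral_sub (integrable_const _) (integrable_field hR _)]
          simp [rate]
  -- The density numbers the points from `1`, the jump measure from `0`.
  · have hset : {n : ℕ | 1 ≤ n ∧ M.time n ω ≤ (T : ℝ≥0∞)} =
        ((Finset.range m).image Nat.succ : Finset ℕ) := by
      ext n
      simp only [mem_ofPred_eq, Finset.coe_image, Finset.coe_range, mem_image, mem_Iio]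
      constructor
      · rintro ⟨h1, h2⟩
        obtain ⟨j, rfl⟩ := Nat.exists_eq_add_of_le' h1
        exact ⟨j, (hm j).1 h2, rfl⟩
      · rintro ⟨j, hj, rfl⟩
        exact ⟨Nat.succ_pos j, (hm j).2 hj⟩
    have hle : ∀ j ∈ Finset.range m, (M.time (j + 1) ω).toNNReal ≤ T := fun j hj => by
      simpa using ENNReal.toNNReal_mono ENNReal.coe_ne_top ((hm j).2 (Finset.mem_range.1 hj))
    rw [hset, finprod_mem_coe_finset, Finset.prod_image fun _ _ _ _ h => Nat.succ_injective h,
      Finset.filter_true_of_mem fun j hj => (hle j hj).trans_lt (lt_add_one T)]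
    exact Finset.prod_congr rfl fun j hj => (hb.controlField_eq (hle j hj) _).symm

lemma controlMeasure_eq (h : ControlHypothesis M T r l g Cr Cl) (hu : Admissible M u) :
    C.controlMeasure T r u = P.withDensity fun ω =>
      ENNReal.ofReal (C.doleans T (controlField M r u Cr) 0 (T + 1) ω) := by
  refine withDensity_congr_ae ?_
  filter_upwards [C.ae_regular, h.bounds] with ω hω hb
  rw [hω.density_eq h hu hb]

lemma mass_exp_ne_top {a : ℝ} (hexp : ∫⁻ ω, ENNReal.ofReal (Real.exp (a * C.A T ω)) ∂P < ∞) :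
    ∫⁻ ω, ENNReal.ofReal (Real.exp (a * C.mass T ω)) ∂P ≠ ∞ := by
  refine ne_of_eq_of_ne (lintegral_congr_ae ?_) hexp.ne
  filter_upwards [C.ae_regular] with ω hω
  rw [hω.mass_eq]

lemma isProbabilityMeasure_controlMeasure [IsProbabilityMeasure P]
    (h : ControlHypothesis M T r l g Cr Cl)
    (hE : ∫⁻ ω, ENNReal.ofReal (Real.exp ((3 + Cr ^ 4) * C.mass T ω)) ∂P ≠ ∞)
    (hu : Admissible M u) : IsProbabilityMeasure (C.controlMeasure T r u) := by
  rw [controlMeasure_eq h hu]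
  refine ⟨?_⟩
  rw [withDensity_apply _ MeasurableSet.univ, Measure.restrict_univ]
  exact lintegral_doleans_end_eq_one (h.isBddField hu) hE

/-- The two processes can differ only at the countably many times `T_n`, which the atomless clock
does not charge. -/
lemma ae_X_eq_leftX (ω : Ω) : ∀ᵐ t ∂(C.clock T ω), M.X t ω = M.leftX t ω := by
  have hc : (range fun n => (M.time n ω).toNNReal).Countable := countable_range _
  filter_upwards [measure_eq_zero_iff_ae_notMem.1 (hc.measure_zero (C.clock T ω))] with t ht
  refine M.X_eq_leftX fun n hn => ht ⟨n, ?_⟩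
  simp only [hn, ENNReal.toNNReal_coe]

lemma Regular.pathCost_eq {ω : Ω} (hω : C.Regular ω) :
    C.pathCost T l g u ω =
      (∫ t, l t ω (M.leftX t ω) (u t ω) ∂(C.clock T ω)) + g ω (M.X T ω) := by
  rw [pathCost, ← hω.clock_eq]
  congr 1
  refine integral_congr_ae ?_
  filter_upwards [C.ae_X_eq_leftX ω] with t ht
  rw [ht]

lemma integrable_pathCost [IsProbabilityMeasure P] (h : ControlHypothesis M T r l g Cr Cl)
    (hE : ∫⁻ ω, ENNReal.ofReal (Real.exp ((3 + Cr ^ 4) * C.mass T ω)) ∂P ≠ ∞) {β : ℝ}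
    (hβ : 0 < β)
    (hg : ∫⁻ ω, ENNReal.ofReal (|g ω (M.X T ω)| ^ 2 * Real.exp (β * C.A T ω)) ∂P < ∞)
    (hu : Admissible M u) : Integrable (C.pathCost T l g u) (C.controlMeasure T r u) := by
  have hR := h.isBddField hu
  set L : Ω → ℝ := fun ω => C.doleans T (controlField M r u Cr) 0 (T + 1) ω with hL
  have hL0 : ∀ ω, 0 ≤ L ω := fun ω => doleans_nonneg T hR _ ω
  have hLm : Measurable L := measurable_doleans_end T hR _
  rw [controlMeasure_eq h hu, integrable_withDensity_iff_integrable_smul' hLm.ennreal_ofReal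
    (ae_of_all _ fun _ => ENNReal.ofReal_lt_top)]
  have hlm := measurable_integral_clock (C := C) (T := T) (h.measurable_leftX_cost hu)
  have i1 : Integrable (fun ω => L ω * ∫ t, l t ω (M.leftX t ω) (u t ω) ∂(C.clock T ω)) P := by
    refine ((integrable_doleans_mul_mass hR hE).const_mul Cl).mono' (hLm.mul hlm).aestronglyMeasurable ?_
    filter_upwards [h.bounds] with ω hb
    rw [norm_mul, Real.norm_of_nonneg (hL0 ω), mul_left_comm]
    refine mul_le_mul_of_nonneg_left ?_ (hL0 ω)
    refine norm_integral_le_of_norm_le_const ?_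
    filter_upwards [C.ae_mem_Ioc_clock T ω] with t ht
    exact (hb t ht.2 _ _).2.2
  have i2 : Integrable (fun ω => L ω * g ω (M.X T ω)) P := by
    have j1 : Integrable (fun ω => L ω ^ 2) P := integrable_of_lintegral_ofReal_ne_top
      (hLm.pow_const 2) (fun _ => sq_nonneg _) (lintegral_doleans_sq_ne_top hR hE)
    -- The weight `exp(β A_T)` is at least one; `L g` is then a product of two square integrable
    -- variables.
    have j2 : Integrable (fun ω => g ω (M.X T ω) ^ 2) P := by
      refine integrable_of_lintegral_ofReal_ne_top (h.measurable_g.pow_const 2)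
        (fun _ => sq_nonneg _) (ne_top_of_le_ne_top hg.ne (lintegral_mono_ae ?_))
      filter_upwards [C.ae_regular] with ω hω
      refine ENNReal.ofReal_le_ofReal ?_
      rw [sq_abs]
      exact le_mul_of_one_le_right (sq_nonneg _)
        (Real.one_le_exp (mul_nonneg hβ.le (hω.A_nonneg T)))
    refine (j1.add j2).mono' (hLm.mul h.measurable_g).aestronglyMeasurable (ae_of_all _ fun ω => ?_)
    simp only [Pi.add_apply, Real.norm_eq_abs]
    rw [abs_le]
    constructor <;> nlinarith [sq_nonneg (L ω + g ω (M.X T ω)), sq_nonneg (L ω - g ω (M.X T ω)),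
      sq_nonneg (L ω), sq_nonneg (g ω (M.X T ω))]
  refine (i1.add i2).congr ?_
  filter_upwards [C.ae_regular] with ω hω
  rw [hω.pathCost_eq, Pi.add_apply, ENNReal.toReal_ofReal (hL0 ω), smul_eq_mul, mul_add]

variable {Z : ℝ≥0 → Ω → K → ℝ} {β : ℝ}

lemma MemL2.lintegral_comp_ne_top [IsProbabilityMeasure P] (hZ : C.MemL2 T β Z) (hβ : 0 < β) :
    ∫⁻ ω, ∫⁻ z, ENNReal.ofReal |Z z.1 ω z.2| ∂(C.comp T ω) ∂P ≠ ∞ := by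
  have := hZ.lintegral_mul_ne_top hβ (L := fun _ => 1) measurable_const (fun _ => zero_le_one)
    (by simp)
  simpa using this

lemma measurable_path (hZ : Measurable[M.filtration.predictable.prod mK]
    (fun x : (ℝ≥0 × Ω) × K => Z x.1.1 x.1.2 x.2)) (ω : Ω) :
    Measurable fun z : ℝ≥0 × K => Z z.1 ω z.2 := by
  have hZm : Measurable fun x : PredSpace M × K => Z x.1.time x.1.pt x.2 := hZ
  exact hZm.comp (measurable_section M ω)

lemma MemL2.memL1 [IsProbabilityMeasure P] (hZ : C.MemL2 T β Z) (hβ : 0 < β) : C.MemL1 T Z := by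
  refine ⟨hZ.1, lt_top_iff_ne_top.2 (ne_of_eq_of_ne (lintegral_congr_ae ?_)
    (hZ.lintegral_comp_ne_top hβ))⟩
  filter_upwards [C.ae_regular] with ω hω
  rw [C.lintegral_comp T (f := fun z : ℝ≥0 × K => ENNReal.ofReal |Z z.1 ω z.2|)
    (measurable_path hZ.1 ω).abs.ennreal_ofReal, hω.clock_eq]
  rfl

lemma MemL2.ae_integrable_comp [IsProbabilityMeasure P] (hZ : C.MemL2 T β Z) (hβ : 0 < β) :
    ∀ᵐ ω ∂P, Integrable (fun z => Z z.1 ω z.2) (C.comp T ω) := by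
  have hZm : Measurable fun x : PredSpace M × K => Z x.1.time x.1.pt x.2 := hZ.1
  exact (integral_integral_eq (fun G hG => C.measurable_lintegral_comp T hG) hZm
    (hZ.lintegral_comp_ne_top hβ)).1

/-- The Hamiltonian before minimization, evaluated along the control `u`. -/
noncomputable def preHamiltonian (C : Compensator M) (r l : ℝ≥0 → Ω → K → U → ℝ)
    (Z : ℝ≥0 → Ω → K → ℝ) (u : ℝ≥0 → Ω → U) (t : ℝ≥0) (ω : Ω) : ℝ :=
  l t ω (M.leftX t ω) (u t ω) + ∫ y, Z t ω y * (r t ω y (u t ω) - 1) ∂(C.φ t ω)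

/-- An infimum of reals lies below its terms only if the family is bounded below. The bound `-Cl -
Cr ∫ |Z| φ` works since `|r - 1| ≤ Cr`, which needs `Cr ≥ 1`. -/
lemma hamiltonian_le {ω : Ω} (hb : PathBounds T r l Cr Cl ω) (hCr : 1 ≤ Cr) {t : ℝ≥0} (ht : t ≤ T)
    (hi : Integrable (fun y => Z t ω y) (C.φ t ω)) (u : ℝ≥0 → Ω → U) :
    C.hamiltonian r l ω t (M.leftX t ω) (Z t ω) ≤ C.preHamiltonian r l Z u t ω := by
  refine ciInf_le (f := fun v : U => l t ω (M.leftX t ω) v +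
    ∫ y, Z t ω y * (r t ω y v - 1) ∂(C.φ t ω)) ?_ (u t ω)
  refine ⟨-Cl - ∫ y, |Z t ω y| * Cr ∂(C.φ t ω), ?_⟩
  rintro _ ⟨v, rfl⟩
  have h1 := (abs_le.1 (hb t ht (M.leftX t ω) v).2.2).1
  have h2 : ‖∫ y, Z t ω y * (r t ω y v - 1) ∂(C.φ t ω)‖ ≤ ∫ y, |Z t ω y| * Cr ∂(C.φ t ω) := by
    refine norm_integral_le_of_norm_le (hi.abs.mul_const Cr) (ae_of_all _ fun y => ?_)
    rw [norm_mul, Real.norm_eq_abs, Real.norm_eq_abs]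
    refine mul_le_mul_of_nonneg_left ?_ (abs_nonneg _)
    have h3 := hb t ht y v
    exact abs_le.2 ⟨by linarith [h3.1], by linarith [h3.2.1]⟩
  have h3 := (abs_le.1 h2).1
  simp only
  linarith

lemma integral_preHamiltonian (h : ControlHypothesis M T r l g Cr Cl) (hu : Admissible M u)
    {ω : Ω} (hb : PathBounds T r l Cr Cl ω)
    (hi : Integrable (fun z => Z z.1 ω z.2) (C.comp T ω)) :
    Integrable (fun t => C.preHamiltonian r l Z u t ω) (C.clock T ω) ∧
    ∫ t, C.preHamiltonian r l Z u t ω ∂(C.clock T ω) =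
      (∫ t, l t ω (M.leftX t ω) (u t ω) ∂(C.clock T ω)) +
      (∫ z, Z z.1 ω z.2 * controlField M r u Cr (PredSpace.mk M (z.1, ω), z.2) ∂(C.comp T ω)) -
      ∫ z, Z z.1 ω z.2 ∂(C.comp T ω) := by
  have hR := h.isBddField hu
  have hiR : Integrable (fun z => Z z.1 ω z.2 *
      controlField M r u Cr (PredSpace.mk M (z.1, ω), z.2)) (C.comp T ω) := by
    refine (hi.abs.mul_const Cr).mono' (hi.aestronglyMeasurable.mul
      (hR.measurable.comp (measurable_section M ω)).aestronglyMeasurable) (ae_of_all _ fun z => ?_)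
    rw [norm_mul, Real.norm_eq_abs, Real.norm_of_nonneg (hR.nonneg _)]
    exact mul_le_mul_of_nonneg_left (hR.le _) (abs_nonneg _)
  obtain ⟨a1, b1⟩ := C.integrable_comp T hi
  obtain ⟨a2, b2⟩ := C.integrable_comp T hiR
  have hl : Integrable (fun t => l t ω (M.leftX t ω) (u t ω)) (C.clock T ω) := by
    refine Integrable.of_bound ((h.measurable_leftX_cost hu).comp
      (measurable_id.prodMk measurable_const)).aestronglyMeasurable Cl ?_
    filter_upwards [C.ae_mem_Ioc_clock T ω] with t ht
    exact (hb t ht.2 _ _).2.2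
  have heq : (fun t => C.preHamiltonian r l Z u t ω) =ᵐ[C.clock T ω] fun t =>
      l t ω (M.leftX t ω) (u t ω) +
      (∫ y, Z t ω y * controlField M r u Cr (PredSpace.mk M (t, ω), y)
        ∂(C.kernel (PredSpace.mk M (t, ω)))) -
      ∫ y, Z t ω y ∂(C.kernel (PredSpace.mk M (t, ω))) := by
    filter_upwards [C.ae_mem_Ioc_clock T ω, a1, a2] with t ht h1 h2
    rw [preHamiltonian, add_sub_assoc, ← integral_sub h2 h1]
    congr 1
    refine integral_congr_ae (ae_of_all _ fun y => ?_)
    simp only [hb.controlField_eq ht.2, mul_sub, mul_one]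
  refine ⟨((hl.add b2).sub b1).congr heq.symm, ?_⟩
  rw [integral_congr_ae heq, C.integral_comp T hi, C.integral_comp T hiR]
  exact (integral_sub (hl.add b2) b1).trans (congrArg (· - _) (integral_add hl b2))

/-- The BSDE at `t = 0`, with `q` split into jump measure and compensator; they are treated
separately because only the former changes its mean to `R φ dA` under `P_u`. -/
lemma Regular.initial_value_eq {ω : Ω} (hω : C.Regular ω) {Y : ℝ≥0 → Ω → ℝ}
    (hi : Integrable (fun z => Z z.1 ω z.2) (C.comp T ω))
    (hY : Y 0 ω + C.stochInt T Z 0 ω =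
      g ω (M.X T ω) + ∫ s in Ioc 0 T, C.hamiltonian r l ω s (M.X s ω) (Z s ω) ∂(C.dA T ω)) :
    Y 0 ω = g ω (M.X T ω) +
      (∫ t, C.hamiltonian r l ω t (M.leftX t ω) (Z t ω) ∂(C.clock T ω)) -
      (∫ z, Z z.1 ω z.2 ∂(C.jumps T ω)) + ∫ z, Z z.1 ω z.2 ∂(C.comp T ω) := by
  have hrestrict : (C.dA T ω).restrict (Ioc 0 T) = C.clock T ω := by
    rw [hω.clock_eq, dA, Measure.restrict_restrict measurableSet_Ioc, inter_self]
  have hJ : (M.p ω).restrict (Ioc 0 T ×ˢ univ) = C.jumps T ω := by rw [jumps, if_pos hω]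
  have hham : ∫ t, C.hamiltonian r l ω t (M.X t ω) (Z t ω) ∂(C.clock T ω) =
      ∫ t, C.hamiltonian r l ω t (M.leftX t ω) (Z t ω) ∂(C.clock T ω) := by
    refine integral_congr_ae ?_
    filter_upwards [C.ae_X_eq_leftX ω] with t ht
    rw [ht]
  have hcomp : ∫ z, Z z.1 ω z.2 ∂(C.comp T ω) =
      ∫ s, (∫ y, Z s ω y ∂(C.φ s ω)) ∂(C.clock T ω) := C.integral_comp T hi
  rw [stochInt, hrestrict, hJ, hham, ← hcomp] at hY
  linarith

/-- Verification: the initial value of a solution of the BSDE is a lower bound for the cost, and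
it is the cost of any minimizing selector. -/
lemma initial_value_le_J [IsProbabilityMeasure P] (h : ControlHypothesis M T r l g Cr Cl)
    (hE : ∫⁻ ω, ENNReal.ofReal (Real.exp ((3 + Cr ^ 4) * C.mass T ω)) ∂P ≠ ∞)
    (hβ : 0 < β)
    (hg : ∫⁻ ω, ENNReal.ofReal (|g ω (M.X T ω)| ^ 2 * Real.exp (β * C.A T ω)) ∂P < ∞)
    {Y : ℝ≥0 → Ω → ℝ} (hZ : C.MemL2 T β Z) (hYZ : C.SolvesBSDE T r l g Y Z)
    {y₀ : ℝ} (hy₀ : ∀ᵐ ω ∂P, Y 0 ω = y₀) {u₀ : ℝ≥0 → Ω → U} (hu₀ : Admissible M u₀)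
    (hmin₀ : C.IsMinimizingSelector T r l Z u₀) (hu : Admissible M u) :
    y₀ ≤ C.J T r l g u ∧ (C.IsMinimizingSelector T r l Z u → y₀ = C.J T r l g u) := by
  have hR := h.isBddField hu
  have hZm : Measurable fun x : PredSpace M × K => Z x.1.time x.1.pt x.2 := hZ.1
  have hν := controlMeasure_eq (C := C) h hu
  have hprob := isProbabilityMeasure_controlMeasure h hE hu
  have hcost := integrable_pathCost h hE hβ hg hu
  have hac : C.controlMeasure T r u ≪ P := withDensity_absolutelyContinuous _ _
  set ν := C.controlMeasure T r u with hνdef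
  have hLm := measurable_doleans_end (C := C) T (a := 0) hR (T + 1)
  have hfin : ∫⁻ ω, ∫⁻ z, ENNReal.ofReal |Z z.1 ω z.2| ∂(C.comp T ω) ∂ν ≠ ∞ := by
    have hm := C.measurable_lintegral_comp T hZm.abs.ennreal_ofReal
    rw [hν]
    refine ne_of_eq_of_ne (lintegral_withDensity_eq_lintegral_mul _ hLm.ennreal_ofReal hm) ?_
    exact hZ.lintegral_mul_ne_top hβ hLm (doleans_nonneg T hR _) (lintegral_doleans_sq_ne_top hR hE)
  obtain ⟨i1, i2, e⟩ := integral_jumps_eq_integral_comp hR (zero_le_one.trans h.one_lt_Cr.le) hE hν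
    hZm hfin
  -- A term of mean zero under `P_u` is added: the integral of `Z` against `R φ dA` minus that
  -- against the jumps.
  have hJ : C.J T r l g u = ∫ ω, (C.pathCost T l g u ω + (∫ z, Z z.1 ω z.2 *
      controlField M r u Cr (PredSpace.mk M (z.1, ω), z.2) ∂(C.comp T ω)) -
      ∫ z, Z z.1 ω z.2 ∂(C.jumps T ω)) ∂ν := by
    refine Eq.trans ?_ (integral_sub (hcost.add i2) i1).symm
    refine Eq.trans ?_ (congrArg (· - _) (integral_add hcost i2).symm)
    refine Eq.trans ?_ (congrArg (_ - ·) e.symm)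
    exact (add_sub_cancel_right _ _).symm
  have hconst : y₀ = ∫ _ω, y₀ ∂ν := by simp
  -- The pathwise form of the verification identity: the random variable whose mean is `J(u)`, minus
  -- the integrated gap between `preHamiltonian` and its infimum.
  have hpath : ∀ᵐ ω ∂P, y₀ = C.pathCost T l g u ω + (∫ z, Z z.1 ω z.2 *
      controlField M r u Cr (PredSpace.mk M (z.1, ω), z.2) ∂(C.comp T ω)) -
      (∫ z, Z z.1 ω z.2 ∂(C.jumps T ω)) -
      ((∫ t, C.preHamiltonian r l Z u t ω ∂(C.clock T ω)) -
      ∫ t, C.hamiltonian r l ω t (M.leftX t ω) (Z t ω) ∂(C.clock T ω)) := by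
    filter_upwards [C.ae_regular, h.bounds, hZ.ae_integrable_comp hβ, hYZ, hy₀]
      with ω hω hb hi hY hy
    have h1 := hω.initial_value_eq hi (hY 0 (zero_le))
    have h2 := (integral_preHamiltonian h hu hb hi).2
    rw [hω.pathCost_eq, ← hy, h1, h2]
    ring
  have htotal := (hcost.add i2).sub i1
  refine ⟨?_, fun hmin => ?_⟩
  · rw [hJ, hconst]
    refine integral_mono_ae (integrable_const _) htotal (hac.ae_le ?_)
    filter_upwards [hpath, C.ae_regular, h.bounds, hZ.ae_integrable_comp hβ, hmin₀]
      with ω hp hω hb hi hm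
    refine hp.trans_le (sub_le_self _ (sub_nonneg.2 ?_))
    rw [← hω.clock_eq] at hm
    -- An infimum over an arbitrary `U` need not be measurable in `t`. The selector `u₀` represents
    -- it almost everywhere by an integrable function, so that the integrals can be compared.
    have h0 : (fun t => C.hamiltonian r l ω t (M.leftX t ω) (Z t ω)) =ᵐ[C.clock T ω]
      fun t => C.preHamiltonian r l Z u₀ t ω := hm
    refine integral_mono_ae ((integral_preHamiltonian h hu₀ hb hi).1.congr h0.symm)
      (integral_preHamiltonian h hu hb hi).1 ?_
    filter_upwards [C.ae_mem_Ioc_clock T ω, (C.integrable_comp T hi).1] with t ht hit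
    exact hamiltonian_le hb h.one_lt_Cr.le ht.2 hit u
  · rw [hJ, hconst]
    refine integral_congr_ae (hac.ae_le ?_)
    filter_upwards [hpath, C.ae_regular, hmin] with ω hp hω hm
    rw [← hω.clock_eq] at hm
    have h0 : ∫ t, C.hamiltonian r l ω t (M.leftX t ω) (Z t ω) ∂(C.clock T ω) =
      ∫ t, C.preHamiltonian r l Z u t ω ∂(C.clock T ω) := integral_congr_ae hm
    rwa [h0, sub_self, sub_zero] at hp

end Compensator

/-- A selector exists for the zero field, and its values are elements of `U`. -/
lemma HamiltonianHypothesis.nonempty (h : HamiltonianHypothesis C T r l) (ω : Ω) : Nonempty U := by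
  obtain ⟨u, -⟩ := h (fun _ _ _ => 0)
    ⟨@measurable_const ℝ _ _ (M.filtration.predictable.prod mK) 0, by simp⟩
  exact ⟨u 0 ω⟩

end MPPControl

open MPPControl
theorem theorem4p3 {Ω K U : Type*} [MeasurableSpace Ω] [MeasurableSpace K] [MeasurableSpace U]
    (P : Measure Ω) [IsProbabilityMeasure P] [P.IsComplete]
    (M : MarkedPointProcess P K) (C : Compensator M) (T : ℝ≥0) (hT : 0 < T)
    (r l : ℝ≥0 → Ω → K → U → ℝ) (g : Ω → K → ℝ) (Cr Cl : ℝ)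
    (hcontrol : ControlHypothesis M T r l g Cr Cl)
    (hhamiltonian : HamiltonianHypothesis C T r l)
    (hexp : ∫⁻ ω, ENNReal.ofReal (Real.exp ((3 + Cr ^ 4) * C.A T ω)) ∂P < ∞)
    (β : ℝ)
    (hβ : ∃ c < β, ∀ᵐ ω ∂P, ∀ t ≤ T, ∀ (y : K) (u : U), |r t ω y u - 1| ^ 2 ≤ c)
    (hexpβ : ∫⁻ ω, ENNReal.ofReal (Real.exp (β * C.A T ω)) ∂P < ∞)
    (hg : ∫⁻ ω, ENNReal.ofReal (|g ω (M.X T ω)| ^ 2 * Real.exp (β * C.A T ω)) ∂P < ∞)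
    (Y : ℝ≥0 → Ω → ℝ) (Z : ℝ≥0 → Ω → K → ℝ)
    (hY : C.MemL2Prog T β Y) (hZ : C.MemL2 T β Z) (hYZ : C.SolvesBSDE T r l g Y Z) :
    (∀ u : ℝ≥0 → Ω → U, Admissible M u →
      IsProbabilityMeasure (C.controlMeasure T r u) ∧
        Integrable (C.pathCost T l g u) (C.controlMeasure T r u)) ∧
    (∃ ustar : ℝ≥0 → Ω → U, Admissible M ustar ∧ C.IsMinimizingSelector T r l Z ustar) ∧
    (∀ ustar : ℝ≥0 → Ω → U, Admissible M ustar → C.IsMinimizingSelector T r l Z ustar →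
      (∀ᵐ ω ∂P, Y 0 ω = C.J T r l g ustar) ∧
        IsLeast (C.J T r l g '' {u | Admissible M u}) (C.J T r l g ustar)) := by
  have hE := Compensator.mass_exp_ne_top hexp
  -- `β` exceeds a bound for `|r - 1|^2`; positivity follows by evaluating it at one path, mark and
  -- control, which requires `U` to be nonempty.
  have hβ0 : 0 < β := by
    obtain ⟨c, hc, h⟩ := hβ
    obtain ⟨ω, hω⟩ := h.exists
    obtain ⟨u⟩ := hhamiltonian.nonempty ω
    exact ((sq_nonneg _).trans (hω 0 (zero_le) M.initMark u)).trans_lt hc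
  obtain ⟨u₀, hu₀, hmin₀⟩ := hhamiltonian Z (hZ.memL1 hβ0)
  obtain ⟨y₀, hy₀⟩ := M.exists_ae_eq_const C (hY.1.stronglyAdapted 0)
  have key := fun {u : ℝ≥0 → Ω → U} (hu : Admissible M u) =>
    Compensator.initial_value_le_J hcontrol hE hβ0 hg hZ hYZ hy₀ hu₀ hmin₀ hu
  refine ⟨fun u hu => ⟨Compensator.isProbabilityMeasure_controlMeasure hcontrol hE hu,
    Compensator.integrable_pathCost hcontrol hE hβ0 hg hu⟩, ⟨u₀, hu₀, hmin₀⟩,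
    fun ustar hu hmin => ?_⟩
  have hJ := (key hu).2 hmin
  refine ⟨hJ ▸ hy₀, ⟨ustar, hu, rfl⟩, ?_⟩
  rintro _ ⟨u, hu', rfl⟩
  exact hJ ▸ (key hu').1
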